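/- Let $p$ be a prime, $q=p^m$, and let $\gamma_1,\dots,\gamma_m$ be a basis of $\mathbb F_q$ over $\mathbb F_p$. Let $f\in\mathbb F_q[t][X]$ be separable as a polynomial over $K=\mathbb F_q(t)$, let $n=\deg_X f$, and let $\ell_f\in\mathbb F_q[t]$ be its leading coefficient. Write $\deg_t(f)$ for its $t$-degree. Let $v\in\mathbb F_q[t]$ be irreducible with $v\nmid \ell_f$ and such that $f \bmod v$ is separable over $\mathbb F_q[t]/(v)$. Let $K_v$ be the completion of $K$ at $v$, with ring of integers $\mathcal O_v$, and let $$f=\ell_f f_1\cdots f_r$$ be the factorization of $f$ in $\mathcal O_v[X]$ with $f_1,\dots,f_r$ monic and irreducible. Let $W\subseteq\mathbb F_p^r$ be the subspace spanned by the exponent vectors $(w_1,\dots,w_r)$ modulo $p$ of the monic irreducible factors $g=f_1^{w_1}\cdots f_r^{w_r}$ of $f$ in $K[X]$. Fix $\ell\ge 0$ and let $\sigma$ be the degree of $v^\ell$. For $a\in\mathcal O_v$ let $a \bmod v^\ell$ be its unique lift to $\mathbb F_q[t]$ of degree $<\sigma$, and extend this to polynomials coefficientwise. Put $\Phi(g)=f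 g'/g$ (derivative with respect to $X$) and write $$\Phi(f_j)\bmod v^\ell=\sum_{i=0}^{n-1}a_{i,j}X^i\qquad(1\le j\le r).$$ Let $A_i$ ($0\le i<n$) be the matrix over $\mathbb F_q$ whose $j$-th column consists of the coefficients of $t^{\deg_t(f)+1},\dots,t^{\sigma-1}$ in $a_{i,j}$. Let $\tilde A_i$ be the matrix over $\mathbb F_p$ obtained from $A_i$ by replacing every entry by the column of its coordinates in the basis $\gamma_1,\dots,\gamma_m$. Let $L'\subseteq\mathbb F_p^r$ be the intersection of the kernels of $\tilde A_0,\dots,\tilde A_{n-1}$. **Theorem.** 1. If $\sigma>(2n-1)\deg_t(f)$, then $L'=W$. 2. There is a single deterministic algorithm that takes as input an arbitrary finite field $\mathbb F_q$ with $q=p^m$ (given by $p$ and the multiplication table of a basis over $\mathbb F_p$) and an arbitrary $f\in\mathbb F_q[t][X]$ that is separable over $\mathbb F_q(t)$, and that outputs the factorization $f=\ell_f g_1\cdots g_s$ into monic irreducible polynomials $g_j\in\mathbb F_q(t)[X]$, in the form of the list $\ell_f g_1,\dots,\ell_f g_s\in\mathbb F_q[t][X]$. Its number of elementary steps is bounded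 by a polynomial in $\deg_X f$, $\deg_t f$, $p$ and $m=\log_p q$. (Elementary steps are those of the WHILE language on binary trees: building, following, copying or testing one pointer.) In particular, for fixed $\mathbb F_q$, factorization over $\mathbb F_q(t)$ takes time polynomial in $\deg_X f$ and $\deg_t f$. -/

import Mathlib

open Polynomial IsDedekindDomain

universe u

noncomputable section

namespace FactorFqt

variable {F : Type u} [Field F]

/-! ### The finite place and its completion

`F` is the finite field `𝔽_q`, `F[X]` is the ring `𝓞 = 𝔽_q[t]` (its variable is `t`),
`RatFunc F` is `K = 𝔽_q(t)`, and `F[X][X]` is `𝔽_q[t][X]`. -/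

/-- The finite place of `𝔽_q(t)` given by the irreducible polynomial `v ∈ 𝔽_q[t]`. -/
def place (v : F[X]) (hv : Irreducible v) : HeightOneSpectrum F[X] where
  asIdeal := Ideal.span {v}
  isPrime := (Ideal.span_singleton_prime hv.ne_zero).mpr hv.prime
  ne_bot := by simpa using hv.ne_zero

/-- The completion `K_v` of `K = 𝔽_q(t)` at `v`. -/
abbrev Kv (v : F[X]) (hv : Irreducible v) : Type u :=
  (place v hv).adicCompletion (RatFunc F)

/-- The ring of integers `𝓞_v` of `K_v`. -/
abbrev Ov (v : F[X]) (hv : Irreducible v) : Type u :=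
  (place v hv).adicCompletionIntegers (RatFunc F)

lemma valued_pow (v : F[X]) (hv : Irreducible v) (ℓ : ℕ) :
    Valued.v ((algebraMap F[X] (Ov v hv) (v ^ ℓ) : Ov v hv) : Kv v hv) =
      WithZero.exp (-(ℓ : ℤ)) := by
  have h := HeightOneSpectrum.valuedAdicCompletion_eq_valuation'
    (v := place v hv) (algebraMap F[X] (RatFunc F) (v ^ ℓ))
  rw [HeightOneSpectrum.algebraMap_adicCompletionIntegers_apply]
  refine h.trans ?_
  rw [HeightOneSpectrum.valuation_of_algebraMap, map_pow,
    (place v hv).intValuation_singleton hv.ne_zero rfl, ← WithZero.exp_nsmul]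
  simp

lemma pow_dvd_iff (v : F[X]) (hv : Irreducible v) (ℓ : ℕ) (a : Ov v hv) :
    algebraMap F[X] (Ov v hv) (v ^ ℓ) ∣ a ↔
      Valued.v (a : Kv v hv) ≤ WithZero.exp (-(ℓ : ℤ)) := by
  have hp := valued_pow v hv ℓ
  constructor
  · rintro ⟨c, rfl⟩
    have hc : Valued.v (c : Kv v hv) ≤ 1 := c.2
    rw [MulMemClass.coe_mul, map_mul, hp]
    exact mul_le_of_le_one_right' hc
  · intro h
    have hne : ((algebraMap F[X] (Ov v hv) (v ^ ℓ) : Ov v hv) : Kv v hv) ≠ 0 := by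
      intro h0
      rw [h0, map_zero] at hp
      exact WithZero.exp_ne_zero hp.symm
    refine ⟨⟨(a : Kv v hv) / (algebraMap F[X] (Ov v hv) (v ^ ℓ) : Ov v hv), ?_⟩, ?_⟩
    · rw [HeightOneSpectrum.mem_adicCompletionIntegers, map_div₀, hp]
      exact div_le_one_of_le₀ h zero_le
    · apply Subtype.ext
      rw [MulMemClass.coe_mul]
      exact (mul_div_cancel₀ _ hne).symm

lemma algebraMap_pow_dvd_iff (v : F[X]) (hv : Irreducible v) (ℓ : ℕ) (b : F[X]) :
    algebraMap F[X] (Ov v hv) (v ^ ℓ) ∣ algebraMap F[X] (Ov v hv) b ↔ v ^ ℓ ∣ b := by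
  have h := HeightOneSpectrum.valuedAdicCompletion_eq_valuation'
    (v := place v hv) (algebraMap F[X] (RatFunc F) b)
  rw [pow_dvd_iff, HeightOneSpectrum.algebraMap_adicCompletionIntegers_apply]
  erw [h]
  rw [HeightOneSpectrum.valuation_of_algebraMap,
    HeightOneSpectrum.intValuation_le_pow_iff_mem]
  simp [place, Ideal.span_singleton_pow, Ideal.mem_span_singleton]

/-- Every element of `𝓞_v` is congruent modulo `v ^ ℓ` to an element of `𝔽_q[t]`. -/
lemma exists_approx (v : F[X]) (hv : Irreducible v) (ℓ : ℕ) (a : Ov v hv) :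
    ∃ b : F[X], algebraMap F[X] (Ov v hv) (v ^ ℓ) ∣ a - algebraMap F[X] (Ov v hv) b := by
  obtain ⟨π, hπ⟩ : ∃ π : Kv v hv,
      π = ((algebraMap F[X] (Ov v hv) (v ^ ℓ) : Ov v hv) : Kv v hv) := ⟨_, rfl⟩
  have hp : Valued.v π = WithZero.exp (-(ℓ : ℤ)) := by rw [hπ]; exact valued_pow v hv ℓ
  have hopen : IsOpen ((fun y : Kv v hv => (y - (a : Kv v hv)) * π⁻¹) ⁻¹'
      ((Valued.v : Valuation (Kv v hv) _).valuationSubring : Set (Kv v hv))) :=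
    (Valued.isOpen_valuationSubring (Kv v hv)).preimage
      ((continuous_id.sub continuous_const).mul continuous_const)
  have hmem : (a : Kv v hv) ∈ (fun y : Kv v hv => (y - (a : Kv v hv)) * π⁻¹) ⁻¹'
      ((Valued.v : Valuation (Kv v hv) _).valuationSubring : Set (Kv v hv)) := by
    rw [Set.mem_preimage, sub_self, zero_mul]
    exact zero_mem _
  obtain ⟨k, hk⟩ := (HeightOneSpectrum.denseRange_algebraMap
    (K := RatFunc F) (v := place v hv)).exists_mem_open hopen ⟨_, hmem⟩
  have hk1 : Valued.v (algebraMap (RatFunc F) (Kv v hv) k - (a : Kv v hv)) ≤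
      WithZero.exp (-(ℓ : ℤ)) := by
    have h : Valued.v ((algebraMap (RatFunc F) (Kv v hv) k - (a : Kv v hv)) * π⁻¹) ≤ 1 := hk
    rw [map_mul, map_inv₀, hp] at h
    have h' := mul_le_mul_left h (WithZero.exp (-(ℓ : ℤ)))
    rwa [inv_mul_cancel_right₀ WithZero.exp_ne_zero, one_mul] at h'
  have hle : WithZero.exp (-(ℓ : ℤ)) ≤ (1 : WithZero (Multiplicative ℤ)) := by
    rw [← WithZero.exp_zero, WithZero.exp_le_exp]; simp
  have hk2 : (place v hv).valuation (RatFunc F) k ≤ 1 := by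
    have h := HeightOneSpectrum.valuedAdicCompletion_eq_valuation' (v := place v hv) k
    rw [← h]
    change Valued.v (algebraMap (RatFunc F) (Kv v hv) k) ≤ 1
    have h2 := Valuation.map_add Valued.v
      (algebraMap (RatFunc F) (Kv v hv) k - (a : Kv v hv)) (a : Kv v hv)
    rw [sub_add_cancel] at h2
    exact h2.trans (max_le (hk1.trans hle) a.2)
  obtain ⟨b, hb⟩ := (place v hv).exists_valuation_sub_lt_of_integer hk2
    (Units.mk0 (WithZero.exp (-(ℓ : ℤ))) WithZero.exp_ne_zero)
  refine ⟨b, (pow_dvd_iff v hv ℓ _).mpr ?_⟩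
  have h1 : Valued.v (algebraMap (RatFunc F) (Kv v hv) (algebraMap F[X] (RatFunc F) b - k)) ≤
      WithZero.exp (-(ℓ : ℤ)) := by
    refine le_trans (le_of_eq ?_) hb.le
    exact HeightOneSpectrum.valuedAdicCompletion_eq_valuation' (v := place v hv) _
  have h2 := (Valuation.map_add Valued.v _ _).trans (max_le h1 hk1)
  rw [map_sub, sub_add_sub_cancel] at h2
  rw [← Valuation.map_neg, ← NegMemClass.coe_neg, neg_sub]
  exact h2

lemma dvd_sub_mod' (b c : F[X]) : c ∣ b - b % c :=
  ⟨b / c, by rw [sub_eq_iff_eq_add]; exact (EuclideanDomain.div_add_mod b c).symm⟩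

/-- Every element of `𝓞_v` has a unique lift modulo `v ^ ℓ` to `𝔽_q[t]` whose degree is smaller
than the degree of `v ^ ℓ`. -/
theorem existsUnique_lift (v : F[X]) (hv : Irreducible v) (ℓ : ℕ) (a : Ov v hv) :
    ∃! b : F[X], b.degree < (v ^ ℓ).degree ∧
      algebraMap F[X] (Ov v hv) (v ^ ℓ) ∣ a - algebraMap F[X] (Ov v hv) b := by
  have hne : v ^ ℓ ≠ 0 := pow_ne_zero _ hv.ne_zero
  obtain ⟨b, hb⟩ := exists_approx v hv ℓ a
  refine ⟨b % v ^ ℓ, ⟨EuclideanDomain.mod_lt b hne, ?_⟩, ?_⟩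
  · have h : a - algebraMap F[X] (Ov v hv) (b % v ^ ℓ) =
        (a - algebraMap F[X] (Ov v hv) b) + algebraMap F[X] (Ov v hv) (b - b % v ^ ℓ) := by
      rw [map_sub]; ring
    rw [h]
    exact dvd_add hb ((algebraMap_pow_dvd_iff v hv ℓ _).mpr (dvd_sub_mod' b _))
  · rintro c ⟨hc, hc'⟩
    have h : v ^ ℓ ∣ c - b % v ^ ℓ := by
      have h1 : v ^ ℓ ∣ c - b := by
        rw [← algebraMap_pow_dvd_iff v hv, map_sub]
        have := dvd_sub hb hc'
        rwa [sub_sub_sub_cancel_left] at this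
      have h2 := dvd_add h1 (dvd_sub_mod' b (v ^ ℓ))
      rwa [sub_add_sub_cancel] at h2
    have hd : (c - b % v ^ ℓ).degree < (v ^ ℓ).degree :=
      (degree_sub_le _ _).trans_lt (max_lt hc (EuclideanDomain.mod_lt b hne))
    exact sub_eq_zero.mp (eq_zero_of_dvd_of_degree_lt h hd)

/-- `a mod v ^ ℓ`: the unique lift of `a ∈ 𝓞_v` to `𝔽_q[t]` of degree smaller than that of
`v ^ ℓ`. -/
def modPow (v : F[X]) (hv : Irreducible v) (ℓ : ℕ) (a : Ov v hv) : F[X] :=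
  (existsUnique_lift v hv ℓ a).choose

/-! ### Local factors, `K`-factors, and the space `W` -/

/-- The `t`-degree of `f ∈ 𝔽_q[t][X]`. -/
def degT (f : F[X][X]) : ℕ := f.support.sup fun i => (f.coeff i).natDegree

/-- `f` viewed as an element of `𝔽_q(t)[X]`. -/
def toK (f : F[X][X]) : (RatFunc F)[X] := f.map (algebraMap F[X] (RatFunc F))

/-- `f = ℓ_f f₁ ⋯ f_r` in `𝓞_v[X]` with monic irreducible `f_i` (the local factors). -/
def IsLocalFactorization (v : F[X]) (hv : Irreducible v) (f : F[X][X]) {r : ℕ}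
    (fl : Fin r → (Ov v hv)[X]) : Prop :=
  (∀ i, (fl i).Monic ∧ Irreducible (fl i)) ∧
    f.map (algebraMap F[X] (Ov v hv)) =
      C (algebraMap F[X] (Ov v hv) f.leadingCoeff) * ∏ i, fl i

/-- `w` is the exponent vector of the polynomial `g ∈ K[X]`: `g = f₁ ^ w₁ ⋯ f_r ^ w_r` in
`K_v[X]`. -/
def IsExponentVector (v : F[X]) (hv : Irreducible v) {r : ℕ} (fl : Fin r → (Ov v hv)[X])
    (g : (RatFunc F)[X]) (w : Fin r → ℕ) : Prop :=
  g.map (algebraMap (RatFunc F) (Kv v hv)) =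
    ∏ i, (fl i).map (algebraMap (Ov v hv) (Kv v hv)) ^ w i

/-- `W ⊆ 𝔽_p ^ r`: the space spanned by the exponent vectors of the monic irreducible factors of
`f` in `𝔽_q(t)[X]`. -/
def spaceW (p : ℕ) (v : F[X]) (hv : Irreducible v) (f : F[X][X]) {r : ℕ}
    (fl : Fin r → (Ov v hv)[X]) : Submodule (ZMod p) (Fin r → ZMod p) :=
  Submodule.span (ZMod p) {e | ∃ (g : (RatFunc F)[X]) (w : Fin r → ℕ),
    g.Monic ∧ Irreducible g ∧ g ∣ toK f ∧ IsExponentVector v hv fl g w ∧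
      e = fun i => (w i : ZMod p)}

/-! ### The matrices `A_i`, `Ã_i` and the space `L'` -/

/-- `Φ(g) = f g' / g` for a monic polynomial `g ∈ 𝓞_v[X]` dividing `f` (so that the division is
exact). -/
def Phi (v : F[X]) (hv : Irreducible v) (f : F[X][X]) (g : (Ov v hv)[X]) : (Ov v hv)[X] :=
  (f.map (algebraMap F[X] (Ov v hv)) * derivative g) /ₘ g

/-- The coefficient `a_{i,j} ∈ 𝔽_q[t]` of `X ^ i` in `Φ(f_j) mod v ^ ℓ`. -/
def coeffA (v : F[X]) (hv : Irreducible v) (f : F[X][X]) {r : ℕ} (fl : Fin r → (Ov v hv)[X])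
    (ℓ i : ℕ) (j : Fin r) : F[X] :=
  modPow v hv ℓ ((Phi v hv f (fl j)).coeff i)

/-- The matrix `A_i` over `𝔽_q`: column `j` consists of the coefficients of `t ^ m, …, t ^ (σ - 1)`
in `a_{i,j}`, where `m = deg_t f + 1` and `σ` is the degree of `v ^ ℓ`. -/
def matA (v : F[X]) (hv : Irreducible v) (f : F[X][X]) {r : ℕ} (fl : Fin r → (Ov v hv)[X])
    (ℓ i : ℕ) : Matrix (Fin ((v ^ ℓ).natDegree - (degT f + 1))) (Fin r) F :=
  Matrix.of fun k j => (coeffA v hv f fl ℓ i j).coeff (degT f + 1 + k)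

/-- The matrix `Ã_i` over `𝔽_p`: every entry of `A_i` is replaced by the column of its coordinates
with respect to the basis `γ` of `𝔽_q` over `𝔽_p`. -/
def matAtilde {p m : ℕ} [Fact p.Prime] [Algebra (ZMod p) F]
    (γ : Module.Basis (Fin m) (ZMod p) F) (v : F[X]) (hv : Irreducible v) (f : F[X][X])
    {r : ℕ} (fl : Fin r → (Ov v hv)[X]) (ℓ i : ℕ) :
    Matrix (Fin ((v ^ ℓ).natDegree - (degT f + 1)) × Fin m) (Fin r) (ZMod p) :=
  Matrix.of fun kl j => γ.repr (matA v hv f fl ℓ i kl.1 j) kl.2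

/-- `L' ⊆ 𝔽_p ^ r`: the intersection of the kernels of `Ã_0, …, Ã_{n-1}`, with `n = deg_X f`. -/
def spaceL' {p m : ℕ} [Fact p.Prime] [Algebra (ZMod p) F]
    (γ : Module.Basis (Fin m) (ZMod p) F) (v : F[X]) (hv : Irreducible v) (f : F[X][X])
    {r : ℕ} (fl : Fin r → (Ov v hv)[X]) (ℓ : ℕ) : Submodule (ZMod p) (Fin r → ZMod p) :=
  ⨅ i : Fin f.natDegree, LinearMap.ker (matAtilde γ v hv f fl ℓ i).mulVecLin

/-! ### A machine model with a step count

The WHILE language on binary trees: a program works on finitely many of the variables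
`x₀, x₁, …`, each holding (a pointer to) a binary tree.  An elementary instruction builds or
follows one pointer, or tests one pointer for `nil`, and costs one step. -/

/-- Binary trees, the data of the machine. -/
inductive Val : Type
  | nil : Val
  | cons : Val → Val → Val

/-- First component of a pair (and `nil` for `nil`). -/
def Val.hd : Val → Val
  | .nil => .nil
  | .cons a _ => a

/-- Second component of a pair (and `nil` for `nil`). -/
def Val.tl : Val → Val
  | .nil => .nil
  | .cons _ b => b

/-- Programs. -/
inductive Prog : Type
  /-- `x_i := nil` -/
  | nil (i : ℕ) : Prog
  /-- `x_i := x_j` -/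
  | copy (i j : ℕ) : Prog
  /-- `x_i := cons x_j x_k` -/
  | cons (i j k : ℕ) : Prog
  /-- `x_i := hd x_j` -/
  | hd (i j : ℕ) : Prog
  /-- `x_i := tl x_j` -/
  | tl (i j : ℕ) : Prog
  /-- first `c`, then `d` -/
  | seq (c d : Prog) : Prog
  /-- if `x_i ≠ nil` then `c` else `d` -/
  | ite (i : ℕ) (c d : Prog) : Prog
  /-- while `x_i ≠ nil` do `c` -/
  | loop (i : ℕ) (c : Prog) : Prog

/-- The contents of the variables. -/
abbrev Store : Type := ℕ → Val

/-- `Exec c s T s'`: started in the store `s`, the program `c` halts after exactly `T` steps, in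
the store `s'`. -/
inductive Exec : Prog → Store → ℕ → Store → Prop
  | nil (i : ℕ) (s : Store) : Exec (.nil i) s 1 (Function.update s i .nil)
  | copy (i j : ℕ) (s : Store) : Exec (.copy i j) s 1 (Function.update s i (s j))
  | cons (i j k : ℕ) (s : Store) :
      Exec (.cons i j k) s 1 (Function.update s i (.cons (s j) (s k)))
  | hd (i j : ℕ) (s : Store) : Exec (.hd i j) s 1 (Function.update s i (s j).hd)
  | tl (i j : ℕ) (s : Store) : Exec (.tl i j) s 1 (Function.update s i (s j).tl)
  | seq {c d : Prog} {s s₁ s₂ : Store} {T₁ T₂ : ℕ} :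
      Exec c s T₁ s₁ → Exec d s₁ T₂ s₂ → Exec (.seq c d) s (T₁ + T₂) s₂
  | ite_true {i : ℕ} {c d : Prog} {s s' : Store} {T : ℕ} :
      s i ≠ .nil → Exec c s T s' → Exec (.ite i c d) s (T + 1) s'
  | ite_false {i : ℕ} {c d : Prog} {s s' : Store} {T : ℕ} :
      s i = .nil → Exec d s T s' → Exec (.ite i c d) s (T + 1) s'
  | loop_true {i : ℕ} {c : Prog} {s s₁ s₂ : Store} {T₁ T₂ : ℕ} :
      s i ≠ .nil → Exec c s T₁ s₁ → Exec (.loop i c) s₁ T₂ s₂ →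
        Exec (.loop i c) s (T₁ + T₂ + 1) s₂
  | loop_false {i : ℕ} {c : Prog} {s : Store} :
      s i = .nil → Exec (.loop i c) s 1 s

/-- The initial store: the input in `x₀`, all other variables `nil`. -/
def initStore (a : Val) : Store := Function.update (fun _ => .nil) 0 a

/-- On input `a` the program `c` halts after `T` steps with output `b` (in `x₀`). -/
def Computes (c : Prog) (a : Val) (T : ℕ) (b : Val) : Prop :=
  ∃ s' : Store, Exec c (initStore a) T s' ∧ s' 0 = b

/-! ### Encodings of the input and the output -/

/-- Lists. -/
def encList : List Val → Val
  | [] => .nil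
  | a :: l => .cons a (encList l)

/-- Natural numbers, in unary. -/
def encNat (k : ℕ) : Val := encList (List.replicate k .nil)

/-- An element of `𝔽_q`: the list of its coordinates with respect to the basis `γ` over `𝔽_p`,
each a residue in `{0, …, p - 1}`. -/
def encScalar {p m : ℕ} [Fact p.Prime] [Algebra (ZMod p) F]
    (γ : Module.Basis (Fin m) (ZMod p) F) (a : F) : Val :=
  encList (List.ofFn fun l => encNat (γ.repr a l).val)

/-- The field `𝔽_q`: the prime `p` and the multiplication table of the basis `γ`. -/
def encField {p m : ℕ} [Fact p.Prime] [Algebra (ZMod p) F]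
    (γ : Module.Basis (Fin m) (ZMod p) F) : Val :=
  .cons (encNat p)
    (encList (List.ofFn fun i => encList (List.ofFn fun j => encScalar γ (γ i * γ j))))

/-- A polynomial: the list of its coefficients of degree `0, …, natDegree`. -/
def encPoly {R : Type u} [Semiring R] (enc : R → Val) (g : R[X]) : Val :=
  encList ((List.range (g.natDegree + 1)).map fun k => enc (g.coeff k))

/-- An element of `𝔽_q[t][X]`. -/
def encBiv {p m : ℕ} [Fact p.Prime] [Algebra (ZMod p) F]
    (γ : Module.Basis (Fin m) (ZMod p) F) (f : F[X][X]) : Val :=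
  encPoly (encPoly (encScalar γ)) f

/-- The input of a factorization algorithm: the field `𝔽_q` and the polynomial `f`. -/
def encInput {p m : ℕ} [Fact p.Prime] [Algebra (ZMod p) F]
    (γ : Module.Basis (Fin m) (ZMod p) F) (f : F[X][X]) : Val :=
  .cons (encField γ) (encBiv γ f)

/-- The list `h₁, …, h_s` in `𝔽_q[t][X]` describes the factorization `f = ℓ_f g₁ ⋯ g_s` of `f` in
`𝔽_q(t)[X]` into its leading coefficient and monic irreducible polynomials: `h_j = ℓ_f g_j`. -/
def IsFactorization (f : F[X][X]) (hs : List F[X][X]) : Prop :=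
  ∃ gs : List (RatFunc F)[X],
    (∀ g ∈ gs, g.Monic ∧ Irreducible g) ∧
    toK f = C (algebraMap F[X] (RatFunc F) f.leadingCoeff) * gs.prod ∧
    hs.map toK = gs.map fun g => C (algebraMap F[X] (RatFunc F) f.leadingCoeff) * g

/-- The program `c` factors separable polynomials over rational function fields `𝔽_q(t)` in
polynomial time: for all finite fields `𝔽_q`, `q = p ^ m`, given by the multiplication table of
some basis over `𝔽_p`, and all separable `f ∈ 𝔽_q[t][X]`, it outputs the factorization of `f`
within a number of steps that is polynomially bounded in `deg_X f`, `deg_t f`, `p` and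
`m = log_p q`. -/
def FactorsInPolyTime (c : Prog) : Prop :=
  ∃ P : Polynomial ℕ, ∀ (p m : ℕ) [Fact p.Prime] (F : Type u) [Field F] [Algebra (ZMod p) F]
    (γ : Module.Basis (Fin m) (ZMod p) F) (f : F[X][X]), (toK f).Separable →
      ∃ (T : ℕ) (hs : List F[X][X]),
        Computes c (encInput γ f) T (encList (hs.map (encBiv γ))) ∧
        T ≤ P.eval (f.natDegree + degT f + p + m) ∧
        IsFactorization f hs

end FactorFqt
end

/-! Part 1. Logarithmic derivatives turn products into sums: if `g = ∏ f_j ^ w_j`, then `Φ(g) = ∑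
w_j Φ(f_j)` (`prod_mul_sum_logDeriv`). For a vector `w` over `𝔽_p` let `h_w` be the combination of
the polynomials `Φ(f_j) mod v ^ ℓ`; then `w ∈ L'` means exactly that `h_w` has `t`-degree at most
`deg_t f` (`mem_spaceL'`). If `w` is the exponent vector of a global factor `g`, then `Φ(g)` is a
polynomial over `𝔽_q[t]` of `t`-degree at most `deg_t f < σ`, so it is its own remainder modulo `v ^
ℓ` and `W ⊆ L'`.

For the converse, separability of `f` distributes the local factors among the global ones, and the
indicators of the resulting classes lie in `W`; it suffices that every `w ∈ L'` is constant on each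
class. After subtracting a multiple of an indicator, let `w_j = 0` with `f_j ∣ g_i`. Modulo `v ^ ℓ`
the monic `f_j` divides both `g_i` and `h_w`, so `v ^ ℓ` divides their resultant, whose degree is at
most `(2n - 1) deg_t f < σ`. Hence the resultant vanishes and `g_i ∣ h_w` over `K`
(`dvd_of_apply_eq_zero`). If `w_k ≠ 0` for another `f_k ∣ g_i`, then `f_k` would divide `Φ(f_k)`,
hence `f'`, modulo `v`, against separability modulo `v` (`apply_eq_zero_of_dvd`).

Part 2. The algorithm does not use a place `v`; it is linear algebra over `𝔽_p`. Write `f = c ∏ g_i`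
in `𝔽_q[t][X]`. Niederreiter's operator `N(h) = D ^ (p - 1) (f ^ (p - 1) h) + h ^ p` is
`𝔽_p`-linear, and on polynomials of degree `< n` its kernel is spanned by the `λ_i = f g_i' / g_i`
(`mem_ker_iff`). Indeed `N(h) ≡ h ^ p - f' ^ (p - 1) h` modulo `f`, so `N(h) = 0` forces `h` modulo
each `g_i` to be an `𝔽_p`-multiple of `f'`, that is, of `λ_i`. Conversely `N(λ_i)` is divisible by
all `g_j` and has derivative zero, so over the algebraic closure it is a `p`-th power `G ^ p` with
`∏ g_j ∣ G` and `deg G < n`, hence zero.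

Since `f ∣ λ_i λ_j` for `i ≠ j` and `f' = ∑ λ_i`, an equation `(h + k f') x + f z = 0` with `h = ∑
χ_i λ_i` selects the combinations `x` supported where `χ_i = -k` (`mem_split_iff`). Running through
`k < p` and a generating set of the kernel isolates the individual lines spanned by the `λ_i`.
Finally `f ∣ λ_i x` is equivalent to `g_i ∣ x` (`dvd_logDer_mul`), so the multiple of `g_i` with
leading coefficient `ℓ_f` is found as a solution of least degree. Degrees in `t` are additive, which
puts all unknown cofactors into boxes of polynomial size.

The step count is handled by a small functional language with a cost function that is compiled to
WHILE programs (`exists_implements`). All values are carried by representation predicates with a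
size bound `b`, and each program comes with correctness and a cost bound that is polynomial in `b`.
-/

namespace FactorFqt

/-! ### A functional language on binary trees, compiled to WHILE programs -/

/-- Expressions of a first-order functional language on binary trees.  The value of an expression
depends on one tree, which serves as the list of its arguments. -/
inductive Fn : Type
  | id : Fn
  | nil : Fn
  | hd : Fn
  | tl : Fn
  | pair (f g : Fn) : Fn
  | comp (g f : Fn) : Fn
  | ite (c f g : Fn) : Fn
  | fold (s : Fn) : Fn

/-- Left fold over the spine of a tree. -/
def foldV (g : Val → Val → Val) : Val → Val → Val
  | .nil, acc => acc
  | .cons x l, acc => foldV g l (g acc x)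

/-- The cost of a left fold whose steps have cost `c`. -/
def foldC (g : Val → Val → Val) (c : Val → Val → ℕ) : Val → Val → ℕ
  | .nil, _ => 1
  | .cons x l, acc => c acc x + 9 + foldC g c l (g acc x)

namespace Fn

/-- The value of an expression. -/
def eval : Fn → Val → Val
  | .id, a => a
  | .nil, _ => .nil
  | .hd, a => a.hd
  | .tl, a => a.tl
  | .pair f g, a => .cons (eval f a) (eval g a)
  | .comp g f, a => eval g (eval f a)
  | .ite c f g, a => match eval c a with
    | .nil => eval g a
    | .cons _ _ => eval f a
  | .fold s, a => foldV (fun acc x => eval s (.cons acc (.cons x a.tl.tl))) a.hd a.tl.hd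

/-- A bound for the number of steps needed to compute an expression. -/
def cost : Fn → Val → ℕ
  | .id, _ => 1
  | .nil, _ => 1
  | .hd, _ => 1
  | .tl, _ => 1
  | .pair f g, a => cost f a + cost g a + 3
  | .comp g f, a => cost f a + cost g (eval f a)
  | .ite c f g, a => cost c a + 2 + (match eval c a with
    | .nil => cost g a
    | .cons _ _ => cost f a)
  | .fold s, a => foldC (fun acc x => eval s (.cons acc (.cons x a.tl.tl)))
      (fun acc x => cost s (.cons acc (.cons x a.tl.tl))) a.hd a.tl.hd + 6

/-- `c` evaluates `f` on the contents of `x_k`, without changing `x_j` for `j < k`. -/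
def Implements (f : Fn) (k : ℕ) (c : Prog) : Prop :=
  ∀ s : Store, ∃ (T : ℕ) (s' : Store), Exec c s T s' ∧ T ≤ f.cost (s k) ∧
    s' k = f.eval (s k) ∧ ∀ j < k, s' j = s j

/-- `x_{k+1}` holds the rest of the list and `x_{k+2}` the accumulator together with the ambient
arguments. The step is compiled for `x_{k+3}` and therefore leaves both alone. -/
lemma exists_implements_fold {f : Fn} {k : ℕ} {c : Prog} (hc : f.Implements (k + 3) c) :
    ∃ c', (Fn.fold f).Implements k c' := by
  let body : Prog :=
    .seq (.hd (k + 3) (k + 1)) <| .seq (.hd (k + 4) (k + 2)) <| .seq (.tl (k + 5) (k + 2)) <|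
    .seq (.cons (k + 6) (k + 3) (k + 5)) <| .seq (.cons (k + 3) (k + 4) (k + 6)) <|
    .seq c <| .seq (.tl (k + 4) (k + 2)) <| .seq (.cons (k + 2) (k + 3) (k + 4))
      (.tl (k + 1) (k + 1))
  -- The 8 counts the pointer instructions around `c`; the loop test makes it the 9 in `foldC`.
  have hbody : ∀ (s : Store) (x l acc ρ : Val), s (k + 1) = .cons x l → s (k + 2) = .cons acc ρ →
      ∃ T s', Exec body s T s' ∧ T ≤ f.cost (.cons acc (.cons x ρ)) + 8 ∧ s' (k + 1) = l ∧
        s' (k + 2) = .cons (f.eval (.cons acc (.cons x ρ))) ρ ∧ ∀ j ≤ k, s' j = s j := by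
    intro s x l acc ρ h1 h2
    obtain ⟨s₁, hs₁⟩ : ∃ s₁ : Store, s₁ = Function.update (Function.update (Function.update
      (Function.update (Function.update s (k + 3) x) (k + 4) acc) (k + 5) ρ) (k + 6) (.cons x ρ))
      (k + 3) (.cons acc (.cons x ρ)) := ⟨_, rfl⟩
    obtain ⟨T, s₂, hE, hT, hv, hk⟩ := hc s₁
    have e3 : s₁ (k + 3) = .cons acc (.cons x ρ) := by simp [hs₁]
    have e1 : s₂ (k + 1) = .cons x l := by rw [hk _ (by omega), hs₁]; simp [h1]
    have e2 : s₂ (k + 2) = .cons acc ρ := by rw [hk _ (by omega), hs₁]; simp [h2]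
    rw [e3] at hv hT
    refine ⟨_, _, .seq (.hd _ _ _) <| .seq (.hd _ _ _) <| .seq (.tl _ _ _) <| .seq (.cons _ _ _ _)
      <| .seq (.cons _ _ _ _) <| .seq (T₁ := T) (s₁ := s₂) ?_ <| .seq (.tl _ _ _) <|
      .seq (.cons _ _ _ _) (.tl _ _ _), by omega, ?_, ?_, ?_⟩
    · convert hE using 1
      rw [hs₁]
      simp [h1, h2, Val.hd, Val.tl]
    · simp [e1, Val.tl]
    · simp [hv, e2, Val.tl]
    · intro j hj
      have : s₂ j = s j := by
        rw [hk _ (by omega), hs₁]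
        simp [show j ≠ k + 3 by omega, show j ≠ k + 4 by omega, show j ≠ k + 5 by omega,
          show j ≠ k + 6 by omega]
      simp [show j ≠ k + 1 by omega, show j ≠ k + 2 by omega, show j ≠ k + 4 by omega, this]
  have hloop : ∀ (l acc ρ : Val) (s : Store), s (k + 1) = l → s (k + 2) = .cons acc ρ →
      ∃ T s', Exec (.loop (k + 1) body) s T s' ∧
        T ≤ foldC (fun acc x => eval f (.cons acc (.cons x ρ)))
          (fun acc x => cost f (.cons acc (.cons x ρ))) l acc ∧
        s' (k + 2) = .cons (foldV (fun acc x => eval f (.cons acc (.cons x ρ))) l acc) ρ ∧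
        ∀ j ≤ k, s' j = s j := by
    intro l
    induction l with
    | nil =>
      intro acc ρ s h1 h2
      exact ⟨1, s, .loop_false h1, le_rfl, h2, fun _ _ => rfl⟩
    | cons x l _ ih =>
      intro acc ρ s h1 h2
      obtain ⟨T₁, s₁, hE₁, hT₁, h1', h2', hk₁⟩ := hbody s x l acc ρ h1 h2
      obtain ⟨T₂, s₂, hE₂, hT₂, hv, hk₂⟩ := ih _ ρ s₁ h1' h2'
      refine ⟨_, s₂, .loop_true (by simp [h1]) hE₁ hE₂, ?_, hv, fun j hj => ?_⟩
      · simp only [foldC]; omega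
      · rw [hk₂ j hj, hk₁ j hj]
  refine ⟨.seq (.hd (k + 1) k) <| .seq (.tl (k + 2) k) <| .seq (.hd (k + 3) (k + 2)) <|
    .seq (.tl (k + 4) (k + 2)) <| .seq (.cons (k + 2) (k + 3) (k + 4)) <|
    .seq (.loop (k + 1) body) (.hd k (k + 2)), fun s => ?_⟩
  obtain ⟨s₁, hs₁⟩ : ∃ s₁ : Store, s₁ = Function.update (Function.update (Function.update
    (Function.update (Function.update s (k + 1) (s k).hd) (k + 2) (s k).tl) (k + 3) (s k).tl.hd)
    (k + 4) (s k).tl.tl) (k + 2) (.cons (s k).tl.hd (s k).tl.tl) := ⟨_, rfl⟩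
  obtain ⟨T, s₂, hE, hT, hv, hk⟩ := hloop (s k).hd (s k).tl.hd (s k).tl.tl s₁
    (by simp [hs₁]) (by simp [hs₁])
  refine ⟨_, _, .seq (.hd _ _ _) <| .seq (.tl _ _ _) <| .seq (.hd _ _ _) <| .seq (.tl _ _ _) <|
    .seq (.cons _ _ _ _) <| .seq (T₁ := T) (s₁ := s₂) ?_ (.hd _ _ _), ?_, ?_, fun j hj => ?_⟩
  · convert hE using 1
    rw [hs₁]
    simp
  · simp only [cost]; omega
  · simp [hv, eval, Val.hd]
  · rw [Function.update_of_ne (by omega), hk j hj.le, hs₁]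
    simp [show j ≠ k + 1 by omega, show j ≠ k + 2 by omega, show j ≠ k + 4 by omega,
      show j ≠ k + 3 by omega]

/-- Structural induction with `k` general: a subexpression whose result must survive, or which must
not destroy the argument, gets a copy of the argument in a higher variable, and compiled code never
touches lower ones. -/
theorem exists_implements (f : Fn) (k : ℕ) : ∃ c, f.Implements k c := by
  induction f generalizing k with
  | id => exact ⟨.copy k k, fun s => ⟨1, _, .copy _ _ _, le_rfl, by simp [eval],
      fun j hj => by simp [hj.ne]⟩⟩
  | nil => exact ⟨.nil k, fun s => ⟨1, _, .nil _ _, le_rfl, by simp [eval],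
      fun j hj => by simp [hj.ne]⟩⟩
  | hd => exact ⟨.hd k k, fun s => ⟨1, _, .hd _ _ _, le_rfl, by simp [eval],
      fun j hj => by simp [hj.ne]⟩⟩
  | tl => exact ⟨.tl k k, fun s => ⟨1, _, .tl _ _ _, le_rfl, by simp [eval],
      fun j hj => by simp [hj.ne]⟩⟩
  | pair f g hf hg =>
    obtain ⟨c, hc⟩ := hf (k + 1)
    obtain ⟨d, hd⟩ := hg (k + 2)
    refine ⟨.seq (.copy (k + 1) k) <| .seq c <| .seq (.copy (k + 2) k) <| .seq d <|
      .cons k (k + 1) (k + 2), fun s => ?_⟩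
    obtain ⟨T₁, s₁, hE₁, hT₁, hv₁, hk₁⟩ := hc (Function.update s (k + 1) (s k))
    obtain ⟨T₂, s₂, hE₂, hT₂, hv₂, hk₂⟩ := hd (Function.update s₁ (k + 2) (s₁ k))
    have e : s₁ k = s k := by rw [hk₁ _ (by omega)]; simp
    have e' : s₂ (k + 1) = s₁ (k + 1) := by rw [hk₂ _ (by omega)]; simp
    simp only [Function.update_self, e] at hT₁ hv₁ hT₂ hv₂
    refine ⟨_, _, .seq (.copy _ _ _) <| .seq hE₁ <| .seq (.copy _ _ _) <| .seq hE₂ (.cons _ _ _ _),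
      ?_, ?_, fun j hj => ?_⟩
    · simp only [cost]; omega
    · simp [e', hv₁, hv₂, eval]
    · rw [Function.update_of_ne hj.ne, hk₂ _ (by omega), Function.update_of_ne (by omega),
        hk₁ _ (by omega), Function.update_of_ne (by omega)]
  | comp g f hg hf =>
    obtain ⟨c, hc⟩ := hf k
    obtain ⟨d, hd⟩ := hg k
    refine ⟨.seq c d, fun s => ?_⟩
    obtain ⟨T₁, s₁, hE₁, hT₁, hv₁, hk₁⟩ := hc s
    obtain ⟨T₂, s₂, hE₂, hT₂, hv₂, hk₂⟩ := hd s₁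
    rw [hv₁] at hT₂ hv₂
    refine ⟨_, _, .seq hE₁ hE₂, ?_, hv₂, fun j hj => ?_⟩
    · simp only [cost]; omega
    · rw [hk₂ j hj, hk₁ j hj]
  | ite c f g hc hf hg =>
    obtain ⟨c', hc'⟩ := hc (k + 1)
    obtain ⟨d₁, hd₁⟩ := hf k
    obtain ⟨d₂, hd₂⟩ := hg k
    refine ⟨.seq (.copy (k + 1) k) <| .seq c' <| .ite (k + 1) d₁ d₂, fun s => ?_⟩
    obtain ⟨T₁, s₁, hE₁, hT₁, hv₁, hk₁⟩ := hc' (Function.update s (k + 1) (s k))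
    simp only [Function.update_self] at hT₁ hv₁
    have e : s₁ k = s k := by rw [hk₁ _ (by omega)]; simp
    cases h : eval c (s k) with
    | nil =>
      obtain ⟨T₂, s₂, hE₂, hT₂, hv₂, hk₂⟩ := hd₂ s₁
      rw [e] at hv₂ hT₂
      refine ⟨_, _, .seq (.copy _ _ _) <| .seq hE₁ <| .ite_false (by rw [hv₁, h]) hE₂, ?_, ?_,
        fun j hj => ?_⟩
      · simp only [cost, h]; omega
      · simp [eval, h, hv₂]
      · rw [hk₂ j hj, hk₁ _ (by omega), Function.update_of_ne (by omega)]
    | cons x y =>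
      obtain ⟨T₂, s₂, hE₂, hT₂, hv₂, hk₂⟩ := hd₁ s₁
      rw [e] at hv₂ hT₂
      refine ⟨_, _, .seq (.copy _ _ _) <| .seq hE₁ <| .ite_true (by simp [hv₁, h]) hE₂, ?_, ?_,
        fun j hj => ?_⟩
      · simp only [cost, h]; omega
      · simp [eval, h, hv₂]
      · rw [hk₂ j hj, hk₁ _ (by omega), Function.update_of_ne (by omega)]
  | fold s hs =>
    obtain ⟨c, hc⟩ := hs (k + 3)
    exact exists_implements_fold hc

/-- The tree without its first `n` arguments. -/
def drop : ℕ → Fn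
  | 0 => .id
  | n + 1 => .comp (drop n) .tl

/-- The argument with index `n`. -/
def var (n : ℕ) : Fn := .comp .hd (drop n)

/-- `letIn e b` is the value of `b`, where the value of `e` is added to the arguments. -/
def letIn (e b : Fn) : Fn := .comp b (.pair e .id)

/-- Left fold of the step `s` over the list `l`, starting from `a`.  The arguments of `s` are the
accumulator, the element of the list, and those of the whole expression. -/
def for_ (l a s : Fn) : Fn := .comp (.fold s) (.pair l (.pair a .id))

/-- Call of a function with one argument, in the environment `e`. -/
def call₁ (f a e : Fn) : Fn := .comp f (.pair a e)

/-- Call of a function with two arguments. -/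
def call₂ (f a b e : Fn) : Fn := .comp f (.pair a (.pair b e))

/-- Call of a function with three arguments. -/
def call₃ (f a b c e : Fn) : Fn := .comp f (.pair a (.pair b (.pair c e)))

section simp
variable (f g c s e b l a a₁ a₂ a₃ : Fn) (x y v : Val) (n : ℕ)

@[simp] lemma eval_id : eval .id x = x := rfl
@[simp] lemma eval_nil : eval .nil x = .nil := rfl
@[simp] lemma eval_hd : eval .hd x = x.hd := rfl
@[simp] lemma eval_tl : eval .tl x = x.tl := rfl
@[simp] lemma hd_cons : (Val.cons x y).hd = x := rfl
@[simp] lemma tl_cons : (Val.cons x y).tl = y := rfl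
@[simp] lemma hd_nil : Val.nil.hd = .nil := rfl
@[simp] lemma tl_nil : Val.nil.tl = .nil := rfl
@[simp] lemma eval_pair : eval (.pair f g) x = .cons (eval f x) (eval g x) := rfl
@[simp] lemma eval_comp : eval (.comp g f) x = eval g (eval f x) := rfl
@[simp] lemma eval_drop_zero : eval (drop 0) x = x := rfl
@[simp] lemma eval_drop_succ_cons : eval (drop (n + 1)) (.cons x y) = eval (drop n) y := rfl
@[simp] lemma eval_var_zero_cons : eval (var 0) (.cons x y) = x := rfl
@[simp] lemma eval_var_succ_cons : eval (var (n + 1)) (.cons x y) = eval (var n) y := rfl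
@[simp] lemma eval_letIn : eval (letIn e b) x = eval b (.cons (eval e x) x) := rfl
@[simp] lemma eval_for :
    eval (for_ l a s) x = foldV (fun acc z => eval s (.cons acc (.cons z x))) (eval l x)
      (eval a x) := rfl
@[simp] lemma eval_call₁ : eval (call₁ f a e) x = eval f (.cons (eval a x) (eval e x)) := rfl
@[simp] lemma eval_call₂ : eval (call₂ f a₁ a₂ e) x =
    eval f (.cons (eval a₁ x) (.cons (eval a₂ x) (eval e x))) := rfl
@[simp] lemma eval_call₃ : eval (call₃ f a₁ a₂ a₃ e) x =
    eval f (.cons (eval a₁ x) (.cons (eval a₂ x) (.cons (eval a₃ x) (eval e x)))) := rfl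
@[simp] lemma cost_id : cost .id x = 1 := rfl
@[simp] lemma cost_nil : cost .nil x = 1 := rfl
@[simp] lemma cost_hd : cost .hd x = 1 := rfl
@[simp] lemma cost_tl : cost .tl x = 1 := rfl
@[simp] lemma cost_pair : cost (.pair f g) x = cost f x + cost g x + 3 := rfl
@[simp] lemma cost_comp : cost (.comp g f) x = cost f x + cost g (eval f x) := rfl
@[simp] lemma cost_drop : cost (drop n) x = n + 1 := by
  induction n generalizing x with
  | zero => rfl
  | succ n ih => simp [drop, ih]; omega
@[simp] lemma cost_var : cost (var n) x = n + 2 := by simp [var]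
@[simp] lemma cost_letIn :
    cost (letIn e b) x = cost e x + 4 + cost b (.cons (eval e x) x) := by
  simp [letIn]
@[simp] lemma cost_for :
    cost (for_ l a s) x = cost l x + cost a x + 13 +
      foldC (fun acc z => eval s (.cons acc (.cons z x)))
        (fun acc z => cost s (.cons acc (.cons z x))) (eval l x) (eval a x) := by
  simp [for_, cost]; omega
@[simp] lemma cost_call₁ : cost (call₁ f a e) x =
    cost a x + cost e x + 3 + cost f (.cons (eval a x) (eval e x)) := by simp [call₁]
@[simp] lemma cost_call₂ : cost (call₂ f a₁ a₂ e) x = cost a₁ x + cost a₂ x + cost e x + 6 +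
    cost f (.cons (eval a₁ x) (.cons (eval a₂ x) (eval e x))) := by
  simp [call₂]; omega
@[simp] lemma cost_call₃ : cost (call₃ f a₁ a₂ a₃ e) x =
    cost a₁ x + cost a₂ x + cost a₃ x + cost e x + 9 +
    cost f (.cons (eval a₁ x) (.cons (eval a₂ x) (.cons (eval a₃ x) (eval e x)))) := by
  simp [call₃]; omega

variable {c x}
lemma eval_ite_nil (h : eval c x = .nil) : eval (.ite c f g) x = eval g x := by
  simp [eval, h]
lemma eval_ite_ne (h : eval c x ≠ .nil) : eval (.ite c f g) x = eval f x := by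
  cases h' : eval c x with
  | nil => exact absurd h' h
  | cons => simp [eval, h']
lemma cost_ite_nil (h : eval c x = .nil) :
    cost (.ite c f g) x = cost c x + 2 + cost g x := by
  simp [cost, h]
lemma cost_ite_ne (h : eval c x ≠ .nil) :
    cost (.ite c f g) x = cost c x + 2 + cost f x := by
  cases h' : eval c x with
  | nil => exact absurd h' h
  | cons => simp [cost, h']

end simp

end Fn

@[simp] lemma encList_nil : encList [] = .nil := rfl
@[simp] lemma encList_cons (a : Val) (l : List Val) : encList (a :: l) = .cons a (encList l) := rfl
@[simp] lemma encNat_zero : encNat 0 = .nil := rfl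
lemma encNat_succ (k : ℕ) : encNat (k + 1) = .cons .nil (encNat k) := rfl
lemma tl_encNat (k : ℕ) : (encNat k).tl = encNat (k - 1) := by cases k <;> rfl
lemma encNat_eq_nil {k : ℕ} : encNat k = .nil ↔ k = 0 := by
  cases k <;> simp [encNat_succ]

@[simp] lemma foldV_nil (g : Val → Val → Val) (a : Val) : foldV g .nil a = a := rfl
@[simp] lemma foldV_cons (g : Val → Val → Val) (x l a : Val) :
    foldV g (.cons x l) a = foldV g l (g a x) := rfl
@[simp] lemma foldC_nil (g : Val → Val → Val) (c : Val → Val → ℕ) (a : Val) :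
    foldC g c .nil a = 1 := rfl
@[simp] lemma foldC_cons (g : Val → Val → Val) (c : Val → Val → ℕ) (x l a : Val) :
    foldC g c (.cons x l) a = c a x + 9 + foldC g c l (g a x) := rfl

/-- A fold over a list, with an invariant that depends on the remaining elements. -/
lemma fold_inv {g : Val → Val → Val} {c : Val → Val → ℕ} {B : ℕ} (Inv : List Val → Val → Prop)
    (step : ∀ x L acc, Inv (x :: L) acc → Inv L (g acc x) ∧ c acc x ≤ B)
    (L : List Val) (acc : Val) (h : Inv L acc) :
    Inv [] (foldV g (encList L) acc) ∧ foldC g c (encList L) acc ≤ L.length * (B + 9) + 1 := by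
  induction L generalizing acc with
  | nil => exact ⟨h, by simp⟩
  | cons x L ih =>
    obtain ⟨h₁, h₂⟩ := step x L acc h
    obtain ⟨h₃, h₄⟩ := ih _ h₁
    refine ⟨h₃, ?_⟩
    simp only [encList_cons, foldC_cons, List.length_cons, Nat.succ_mul]
    omega

/-- A fold over a unary number. -/
lemma fold_nat {g : Val → Val → Val} {c : Val → Val → ℕ} {B : ℕ} (Inv : ℕ → Val → Prop)
    (k : ℕ) (acc : Val) (h : Inv 0 acc)
    (step : ∀ i < k, ∀ acc, Inv i acc → Inv (i + 1) (g acc .nil) ∧ c acc .nil ≤ B) :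
    Inv k (foldV g (encNat k) acc) ∧ foldC g c (encNat k) acc ≤ k * (B + 9) + 1 := by
  have := fold_inv (g := g) (c := c) (B := B)
    (fun L acc => (∀ x ∈ L, x = .nil) ∧ L.length ≤ k ∧ Inv (k - L.length) acc) ?_
    (List.replicate k .nil) acc ⟨by simp +contextual, by simp, by simpa using h⟩
  · simpa [encNat] using this
  · rintro x L acc ⟨hx, hl, hi⟩
    rw [List.length_cons] at hl hi
    obtain ⟨h₁, h₂⟩ := step _ (by omega) acc hi
    rw [hx x (by simp)]
    refine ⟨⟨fun y hy => hx y (by simp [hy]), by omega, ?_⟩, h₂⟩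
    rwa [show k - L.length = k - (L.length + 1) + 1 by omega]

/-! ### Polynomially bounded functions -/

/-- `T` is bounded by a polynomial. -/
def IsPoly (T : ℕ → ℕ) : Prop := ∃ C, ∀ b, T b ≤ (b + 2) ^ C

namespace IsPoly

lemma const (k : ℕ) : IsPoly fun _ => k :=
  ⟨k, fun b => (Nat.lt_two_pow_self (n := k)).le.trans (Nat.pow_le_pow_left (by omega) k)⟩

lemma id : IsPoly fun b => b := ⟨1, fun b => by simp⟩

lemma mul {S T : ℕ → ℕ} (hS : IsPoly S) (hT : IsPoly T) : IsPoly fun b => S b * T b := by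
  obtain ⟨C, hC⟩ := hS
  obtain ⟨D, hD⟩ := hT
  exact ⟨C + D, fun b => by rw [pow_add]; exact Nat.mul_le_mul (hC b) (hD b)⟩

/-- The base `b + 2` is at least 2, so one more factor absorbs the doubling that comes from adding
two powers. -/
lemma add {S T : ℕ → ℕ} (hS : IsPoly S) (hT : IsPoly T) : IsPoly fun b => S b + T b := by
  obtain ⟨C, hC⟩ := hS
  obtain ⟨D, hD⟩ := hT
  refine ⟨C + D + 1, fun b => ?_⟩
  have h1 : (b + 2) ^ C ≤ (b + 2) ^ (C + D) := Nat.pow_le_pow_right (by omega) (by omega)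
  have h2 : (b + 2) ^ D ≤ (b + 2) ^ (C + D) := Nat.pow_le_pow_right (by omega) (by omega)
  have h3 : (b + 2) ^ (C + D) * 2 ≤ (b + 2) ^ (C + D) * (b + 2) :=
    Nat.mul_le_mul_left _ (by omega)
  have := hC b
  have := hD b
  rw [pow_succ]
  change S b + T b ≤ _
  omega

lemma comp {S T : ℕ → ℕ} (hT : IsPoly T) (hS : IsPoly S) : IsPoly fun b => T (S b) := by
  obtain ⟨D, hD⟩ := (hS.add (const 2))
  obtain ⟨C, hC⟩ := hT
  exact ⟨D * C, fun b => (hC _).trans (by rw [pow_mul]; exact Nat.pow_le_pow_left (hD b) C)⟩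

lemma pow {S : ℕ → ℕ} (hS : IsPoly S) (k : ℕ) : IsPoly fun b => S b ^ k := by
  induction k with
  | zero => simpa using const 1
  | succ k ih => simpa only [pow_succ] using ih.mul hS

end IsPoly

end FactorFqt


/-! ### Loops, arithmetic in the prime field, and polynomial arithmetic on coefficient lists -/

namespace FactorFqt
open Fn

/-- A loop over a list, with an invariant that depends on the remaining elements. -/
lemma for_inv {l a s : Fn} {x : Val} {B : ℕ} (Inv : List Val → Val → Prop) {L : List Val}
    (hl : l.eval x = encList L) (h0 : Inv L (a.eval x))
    (step : ∀ z L acc, Inv (z :: L) acc → Inv L (s.eval (.cons acc (.cons z x))) ∧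
      s.cost (.cons acc (.cons z x)) ≤ B) :
    Inv [] ((for_ l a s).eval x) ∧
      (for_ l a s).cost x ≤ l.cost x + a.cost x + L.length * (B + 9) + 14 := by
  obtain ⟨h1, h2⟩ := fold_inv Inv step L (a.eval x) h0
  refine ⟨by simpa [hl] using h1, ?_⟩
  rw [cost_for, hl]
  omega

/-- A loop over a unary number. -/
lemma for_nat {l a s : Fn} {x : Val} {B : ℕ} (Inv : ℕ → Val → Prop) {k : ℕ}
    (hl : l.eval x = encNat k) (h0 : Inv 0 (a.eval x))
    (step : ∀ i < k, ∀ acc, Inv i acc → Inv (i + 1) (s.eval (.cons acc (.cons .nil x))) ∧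
      s.cost (.cons acc (.cons .nil x)) ≤ B) :
    Inv k ((for_ l a s).eval x) ∧
      (for_ l a s).cost x ≤ l.cost x + a.cost x + k * (B + 9) + 14 := by
  obtain ⟨h1, h2⟩ := fold_nat (g := fun acc z => s.eval (.cons acc (.cons z x)))
    (c := fun acc z => s.cost (.cons acc (.cons z x))) Inv k (a.eval x) h0 step
  refine ⟨by simpa [hl] using h1, ?_⟩
  rw [cost_for, hl]
  omega

/-! ### Arithmetic in the prime field -/

/-- The successor in `ℤ/p`. -/
def ssucc : Fn :=
  .ite (for_ (var 0) (.comp .tl (var 1)) (.comp .tl (var 0))) (.pair .nil (var 0)) .nil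

/-- Addition in `ℤ/p`. -/
def sadd : Fn := for_ (var 0) (var 1) (call₁ ssucc (var 0) (drop 4))

/-- Multiplication in `ℤ/p`. -/
def smul : Fn := for_ (var 0) .nil (call₂ sadd (var 0) (var 3) (drop 4))

/-- The time of `ssucc`. -/
def tsucc (b : ℕ) : ℕ := b * 12 + 60

/-- The time of `sadd`. -/
def tadd (b : ℕ) : ℕ := b * (tsucc b + 60) + 60

/-- The time of `smul`. -/
def tmul (b : ℕ) : ℕ := b * (tadd b + 60) + 60

section scalar
variable {p : ℕ} [hp : Fact p.Prime] (tb : Val)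

/-- Removing one element of the unary number `p - 1` for each element of `x` leaves `p - 1 - x`,
which is `nil` exactly when the successor wraps around to `0`. -/
lemma ssucc_spec (x : ZMod p) :
    ssucc.eval (.cons (encNat x.val) (.cons (encNat p) tb)) = encNat (x + 1).val ∧
      ssucc.cost (.cons (encNat x.val) (.cons (encNat p) tb)) ≤ tsucc p := by
  have hx := ZMod.val_lt x
  obtain ⟨h1, h2⟩ := fold_nat (g := fun acc _ => acc.tl) (c := fun _ _ => 3) (B := 3)
    (fun i acc => acc = encNat (p - 1 - i)) x.val (encNat (p - 1)) rfl
    (by rintro i - _ rfl; exact ⟨by rw [tl_encNat]; congr 1, le_rfl⟩)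
  have hv : (x + 1).val = if p - 1 - x.val = 0 then 0 else x.val + 1 := by
    rw [ZMod.val_add, ZMod.val_one]
    split_ifs with h
    · rw [show x.val + 1 = p by omega, Nat.mod_self]
    · rw [Nat.mod_eq_of_lt (by omega)]
  rw [ssucc, tsucc]
  by_cases h : p - 1 - x.val = 0
  · have hc : eval (for_ (var 0) (.comp .tl (var 1)) (.comp .tl (var 0)))
        (.cons (encNat x.val) (.cons (encNat p) tb)) = .nil := by
      simp [tl_encNat, h1, h]
    rw [eval_ite_nil _ _ hc, cost_ite_nil _ _ hc, hv, if_pos h]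
    refine ⟨rfl, ?_⟩
    simp [tl_encNat]
    omega
  · have hc : eval (for_ (var 0) (.comp .tl (var 1)) (.comp .tl (var 0)))
        (.cons (encNat x.val) (.cons (encNat p) tb)) ≠ .nil := by
      simp [tl_encNat, h1, encNat_eq_nil, h]
    rw [eval_ite_ne _ _ hc, cost_ite_ne _ _ hc, hv, if_neg h]
    refine ⟨by simp [encNat_succ], ?_⟩
    simp [tl_encNat]
    omega

/-- The summand `y` is incremented `x` times. Unary arithmetic is affordable because the bound may
be polynomial in `p`. -/
lemma sadd_spec (x y : ZMod p) :
    sadd.eval (.cons (encNat x.val) (.cons (encNat y.val) (.cons (encNat p) tb))) =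
      encNat (x + y).val ∧
    sadd.cost (.cons (encNat x.val) (.cons (encNat y.val) (.cons (encNat p) tb))) ≤ tadd p := by
  have hx := (ZMod.val_lt x).le
  obtain ⟨h1, h2⟩ := for_nat (l := var 0) (a := var 1) (s := call₁ ssucc (var 0) (drop 4))
    (x := .cons (encNat x.val) (.cons (encNat y.val) (.cons (encNat p) tb))) (B := tsucc p + 10)
    (fun i acc => acc = encNat (i + y : ZMod p).val) (k := x.val) (by simp) (by simp)
    (by
      rintro i - _ rfl
      obtain ⟨h1, h2⟩ := ssucc_spec tb (i + y : ZMod p)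
      refine ⟨?_, ?_⟩
      · simp only [eval_call₁, eval_var_zero_cons, eval_drop_succ_cons, eval_drop_zero, h1]
        congr 2; push_cast; ring
      · simp; omega)
  rw [ZMod.natCast_zmod_val] at h1
  refine ⟨h1, h2.trans ?_⟩
  have h3 : x.val * (tsucc p + 10 + 9) ≤ p * (tsucc p + 60) := Nat.mul_le_mul hx (by omega)
  rw [tadd]
  simp
  omega

lemma smul_spec (x y : ZMod p) :
    smul.eval (.cons (encNat x.val) (.cons (encNat y.val) (.cons (encNat p) tb))) =
      encNat (x * y).val ∧
    smul.cost (.cons (encNat x.val) (.cons (encNat y.val) (.cons (encNat p) tb))) ≤ tmul p := by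
  have hx := (ZMod.val_lt x).le
  obtain ⟨h1, h2⟩ := for_nat (l := var 0) (a := .nil) (s := call₂ sadd (var 0) (var 3) (drop 4))
    (x := .cons (encNat x.val) (.cons (encNat y.val) (.cons (encNat p) tb))) (B := tadd p + 18)
    (fun i acc => acc = encNat (i * y : ZMod p).val) (k := x.val) (by simp) (by simp)
    (by
      rintro i - _ rfl
      obtain ⟨h1, h2⟩ := sadd_spec tb (i * y : ZMod p) y
      refine ⟨?_, ?_⟩
      · simp only [eval_call₂, eval_var_zero_cons, eval_var_succ_cons, eval_drop_succ_cons,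
          eval_drop_zero, h1]
        congr 2; push_cast; ring
      · simp; omega)
  rw [ZMod.natCast_zmod_val] at h1
  refine ⟨h1, h2.trans ?_⟩
  have h3 : x.val * (tadd p + 18 + 9) ≤ p * (tadd p + 60) := Nat.mul_le_mul hx (by omega)
  rw [tmul]
  simp
  omega

end scalar

/-! ### Lists -/

/-- `revApp` reverses the first list and appends the second one. -/
def revApp : Fn := for_ (var 0) (var 1) (.pair (var 1) (var 0))

/-- Application of `f a` to all elements of a list. -/
def mapF (f : Fn) : Fn :=
  letIn (for_ (var 1) .nil (.pair (call₂ f (var 2) (var 1) (drop 4)) (var 0)))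
    (call₂ revApp (var 0) .nil .nil)

/-- Addition of lists of coefficients. -/
def padd (add : Fn) : Fn :=
  letIn (for_ (var 0) (.pair (var 1) .nil)
      (.pair (.comp .tl (.comp .hd (var 0)))
        (.pair (call₂ add (var 1) (.comp .hd (.comp .hd (var 0))) (drop 4)) (.comp .tl (var 0)))))
    (call₂ revApp (.comp .tl (var 0)) (.comp .hd (var 0)) .nil)

/-- Whether some element of a list is nonzero. -/
def pnz (nz : Fn) : Fn :=
  for_ (var 0) .nil (.ite (var 0) (var 0) (call₁ nz (var 1) (drop 3)))

/-- Multiplication of lists of coefficients. -/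
def pmul (add mul : Fn) : Fn :=
  .comp .hd (for_ (var 0) (.pair .nil (var 1))
    (.pair (call₂ (padd add) (.comp .hd (var 0))
        (call₂ (mapF mul) (var 1) (.comp .tl (var 0)) (drop 4)) (drop 4))
      (.pair .nil (.comp .tl (var 0)))))

/-- The derivative of a list of coefficients. -/
def pderiv (add : Fn) : Fn :=
  .comp .tl (for_ (call₂ revApp (var 0) .nil .nil) .nil
    (.pair (.pair (var 1) (.comp .hd (var 0)))
      (call₂ (padd add) (.comp .hd (var 0)) (.pair .nil (.comp .tl (var 0))) (drop 3))))

lemma encList_injective : Function.Injective encList := by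
  intro L
  induction L with
  | nil => rintro (_ | ⟨b, L'⟩) h <;> simp_all
  | cons a L ih =>
    rintro (_ | ⟨b, L'⟩) h
    · simp at h
    · simp only [encList_cons, Val.cons.injEq] at h
      rw [h.1, ih h.2]

lemma exists_encList (v : Val) : ∃ L, v = encList L := by
  induction v with
  | nil => exact ⟨[], rfl⟩
  | cons a b _ ih => obtain ⟨L, rfl⟩ := ih; exact ⟨a :: L, rfl⟩

lemma tl_encList (L : List Val) : (encList L).tl = encList L.tail := by cases L <;> rfl

lemma foldV_append (g : Val → Val → Val) (L M : List Val) (a : Val) :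
    foldV g (encList (L ++ M)) a = foldV g (encList M) (foldV g (encList L) a) := by
  induction L generalizing a with
  | nil => rfl
  | cons x L ih => simp [ih]

lemma revApp_eval (L M : List Val) (ρ : Val) :
    revApp.eval (.cons (encList L) (.cons (encList M) ρ)) = encList (L.reverse ++ M) := by
  simp only [revApp, eval_for, eval_var_zero_cons, eval_var_succ_cons, eval_pair]
  induction L generalizing M with
  | nil => rfl
  | cons x L ih => simpa using ih (x :: M)

lemma revApp_cost (L : List Val) (r ρ : Val) :
    revApp.cost (.cons (encList L) (.cons r ρ)) ≤ L.length * 20 + 20 := by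
  obtain ⟨-, h⟩ := fold_inv (g := fun acc x => .cons x acc) (c := fun _ _ => 8) (B := 8)
    (fun _ _ => True) (fun _ _ _ _ => ⟨trivial, le_rfl⟩) L r trivial
  simp [revApp]
  omega

lemma rev_eval (L : List Val) (ρ : Val) :
    revApp.eval (.cons (encList L) (.cons .nil ρ)) = encList L.reverse := by
  simpa using revApp_eval L [] ρ

lemma mapF_spec {f : Fn} {a E : Val} {B : ℕ} (L : List Val)
    (h : ∀ x ∈ L, f.cost (.cons a (.cons x E)) ≤ B) :
    (mapF f).eval (.cons a (.cons (encList L) E)) =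
      encList (L.map fun x => f.eval (.cons a (.cons x E))) ∧
    (mapF f).cost (.cons a (.cons (encList L) E)) ≤ L.length * (B + 80) + 80 := by
  obtain ⟨⟨O, h1, h2, -⟩, h3⟩ := for_inv (l := var 1) (a := .nil)
    (s := .pair (call₂ f (var 2) (var 1) (drop 4)) (var 0))
    (x := .cons a (.cons (encList L) E)) (B := B + 40)
    (fun Lr acc => ∃ O : List Val, acc = encList O ∧
      O.reverse ++ Lr.map (fun x => f.eval (.cons a (.cons x E))) =
        L.map (fun x => f.eval (.cons a (.cons x E))) ∧ ∀ z ∈ Lr, z ∈ L) (L := L)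
    (by simp) ⟨[], by simp⟩ (by
      rintro z Lr _ ⟨O, rfl, h1, h2⟩
      have := h z (h2 z (by simp))
      refine ⟨⟨f.eval (.cons a (.cons z E)) :: O, by simp, by simpa using h1,
        fun y hy => h2 y (by simp [hy])⟩, ?_⟩
      simp
      omega)
  rw [List.map_nil, List.append_nil] at h2
  have h4 : O.length = L.length := by simpa using congrArg List.length h2
  constructor
  · simp only [mapF, eval_letIn, h1, eval_call₂, eval_var_zero_cons, eval_nil, rev_eval, h2]
  · have h5 := revApp_cost O .nil .nil
    have h6 : L.length * (B + 80) = L.length * (B + 40 + 9) + L.length * 20 + L.length * 11 := by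
      ring
    simp only [mapF, cost_letIn, h1, cost_call₂, eval_var_zero_cons, eval_nil, cost_var, cost_nil]
      at h3 ⊢
    omega

/-! ### Lists of coefficients of polynomials -/

section poly
variable {R : Type*} [CommRing R]

/-- The list represents the polynomial: its elements represent the coefficients, and there are no
coefficients beyond its end. -/
inductive LRep (r : Val → R → Prop) : List Val → R[X] → Prop
  | nil : LRep r [] 0
  | cons {a : Val} {x : R} {L : List Val} {y : R[X]} :
      r a x → LRep r L y → LRep r (a :: L) (C x + X * y)

namespace LRep
variable {r : Val → R → Prop} {L : List Val} {y : R[X]}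

lemma coeff_eq_zero (h : LRep r L y) {i : ℕ} (hi : L.length ≤ i) : y.coeff i = 0 := by
  induction h generalizing i with
  | nil => simp
  | cons _ _ ih =>
    obtain ⟨i, rfl⟩ : ∃ j, i = j + 1 := ⟨i - 1, by simp at hi; omega⟩
    simp at hi
    simp [ih hi]

lemma mono {r' : Val → R → Prop} (h : LRep r L y) (hr : ∀ v x, r v x → r' v x) :
    LRep r' L y := by
  induction h with
  | nil => exact .nil
  | cons h _ ih => exact .cons (hr _ _ h) ih

lemma map {S : Type*} [CommRing S] {r' : Val → S → Prop} {φ : Val → Val} (h : LRep r L y)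
    {ψ : R →+ S} (hr : ∀ v ∈ L, ∀ x, r v x → r' (φ v) (ψ x)) {z : S[X]}
    (hz : ∀ i, z.coeff i = ψ (y.coeff i)) : LRep r' (L.map φ) z := by
  induction h generalizing z with
  | nil =>
    have : z = 0 := by ext i; simp [hz]
    exact this ▸ .nil
  | @cons a x L y h _ ih =>
    have e : z = C (ψ x) + X * z.divX := by
      have h0 : z.coeff 0 = ψ x := by rw [hz]; simp
      nth_rw 1 [← X_mul_divX_add z, add_comm, h0]
    rw [e, List.map_cons]
    refine .cons (hr _ (by simp) _ h) (ih (fun v hv => hr v (by simp [hv])) fun i => ?_)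
    rw [coeff_divX, hz]
    simp

lemma of_coeff : ∀ {L : List Val} {y : R[X]} (_ : ∀ (i : ℕ) (h : i < L.length), r L[i] (y.coeff i))
    (_ : ∀ i, L.length ≤ i → y.coeff i = 0), LRep r L y
  | [], y, _, h' => by
    have : y = 0 := by ext i; simp [h' i]
    exact this ▸ .nil
  | a :: L, y, h, h' => by
    rw [← X_mul_divX_add y, add_comm]
    refine .cons (h 0 (by simp)) (of_coeff (fun i hi => ?_) fun i hi => ?_)
    · rw [coeff_divX]; exact h (i + 1) (by simpa using hi)
    · rw [coeff_divX]; exact h' (i + 1) (by simpa using hi)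

lemma hd (h : LRep r L y) (h0 : r .nil 0) : r (encList L).hd (y.coeff 0) := by
  cases h with
  | nil => simpa using h0
  | cons h _ => simpa using h

lemma tail (h : LRep r L y) : LRep r L.tail y.divX := by
  cases h with
  | nil => simpa using .nil
  | @cons a x L y _ h =>
    have : (C x + X * y).divX = y := by ext i; simp
    simpa [this] using h

lemma getD (h : LRep r L y) (h0 : r .nil 0) (i : ℕ) : r (L.getD i .nil) (y.coeff i) := by
  induction h generalizing i with
  | nil => simpa using h0
  | cons h _ ih =>
    cases i with
    | zero => simpa using h
    | succ i => simpa using ih i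

end LRep

/-- The tree `v` represents the polynomial `y` by a list of at most `n` coefficients. -/
def ListRep (r : Val → R → Prop) (n : ℕ) (v : Val) (y : R[X]) : Prop :=
  ∃ L : List Val, v = encList L ∧ L.length ≤ n ∧ LRep r L y

namespace ListRep
variable {r : Val → R → Prop} {n : ℕ} {v : Val} {y : R[X]}

lemma nil (n : ℕ) : ListRep r n .nil 0 := ⟨[], rfl, Nat.zero_le _, .nil⟩

lemma mono {r' : Val → R → Prop} {n' : ℕ} (h : ListRep r n v y) (hn : n ≤ n')
    (hr : ∀ v x, r v x → r' v x) : ListRep r' n' v y := by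
  obtain ⟨L, rfl, hL, h⟩ := h
  exact ⟨L, rfl, hL.trans hn, h.mono hr⟩

lemma coeff_eq_zero (h : ListRep r n v y) {i : ℕ} (hi : n ≤ i) : y.coeff i = 0 := by
  obtain ⟨L, rfl, hL, h⟩ := h
  exact h.coeff_eq_zero (hL.trans hi)

lemma hd (h : ListRep r n v y) (h0 : r .nil 0) : r v.hd (y.coeff 0) := by
  obtain ⟨L, rfl, hL, h⟩ := h
  exact h.hd h0

lemma tl (h : ListRep r n v y) : ListRep r (n - 1) v.tl y.divX := by
  obtain ⟨L, rfl, hL, h⟩ := h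
  exact ⟨L.tail, tl_encList L, by simp; omega, h.tail⟩

lemma cons {a : Val} {x : R} (ha : r a x) (h : ListRep r n v y) :
    ListRep r (n + 1) (.cons a v) (C x + X * y) := by
  obtain ⟨L, rfl, hL, h⟩ := h
  exact ⟨a :: L, rfl, by simpa, .cons ha h⟩

lemma shift (h : ListRep r n v y) (h0 : r .nil 0) : ListRep r (n + 1) (.cons .nil v) (X * y) := by
  simpa using h.cons h0

end ListRep

variable {r : Val → R → Prop} {E : Val} {add : Fn} {t : ℕ}

/-- One pass over the first list, consuming the second list in parallel. A second list that is too
short delivers `nil`, which represents `0` by `h0`; what remains of one that is too long is appended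
at the end. -/
lemma padd_spec (h0 : r .nil 0)
    (hadd : ∀ u x v y, r u x → r v y → r (add.eval (.cons u (.cons v E))) (x + y) ∧
      add.cost (.cons u (.cons v E)) ≤ t)
    {n : ℕ} {u v : Val} {x y : R[X]} (hu : ListRep r n u x) (hv : ListRep r n v y) :
    ListRep r n ((padd add).eval (.cons u (.cons v E))) (x + y) ∧
      (padd add).cost (.cons u (.cons v E)) ≤ n * (t + 100) + 100 := by
  obtain ⟨L, rfl, hL, hu⟩ := hu
  obtain ⟨M, rfl, hM, hv⟩ := hv
  obtain ⟨⟨x', y', M', O, h1, h2, h3, h4, h5, h6⟩, h7⟩ := for_inv (l := var 0)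
    (a := .pair (var 1) .nil)
    (s := .pair (.comp .tl (.comp .hd (var 0)))
      (.pair (call₂ add (var 1) (.comp .hd (.comp .hd (var 0))) (drop 4)) (.comp .tl (var 0))))
    (x := .cons (encList L) (.cons (encList M) E)) (B := t + 50)
    -- The last clause says that the reversed output, completed by any list for the sum of what
    -- remains, represents the whole sum.
    (fun Lr acc => ∃ x' y' M' O, LRep r Lr x' ∧ LRep r M' y' ∧
      acc = .cons (encList M') (encList O) ∧ O.length + Lr.length = L.length ∧
      M'.length ≤ n - O.length ∧
      ∀ W, LRep r W (x' + y') → LRep r (O.reverse ++ W) (x + y)) (L := L) (by simp)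
    ⟨x, y, M, [], hu, hv, by simp, by simp, by simpa, by simp⟩ (by
      rintro z Lr _ ⟨x', y', M', O, h1, h2, rfl, h4, h5, h6⟩
      cases h1 with
      | @cons _ x₀ _ x₁ ha hx =>
      obtain ⟨h7, h8⟩ := hadd z x₀ _ _ ha (h2.hd h0)
      refine ⟨⟨x₁, y'.divX, M'.tail, add.eval (.cons z (.cons (encList M').hd E)) :: O, hx, h2.tail,
        by simp [tl_encList], ?_, ?_, fun W hW => ?_⟩, ?_⟩
      · simp only [List.length_cons] at h4 ⊢; omega
      · simp only [List.length_cons, List.length_tail]; omega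
      · have := h6 _ (by
          convert LRep.cons h7 hW using 1
          rw [C_add]
          nth_rw 1 [← X_mul_divX_add y']
          ring)
        simpa using this
      · simp
        omega)
  cases h1
  rw [List.length_nil] at h4
  have h8 := h6 M' (by simpa using h2)
  refine ⟨⟨_, ?_, ?_, h8⟩, ?_⟩
  · simp only [padd, eval_letIn, h3, eval_call₂, eval_var_zero_cons, Fn.eval_comp, eval_hd, eval_tl,
      hd_cons, tl_cons, revApp_eval]
  · simp only [List.length_append, List.length_reverse]; omega
  · have h9 := revApp_cost O (encList M') .nil
    have h10 : L.length * (t + 50 + 9) + L.length * 20 ≤ n * (t + 100) := by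
      rw [← mul_add]; exact Nat.mul_le_mul hL (by omega)
    simp only [padd, cost_letIn, h3, cost_call₂, eval_var_zero_cons, Fn.eval_comp, eval_hd, eval_tl,
      hd_cons, tl_cons, eval_nil, cost_var, cost_nil, cost_comp, cost_hd, cost_tl, cost_pair]
      at h7 ⊢
    omega

lemma pmap_spec {f : Fn} {a : Val} {r' : Val → R → Prop} {s : R →+ R}
    (hf : ∀ u x, r u x → r' (f.eval (.cons a (.cons u E))) (s x) ∧
      f.cost (.cons a (.cons u E)) ≤ t)
    {n : ℕ} {u : Val} {x y : R[X]} (hu : ListRep r n u x) (hy : ∀ i, y.coeff i = s (x.coeff i)) :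
    ListRep r' n ((mapF f).eval (.cons a (.cons u E))) y ∧
      (mapF f).cost (.cons a (.cons u E)) ≤ n * (t + 80) + 80 := by
  obtain ⟨L, rfl, hL, hu⟩ := hu
  have hL' : ∀ {L x}, LRep r L x → ∀ v ∈ L, f.cost (.cons a (.cons v E)) ≤ t := by
    intro L x hu
    induction hu with
    | nil => simp
    | cons h _ ih =>
      intro v hv
      rcases List.mem_cons.mp hv with rfl | hv
      · exact (hf _ _ h).2
      · exact ih v hv
  obtain ⟨h1, h2⟩ := mapF_spec L (hL' hu)
  refine ⟨⟨_, h1, by simpa, hu.map (fun v _ x hx => (hf v x hx).1) hy⟩, h2.trans ?_⟩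
  gcongr

lemma pnz_spec {nz : Fn} (hnz : ∀ u x, r u x → (nz.eval (.cons u E) ≠ .nil ↔ x ≠ 0) ∧
      nz.cost (.cons u E) ≤ t)
    {n : ℕ} {u : Val} {x : R[X]} (hu : ListRep r n u x) :
    ((pnz nz).eval (.cons u E) ≠ .nil ↔ x ≠ 0) ∧
      (pnz nz).cost (.cons u E) ≤ n * (t + 80) + 80 := by
  obtain ⟨L, rfl, hL, hu⟩ := hu
  obtain ⟨⟨x', h1, h2⟩, h3⟩ := for_inv (l := var 0) (a := .nil)
    (s := .ite (var 0) (var 0) (call₁ nz (var 1) (drop 3)))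
    (x := .cons (encList L) E) (B := t + 50)
    (fun Lr acc => ∃ x', LRep r Lr x' ∧ (x ≠ 0 ↔ (acc ≠ .nil ∨ x' ≠ 0))) (L := L) (by simp)
    ⟨x, hu, by simp⟩ (by
      rintro z Lr acc ⟨x', h1, h2⟩
      cases h1 with
      | @cons _ x₀ _ x₁ ha hx =>
      obtain ⟨h3, h4⟩ := hnz _ _ ha
      have e : C x₀ + X * x₁ ≠ 0 ↔ (x₀ ≠ 0 ∨ x₁ ≠ 0) := by
        rw [← not_iff_not]
        push Not
        constructor
        · intro h
          have h0 : x₀ = 0 := by simpa using congrArg (fun q => q.coeff 0) h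
          refine ⟨h0, ?_⟩
          simpa [h0] using h
        · rintro ⟨rfl, rfl⟩
          simp
      rw [e] at h2
      by_cases hacc : acc = .nil
      · rw [eval_ite_nil _ _ (by simpa using hacc), cost_ite_nil _ _ (by simpa using hacc)]
        refine ⟨⟨x₁, hx, ?_⟩, ?_⟩
        · simp [h2, hacc, h3]
        · simp; omega
      · rw [eval_ite_ne _ _ (by simpa using hacc), cost_ite_ne _ _ (by simpa using hacc)]
        refine ⟨⟨x₁, hx, ?_⟩, ?_⟩
        · simp [h2, hacc]
        · simp)
  cases h1
  refine ⟨by simpa [pnz] using h2.symm, h3.trans ?_⟩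
  have : L.length * (t + 50 + 9) ≤ n * (t + 80) := Nat.mul_le_mul hL (by omega)
  simp
  omega

/-- Schoolbook multiplication with the invariant `o + x' * w = x * y`: `o` is the sum so far, `x'`
the unread part of the first factor, and `w` the second factor times a power of `X`. The three
relations allow entries of different size in the factors and the product. -/
lemma pmul_spec {r₁ r₂ : Val → R → Prop} {mul : Fn} (h0 : r .nil 0) (h0' : r₂ .nil 0)
    (hadd : ∀ u x v y, r u x → r v y → r (add.eval (.cons u (.cons v E))) (x + y) ∧
      add.cost (.cons u (.cons v E)) ≤ t)
    (hmul : ∀ u x v y, r₁ u x → r₂ v y → r (mul.eval (.cons u (.cons v E))) (x * y) ∧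
      mul.cost (.cons u (.cons v E)) ≤ t)
    {n₁ n₂ : ℕ} {u v : Val} {x y : R[X]} (hu : ListRep r₁ n₁ u x) (hv : ListRep r₂ n₂ v y) :
    ListRep r (n₁ + n₂) ((pmul add mul).eval (.cons u (.cons v E))) (x * y) ∧
      (pmul add mul).cost (.cons u (.cons v E)) ≤
        n₁ * ((n₁ + n₂) * (2 * t + 200) + 300) + 50 := by
  obtain ⟨L, rfl, hL, hu⟩ := hu
  obtain ⟨⟨x', o, w, k, h1, h2, h3, h4, h5⟩, h6⟩ := for_inv (l := var 0)
    (a := .pair .nil (var 1))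
    (s := .pair (call₂ (padd add) (.comp .hd (var 0))
        (call₂ (mapF mul) (var 1) (.comp .tl (var 0)) (drop 4)) (drop 4))
      (.pair .nil (.comp .tl (var 0))))
    (x := .cons (encList L) (.cons v E)) (B := (n₁ + n₂) * (2 * t + 180) + 250)
    (fun Lr acc => ∃ x' o w k, LRep r₁ Lr x' ∧ k + Lr.length = L.length ∧
      ListRep r (n₁ + n₂) acc.hd o ∧
      ListRep r₂ (n₂ + k) acc.tl w ∧ o + x' * w = x * y) (L := L) (by simp)
    ⟨x, 0, y, 0, hu, by simp, .nil _, by simpa using hv, by simp⟩ (by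
      rintro z Lr acc ⟨x', o, w, k, h1, h2, h3, h4, h5⟩
      cases h1 with
      | @cons _ x₀ _ x₁ ha hx =>
      rw [List.length_cons] at h2
      obtain ⟨h6, h7⟩ := pmap_spec (E := E) (f := mul) (a := z) (r' := r) (s := AddMonoidHom.mulLeft x₀)
        (t := t) (fun u y hy => hmul _ _ _ _ ha hy) h4 (y := C x₀ * w) (by simp)
      obtain ⟨h8, h9⟩ := padd_spec h0 hadd h3 (h6.mono (show _ ≤ n₁ + n₂ by omega) fun _ _ h => h)
      refine ⟨⟨x₁, o + C x₀ * w, X * w, k + 1, hx, by omega, by simpa using h8,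
        by simpa [add_assoc] using h4.shift h0', by rw [← h5]; ring⟩, ?_⟩
      have h10 : (n₂ + k) * (t + 80) ≤ (n₁ + n₂) * (t + 80) := Nat.mul_le_mul_right _ (by omega)
      have h11 : (n₁ + n₂) * (2 * t + 180) = (n₁ + n₂) * (t + 80) + (n₁ + n₂) * (t + 100) := by ring
      simp
      omega)
  cases h1
  refine ⟨?_, ?_⟩
  · rw [zero_mul, add_zero] at h5
    simpa [pmul, ← h5] using h3
  · rw [pmul, cost_comp, cost_hd]
    refine (Nat.add_le_add_right h6 1).trans ?_
    have : L.length * ((n₁ + n₂) * (2 * t + 180) + 250 + 9) ≤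
        n₁ * ((n₁ + n₂) * (2 * t + 200) + 300) :=
      Nat.mul_le_mul hL (by
        have : (n₁ + n₂) * (2 * t + 180) ≤ (n₁ + n₂) * (2 * t + 200) :=
          Nat.mul_le_mul_left _ (by omega)
        omega)
    simp
    omega

/-- Horner's rule `D(a + X y) = y + X D(y)`, applied from the top coefficient downwards, needs
additions only and no multiplication by integers. -/
lemma pderiv_spec (h0 : r .nil 0)
    (hadd : ∀ u x v y, r u x → r v y → r (add.eval (.cons u (.cons v E))) (x + y) ∧
      add.cost (.cons u (.cons v E)) ≤ t)
    {n : ℕ} {u : Val} {x : R[X]} (hu : ListRep r n u x) :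
    ListRep r n ((pderiv add).eval (.cons u E)) (derivative x) ∧
      (pderiv add).cost (.cons u E) ≤ n * (n * (t + 100) + 300) + 100 := by
  obtain ⟨L, rfl, hL, hu⟩ := hu
  have hcoeff : ∀ k i, (divX^[k] x).coeff i = x.coeff (i + k) := by
    intro k
    induction k with
    | zero => simp
    | succ k ih => intro i; rw [Function.iterate_succ_apply', coeff_divX, ih]; congr 1; omega
  obtain ⟨⟨M, x', h1, h2, h3, h4, h5⟩, h6⟩ := for_inv (l := call₂ revApp (var 0) .nil .nil)
    (a := .nil)
    (s := .pair (.pair (var 1) (.comp .hd (var 0)))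
      (call₂ (padd add) (.comp .hd (var 0)) (.pair .nil (.comp .tl (var 0))) (drop 3)))
    (x := .cons (encList L) E) (B := n * (t + 100) + 200)
    (fun Lr acc => ∃ M x', L = Lr.reverse ++ M ∧ LRep r M x' ∧ acc.hd = encList M ∧
      ListRep r M.length acc.tl (derivative x') ∧ x' = divX^[Lr.length] x) (L := L.reverse)
    (by simp [rev_eval]) ⟨[], 0, by simp, .nil, by simp, by simpa using .nil 0, by
      ext i; rw [hcoeff, hu.coeff_eq_zero (by simp), coeff_zero]⟩ (by
      rintro z Lr acc ⟨M, x', h1, h2, h3, h4, h5⟩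
      have hx₀ : r z (x.coeff Lr.length) := by
        rw [h1] at hu
        simp only [List.reverse_cons, List.append_assoc, List.cons_append, List.nil_append] at hu
        simpa using hu.getD h0 Lr.length
      have hM : M.length + 1 ≤ n := by
        rw [h1] at hL
        simp at hL
        omega
      obtain ⟨h8, h9⟩ := padd_spec (n := M.length + 1) h0 hadd ⟨M, rfl, by omega, h2⟩ (h4.shift h0)
      refine ⟨⟨z :: M, C (x.coeff Lr.length) + X * x', by simpa using h1, .cons hx₀ h2,
        by simp [h3], ?_, ?_⟩, ?_⟩
      · simpa [h3] using h8
      · rw [h5, List.length_cons, Function.iterate_succ_apply']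
        nth_rw 2 [← X_mul_divX_add (divX^[Lr.length] x)]
        rw [hcoeff, zero_add, add_comm]
      · have h10 : (M.length + 1) * (t + 100) ≤ n * (t + 100) := Nat.mul_le_mul_right _ hM
        simp [h3]
        omega)
  refine ⟨?_, ?_⟩
  · have hM : L = M := by simpa using h1
    subst hM
    have : x = x' := by simpa using h5.symm
    rw [pderiv, Fn.eval_comp, eval_tl, this]
    exact h4.mono hL fun _ _ h => h
  · rw [pderiv, cost_comp, cost_tl]
    refine (Nat.add_le_add_right h6 1).trans ?_
    have h7 := revApp_cost L .nil .nil
    have : L.reverse.length * (n * (t + 100) + 200 + 9) + L.length * 20 ≤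
        n * (n * (t + 100) + 300) := by
      rw [List.length_reverse, ← mul_add]
      exact Nat.mul_le_mul hL (by omega)
    simp at this ⊢
    omega

end poly
end FactorFqt


namespace FactorFqt
open Fn

/-! ### Rings with computable operations -/

/-- Programs for addition, multiplication by elements of the prime field and the test for being
nonzero, and a bound for their time. -/
structure ModFn : Type where
  /-- addition -/
  add : Fn
  /-- multiplication by an element of the prime field -/
  scale : Fn
  /-- test for being nonzero -/
  nz : Fn
  /-- the time -/
  t : ℕ → ℕ

/-- The programs are correct for the representation `rep` of the elements of `R`, where `rep b`
is the representation by trees of size bounded by `b`. -/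
structure ModFn.Spec (P : ModFn) (p b₀ : ℕ) [Fact p.Prime] (E : Val) {R : Type*} [CommRing R]
    [Algebra (ZMod p) R] (rep : ℕ → Val → R → Prop) : Prop where
  mono : ∀ {b b' v x}, b ≤ b' → rep b v x → rep b' v x
  zero : ∀ b, rep b .nil 0
  add : ∀ {b u v x y}, b₀ ≤ b → rep b u x → rep b v y →
    rep b (P.add.eval (.cons u (.cons v E))) (x + y) ∧ P.add.cost (.cons u (.cons v E)) ≤ P.t b
  scale : ∀ {b u x} (s : ZMod p), b₀ ≤ b → rep b u x →
    rep b (P.scale.eval (.cons (encNat s.val) (.cons u E))) (s • x) ∧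
      P.scale.cost (.cons (encNat s.val) (.cons u E)) ≤ P.t b
  nz : ∀ {b u x}, b₀ ≤ b → rep b u x → (P.nz.eval (.cons u E) ≠ .nil ↔ x ≠ 0) ∧
    P.nz.cost (.cons u E) ≤ P.t b

/-- The program `mul` multiplies in time `t`. -/
def MulSpec (mul : Fn) (t : ℕ → ℕ) (b₀ : ℕ) (E : Val) {R : Type*} [CommRing R]
    (rep : ℕ → Val → R → Prop) : Prop :=
  ∀ {b₁ b₂ u v x y}, b₀ ≤ b₁ → b₀ ≤ b₂ → rep b₁ u x → rep b₂ v y →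
    rep (b₁ + b₂) (mul.eval (.cons u (.cons v E))) (x * y) ∧
      mul.cost (.cons u (.cons v E)) ≤ t (b₁ + b₂)

/-- The operations for polynomials. -/
def ModFn.lift (P : ModFn) : ModFn where
  add := padd P.add
  scale := mapF P.scale
  nz := pnz P.nz
  t b := b * (P.t b + 100) + 100

/-- The time for multiplication of polynomials. -/
def tpmul (t t' : ℕ → ℕ) (b : ℕ) : ℕ := b * (b * (2 * (t b + t' b) + 200) + 300) + 50

/-- The representation of polynomials. -/
def liftRep {R : Type*} [CommRing R] (rep : ℕ → Val → R → Prop) (b : ℕ) : Val → R[X] → Prop :=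
  ListRep (rep b) b

section lift
variable {P : ModFn} {p b₀ : ℕ} [Fact p.Prime] {E : Val} {R : Type*} [CommRing R]
  [Algebra (ZMod p) R] {rep : ℕ → Val → R → Prop}

/-- Applied twice, this carries the operations from `𝔽_q` to `𝔽_q[t]` and then to `𝔽_q[t][X]`; a
single `b` bounds the lengths on all levels. -/
lemma ModFn.Spec.lift (h : P.Spec p b₀ E rep) : P.lift.Spec p b₀ E (liftRep rep) where
  mono hb hv := ListRep.mono hv hb fun _ _ => h.mono hb
  zero b := .nil b
  add hb hu hv := padd_spec (h.zero _) (fun _ _ _ _ hu hv => h.add hb hu hv) hu hv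
  scale {b u x} s hb hu := by
    obtain ⟨h1, h2⟩ := pmap_spec (E := E) (f := P.scale) (a := encNat s.val) (r' := rep b)
      (s := DistribSMul.toAddMonoidHom R s) (fun _ _ hu => h.scale s hb hu) hu (y := s • x)
      (by simp)
    refine ⟨h1, h2.trans ?_⟩
    have : b * (P.t b + 80) ≤ b * (P.t b + 100) := Nat.mul_le_mul_left _ (by omega)
    simp only [ModFn.lift]
    omega
  nz {b u x} hb hu := by
    obtain ⟨h1, h2⟩ := pnz_spec (E := E) (fun _ _ hu => h.nz hb hu) hu
    refine ⟨h1, h2.trans ?_⟩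
    have : b * (P.t b + 80) ≤ b * (P.t b + 100) := Nat.mul_le_mul_left _ (by omega)
    simp only [ModFn.lift]
    omega

lemma MulSpec.lift {mul : Fn} {t : ℕ → ℕ} (hm : MulSpec mul t b₀ E rep) (h : P.Spec p b₀ E rep) :
    MulSpec (pmul P.add mul) (tpmul P.t t) b₀ E (liftRep rep) := by
  intro b₁ b₂ u v x y hb₁ hb₂ hu hv
  obtain ⟨h1, h2⟩ := pmul_spec (t := P.t (b₁ + b₂) + t (b₁ + b₂)) (h.zero (b₁ + b₂)) (h.zero b₂)
    (fun u x v y hu hv => by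
      obtain ⟨h3, h4⟩ := h.add (by omega) hu hv
      exact ⟨h3, by omega⟩)
    (fun u x v y hu hv => by
      obtain ⟨h3, h4⟩ := hm hb₁ hb₂ hu hv
      exact ⟨h3, by omega⟩) hu hv
  refine ⟨h1, h2.trans ?_⟩
  rw [tpmul]
  gcongr
  omega

end lift

/-! ### Arithmetic in the finite field -/

section field
variable {p m : ℕ} [Fact p.Prime] {F : Type u} [Field F] [Algebra (ZMod p) F]
  (γ : Module.Basis (Fin m) (ZMod p) F)

/-- The representation of the elements of the prime field. -/
def srep (p : ℕ) (v : Val) (x : ZMod p) : Prop := v = encNat x.val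

lemma srep_zero : srep p .nil 0 := by simp [srep]

/-- The element of the field with given coordinates. -/
noncomputable def ofCoord : (ZMod p)[X] →ₗ[ZMod p] F := ∑ i : Fin m, (lcoeff (ZMod p) i).smulRight (γ i)

lemma ofCoord_apply (y : (ZMod p)[X]) : ofCoord γ y = ∑ i : Fin m, y.coeff i • γ i := by
  simp [ofCoord]

/-- Linear independence of the basis. The hypothesis is needed because `ofCoord` ignores the
coefficients from `m` on. -/
lemma ofCoord_eq_zero {y : (ZMod p)[X]} (h : ∀ i, m ≤ i → y.coeff i = 0) :
    ofCoord γ y = 0 ↔ y = 0 := by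
  refine ⟨fun h0 => ?_, fun h0 => by rw [h0, map_zero]⟩
  rw [ofCoord_apply] at h0
  have := Fintype.linearIndependent_iff.mp γ.linearIndependent _ h0
  ext i
  by_cases hi : i < m
  · simpa using this ⟨i, hi⟩
  · simpa using h i (by omega)

/-- The representation of the elements of the finite field by lists of coordinates. -/
def frep (_ : ℕ) (v : Val) (x : F) : Prop :=
  ∃ y : (ZMod p)[X], ListRep (srep p) m v y ∧ ofCoord γ y = x

/-- The vector space operations in the finite field. -/
def fieldFn : ModFn where
  add := padd sadd
  scale := mapF smul
  nz := pnz (var 0)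
  t b := b * (tadd b + tmul b + 100) + 100

/-- Linear combination of a list of vectors. -/
def lincomb : Fn :=
  .comp .tl (for_ (var 1) (.pair (var 0) .nil)
    (.pair (.comp .tl (.comp .hd (var 0)))
      (call₂ (padd sadd) (.comp .tl (var 0))
        (call₂ (mapF smul) (.comp .hd (.comp .hd (var 0))) (var 1) (drop 4)) (drop 4))))

/-- Multiplication in the finite field. -/
def fmul : Fn :=
  call₂ lincomb (var 0) (call₂ (mapF lincomb) (var 1) (drop 3) (drop 2)) (drop 2)

/-- The time of `lincomb`. -/
def tlin (b : ℕ) : ℕ := b * (2 * fieldFn.t b + 400) + 50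

/-- The time of `fmul`. -/
def tfmul (b : ℕ) : ℕ := b * (tlin b + 80) + tlin b + 200

lemma tadd_mono : Monotone tadd := by
  intro a b h
  simp only [tadd, tsucc]
  gcongr

lemma tmul_mono : Monotone tmul := by
  intro a b h
  have := tadd_mono h
  simp only [tmul]
  gcongr

/-- Elements of `𝔽_q` are coordinate polynomials over `𝔽_p`, so the vector space operations are
those for coefficient lists. The prime is read from the environment, which is the encoded field
itself; `p + m ≤ b` lets `b` bound all sizes. -/
lemma fieldFn_spec : fieldFn.Spec p (p + m) (encField γ) (frep γ) where
  mono _ h := h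
  zero b := ⟨0, .nil m, map_zero _⟩
  add {b u v x y} hb := by
    rintro ⟨x, hx, rfl⟩ ⟨y, hy, rfl⟩
    obtain ⟨h1, h2⟩ := padd_spec (E := encField γ) (add := sadd) (t := tadd p) srep_zero
      (by rintro _ x _ y rfl rfl; exact sadd_spec (encField γ).tl x y) hx hy
    refine ⟨⟨_, h1, map_add _ _ _⟩, h2.trans ?_⟩
    have := tadd_mono (show p ≤ b by omega)
    simp only [fieldFn]
    gcongr <;> omega
  scale {b u x} s hb := by
    rintro ⟨x, hx, rfl⟩
    obtain ⟨h1, h2⟩ := pmap_spec (E := encField γ) (f := smul) (t := tmul p)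
      (a := encNat s.val) (r' := srep p) (s := DistribSMul.toAddMonoidHom _ s)
      (by rintro _ x rfl; exact smul_spec (encField γ).tl s x) hx (y := s • x) (by simp)
    refine ⟨⟨_, h1, map_smul _ _ _⟩, h2.trans ?_⟩
    have := tmul_mono (show p ≤ b by omega)
    simp only [fieldFn]
    gcongr <;> omega
  nz {b u x} hb := by
    rintro ⟨x, hx, rfl⟩
    obtain ⟨h1, h2⟩ := pnz_spec (E := encField γ) (nz := var 0) (t := 2)
      (by rintro _ x rfl; simp [encNat_eq_nil]) hx
    refine ⟨?_, h2.trans ?_⟩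
    · rw [fieldFn, h1, not_iff_not, ofCoord_eq_zero γ fun i hi => hx.coeff_eq_zero hi]
    · have : m * (2 + 80) ≤ b * (tadd b + tmul b + 100) := Nat.mul_le_mul (by omega) (by omega)
      simp only [fieldFn]
      omega

/-- The linear combination of a list of vectors whose coefficients are those of a polynomial. -/
noncomputable def linComb {V : Type*} [AddCommGroup V] [Module (ZMod p) V] : (ZMod p)[X] → List V → V
  | _, [] => 0
  | y, x :: l => y.coeff 0 • x + linComb y.divX l

lemma linComb_ofFn {V : Type*} [AddCommGroup V] [Module (ZMod p) V] {k : ℕ} (y : (ZMod p)[X])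
    (x : Fin k → V) : linComb y (List.ofFn x) = ∑ i : Fin k, y.coeff i • x i := by
  induction k generalizing y with
  | zero => simp [linComb]
  | succ k ih => simp [List.ofFn_succ, linComb, ih, Fin.sum_univ_succ, coeff_divX]

/-- Invariant: the partial sum plus the combination of the unread vectors with the unread
coefficients is constant. Missing coefficients count as zero. -/
lemma lincomb_spec {b : ℕ} (hb : p + m ≤ b) {u : Val} {y : (ZMod p)[X]}
    (hu : ListRep (srep p) m u y) {L : List Val} {l : List F} (hL : List.Forall₂ (frep γ b) L l)
    (hb' : L.length ≤ b) :
    frep γ b (lincomb.eval (.cons u (.cons (encList L) (encField γ)))) (linComb y l) ∧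
      lincomb.cost (.cons u (.cons (encList L) (encField γ))) ≤ tlin b := by
  have S := fieldFn_spec γ
  obtain ⟨⟨y', l', o, h1, h2, h3, h4⟩, h6⟩ := for_inv (l := var 1) (a := .pair (var 0) .nil)
    (s := .pair (.comp .tl (.comp .hd (var 0)))
      (call₂ (padd sadd) (.comp .tl (var 0))
        (call₂ (mapF smul) (.comp .hd (.comp .hd (var 0))) (var 1) (drop 4)) (drop 4)))
    (x := .cons u (.cons (encList L) (encField γ))) (B := 2 * fieldFn.t b + 200)
    (fun Lr acc => ∃ y' l' o, ListRep (srep p) m acc.hd y' ∧ List.Forall₂ (frep γ b) Lr l' ∧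
      frep γ b acc.tl o ∧ o + linComb y' l' = linComb y l) (L := L) (by simp)
    ⟨y, l, 0, by simpa using hu, hL, by simpa using S.zero b, by simp⟩ (by
      rintro z Lr acc ⟨y', l', o, h1, h2, h3, h4⟩
      cases h2 with
      | @cons _ x _ l' hz h2 =>
      have h5 : acc.hd.hd = encNat (y'.coeff 0).val := h1.hd srep_zero
      obtain ⟨h6, h7⟩ := S.scale (y'.coeff 0) hb hz
      obtain ⟨h8, h9⟩ := S.add hb h3 h6
      simp only [fieldFn] at h8 h9 h7
      refine ⟨⟨y'.divX, l', o + y'.coeff 0 • x, ?_, h2, ?_, ?_⟩, ?_⟩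
      · simpa using h1.tl.mono (Nat.sub_le _ _) fun _ _ h => h
      · simpa [h5] using h8
      · rw [← h4, linComb, add_assoc]
      · simp [h5, fieldFn]
        omega)
  cases h2
  rw [linComb, add_zero] at h4
  refine ⟨?_, ?_⟩
  · rw [← h4]
    simpa [lincomb] using h3
  · rw [lincomb, cost_comp, cost_tl]
    refine (Nat.add_le_add_right h6 1).trans ?_
    have : L.length * (2 * fieldFn.t b + 200 + 9) ≤ b * (2 * fieldFn.t b + 400) :=
      Nat.mul_le_mul hb' (by omega)
    rw [tlin]
    simp
    omega

lemma frep_encScalar (b : ℕ) (x : F) : frep γ b (encScalar γ x) x := by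
  have hc : ∀ i, (∑ j : Fin m, monomial (j : ℕ) (γ.repr x j)).coeff i =
      if h : i < m then γ.repr x ⟨i, h⟩ else 0 := by
    intro i
    simp only [finsetSum_coeff, coeff_monomial]
    split_ifs with h
    · rw [Finset.sum_eq_single ⟨i, h⟩] <;> simp +contextual [Fin.ext_iff]
    · exact Finset.sum_eq_zero fun j _ => if_neg (by have := j.2; omega)
  refine ⟨∑ i : Fin m, monomial (i : ℕ) (γ.repr x i), ⟨_, rfl, by simp,
    .of_coeff (fun i h => ?_) fun i h => ?_⟩, ?_⟩
  · rw [List.length_ofFn] at h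
    rw [hc, dif_pos h]
    simp [srep]
  · rw [hc, dif_neg (by simpa using h)]
  · rw [ofCoord_apply]
    conv_rhs => rw [← γ.sum_repr x]
    exact Finset.sum_congr rfl fun i _ => by rw [hc, dif_pos i.2]

/-- Row `i` of the multiplication table, combined with the coordinates of `y`, gives `γ_i y`;
combining these products with the coordinates of `x` gives `x y`. -/
lemma fmul_spec : MulSpec fmul tfmul (p + m) (encField γ) (frep γ) := by
  rintro b₁ b₂ u v x y hb₁ hb₂ ⟨x, hx, rfl⟩ ⟨y, hy, rfl⟩
  have hb : p + m ≤ b₁ + b₂ := by omega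
  have hrow : ∀ i, List.Forall₂ (frep γ (b₁ + b₂))
      (List.ofFn fun j => encScalar γ (γ i * γ j)) (List.ofFn fun j => γ i * γ j) := by
    intro i
    rw [List.forall₂_iff_get]
    exact ⟨by simp, fun k _ _ => by simpa using frep_encScalar γ _ _⟩
  have h1 := fun i => lincomb_spec γ hb hy (hrow i) (by simp; omega)
  obtain ⟨h2, h3⟩ := mapF_spec (f := lincomb) (a := v) (E := encField γ) (B := tlin (b₁ + b₂))
    (List.ofFn fun i => encList (List.ofFn fun j => encScalar γ (γ i * γ j))) (by
      intro z hz
      obtain ⟨i, rfl⟩ := (List.mem_ofFn' _ _).mp hz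
      exact (h1 i).2)
  have h4 : List.Forall₂ (frep γ (b₁ + b₂))
      ((List.ofFn fun i => encList (List.ofFn fun j => encScalar γ (γ i * γ j))).map
        fun x => lincomb.eval (.cons v (.cons x (encField γ))))
      (List.ofFn fun i => linComb y (List.ofFn fun j => γ i * γ j)) := by
    rw [List.forall₂_iff_get]
    exact ⟨by simp, fun k _ _ => by simpa using (h1 _).1⟩
  obtain ⟨h5, h6⟩ := lincomb_spec γ hb hx h4 (by simp; omega)
  have e : fmul.eval (.cons u (.cons v (encField γ))) = lincomb.eval (.cons u (.cons
      ((mapF lincomb).eval (.cons v (.cons (encField γ).tl (encField γ)))) (encField γ))) := rfl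
  have e' : fmul.cost (.cons u (.cons v (encField γ))) = lincomb.cost (.cons u (.cons
      ((mapF lincomb).eval (.cons v (.cons (encField γ).tl (encField γ)))) (encField γ))) +
      (mapF lincomb).cost (.cons v (.cons (encField γ).tl (encField γ))) + 27 := by
    have : encField γ = .cons (encNat p) (encField γ).tl := rfl
    rw [fmul, this]
    simp
    omega
  rw [encField, tl_cons, ← encField] at e e'
  rw [h2] at e e'
  rw [e, e']
  constructor
  · convert h5 using 1
    rw [linComb_ofFn, ofCoord_apply, ofCoord_apply, Finset.sum_mul]
    refine Finset.sum_congr rfl fun i _ => ?_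
    rw [linComb_ofFn, Finset.mul_sum, Finset.smul_sum]
    refine Finset.sum_congr rfl fun j _ => ?_
    rw [smul_mul_smul_comm, mul_smul]
  · rw [tfmul]
    have h7 : m * (tlin (b₁ + b₂) + 80) ≤ (b₁ + b₂) * (tlin (b₁ + b₂) + 80) :=
      Nat.mul_le_mul_right _ (by omega)
    rw [List.length_ofFn] at h3
    have h8 : lincomb.cost (.cons u (.cons (encList
      ((List.ofFn fun i => encList (List.ofFn fun j => encScalar γ (γ i * γ j))).map
        fun x => lincomb.eval (.cons v (.cons x (encField γ))))) (encField γ))) ≤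
        tlin (b₁ + b₂) := h6
    omega

end field
end FactorFqt


namespace FactorFqt
open Fn

/-! ### Kernels of linear maps over the prime field -/

section span
variable {k V : Type*} [Field k] [AddCommGroup V] [Module k V]

/-- The span of the elements of a list. -/
def lspan (k : Type*) {V : Type*} [Field k] [AddCommGroup V] [Module k V] (l : List V) :
    Submodule k V :=
  Submodule.span k {x | x ∈ l}

@[simp] lemma lspan_nil : lspan k ([] : List V) = ⊥ := by simp [lspan]

@[simp] lemma lspan_cons (x : V) (l : List V) :
    lspan k (x :: l) = Submodule.span k {x} ⊔ lspan k l := by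
  rw [lspan, lspan, ← Submodule.span_union]
  congr 1
  ext y
  simp

lemma lspan_append (l l' : List V) : lspan k (l ++ l') = lspan k l ⊔ lspan k l' := by
  induction l with
  | nil => simp
  | cons x l ih => simp [ih, sup_assoc]

lemma lspan_map {W : Type*} [AddCommGroup W] [Module k W] (φ : V →ₗ[k] W) (l : List V) :
    lspan k (l.map φ) = (lspan k l).map φ := by
  induction l with
  | nil => simp
  | cons x l ih => simp [ih, Submodule.map_sup, Submodule.map_span]

lemma mem_lspan {x : V} {l : List V} (h : x ∈ l) : x ∈ lspan k l := Submodule.subset_span h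

lemma lspan_le {l : List V} {S : Submodule k V} : lspan k l ≤ S ↔ ∀ x ∈ l, x ∈ S :=
  Submodule.span_le

end span

/-- Elimination of the first coordinate of a vector by means of another one. -/
def elim (P : ModFn) : Fn :=
  .pair
    (call₂ (padd sadd)
      (call₂ (mapF smul) (.comp .hd (.comp .hd (var 0))) (.comp .tl (.comp .hd (var 1))) (drop 2))
      (call₂ (mapF smul) (call₂ smul (.comp .tl (var 2)) (.comp .hd (.comp .hd (var 1))) (drop 2))
        (.comp .tl (.comp .hd (var 0))) (drop 2)) (drop 2))
    (call₂ P.add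
      (call₂ P.scale (.comp .hd (.comp .hd (var 0))) (.comp .tl (var 1)) (drop 2))
      (call₂ P.scale (call₂ smul (.comp .tl (var 2)) (.comp .hd (.comp .hd (var 1))) (drop 2))
        (.comp .tl (var 0)) (drop 2)) (drop 2))

/-- The elements of the span of a list of vectors whose first coordinate vanishes. -/
def cut (P : ModFn) : Fn :=
  .comp .tl (for_ (var 0) .nil
    (.ite (.comp .hd (.comp .hd (var 1)))
      (.ite (.comp .hd (var 0))
        (.pair (.comp .hd (var 0))
          (.pair (call₂ (elim P) (.comp .hd (var 0)) (var 1) (drop 3)) (.comp .tl (var 0))))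
        (.pair (var 1) (.comp .tl (var 0))))
      (.pair (.comp .hd (var 0))
        (.pair (.pair (.comp .tl (.comp .hd (var 1))) (.comp .tl (var 1))) (.comp .tl (var 0))))))

/-- The elements of the span of a list of vectors whose first coordinates vanish. -/
def ker (P : ModFn) : Fn := for_ (var 0) (var 1) (call₁ (cut P) (var 0) (drop 4))

/-- The time of `elim`. -/
def telim (P : ModFn) (N b : ℕ) : ℕ :=
  N * (tadd N + 2 * tmul N + 300) + 2 * tmul N + 3 * P.t b + 600

/-- The time of `cut` for lists of length `k`. -/
def tcut (P : ModFn) (k N b : ℕ) : ℕ := k * (telim P N b + 100) + 100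

section ker
variable {p m : ℕ} [Fact p.Prime] {F : Type u} [Field F] [Algebra (ZMod p) F]
  (γ : Module.Basis (Fin m) (ZMod p) F) {R : Type*} [CommRing R] [Algebra (ZMod p) R]
  {P : ModFn} {rep : ℕ → Val → R → Prop} {b₀ : ℕ}

/-- The representation of pairs of a vector over the prime field and an element of `R`. -/
def prep (p : ℕ) {R : Type*} (rep : ℕ → Val → R → Prop) (n b : ℕ) (v : Val)
    (x : (ZMod p)[X] × R) : Prop :=
  ListRep (srep p) n v.hd x.1 ∧ rep b v.tl x.2 ∧ v ≠ .nil

/-- The tail of the encoded prime represents `-1`; this is how the programs negate. -/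
lemma encNat_pred : encNat (p - 1) = encNat (-1 : ZMod p).val := by
  have hp := (Fact.out : p.Prime).one_lt
  have : (-1 : ZMod p) = ((p - 1 : ℕ) : ZMod p) := by
    rw [Nat.cast_sub hp.le]; simp
  rw [this, ZMod.val_cast_of_lt (by omega)]

/-- The combination `x₀ y - y₀ x` has first coordinate zero, and `divX` removes that coordinate.
Cross multiplication avoids inverses in `𝔽_p`. -/
lemma elim_spec (hP : P.Spec p b₀ (encField γ) rep) {n N b : ℕ} (hn : n ≤ N) (hb : b₀ ≤ b)
    (hpb : p ≤ N) {u v : Val} {x y : (ZMod p)[X] × R} (hu : prep p rep n b u x)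
    (hv : prep p rep n b v y) :
    prep p rep n b ((elim P).eval (.cons u (.cons v (encField γ))))
      (x.1.coeff 0 • y.1.divX + (-y.1.coeff 0) • x.1.divX,
        x.1.coeff 0 • y.2 + (-y.1.coeff 0) • x.2) ∧
    (elim P).cost (.cons u (.cons v (encField γ))) ≤ telim P N b := by
  obtain ⟨hu1, hu2, -⟩ := hu
  obtain ⟨hv1, hv2, -⟩ := hv
  have e1 : u.hd.hd = encNat (x.1.coeff 0).val := hu1.hd srep_zero
  have e2 : v.hd.hd = encNat (y.1.coeff 0).val := hv1.hd srep_zero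
  obtain ⟨h1, h2⟩ := smul_spec (encField γ).tl (-1 : ZMod p) (y.1.coeff 0)
  rw [neg_one_mul] at h1
  have sc : ∀ (s : ZMod p) (u : Val) (z : (ZMod p)[X]), ListRep (srep p) n u z →
      ListRep (srep p) n ((mapF smul).eval (.cons (encNat s.val) (.cons u (encField γ)))) (s • z) ∧
      (mapF smul).cost (.cons (encNat s.val) (.cons u (encField γ))) ≤ n * (tmul p + 80) + 80 := by
    intro s u z hz
    exact pmap_spec (E := encField γ) (f := smul) (t := tmul p)
      (a := encNat s.val) (r' := srep p) (s := DistribSMul.toAddMonoidHom _ s)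
      (by rintro _ x rfl; exact smul_spec (encField γ).tl s x) hz (y := s • z) (by simp)
  obtain ⟨h3, h4⟩ := sc (x.1.coeff 0) _ _ (hv1.tl.mono (Nat.sub_le _ _) fun _ _ h => h)
  obtain ⟨h5, h6⟩ := sc (-y.1.coeff 0) _ _ (hu1.tl.mono (Nat.sub_le _ _) fun _ _ h => h)
  obtain ⟨h7, h8⟩ := padd_spec (E := encField γ) (add := sadd) (t := tadd p) srep_zero
    (by rintro _ x _ y rfl rfl; exact sadd_spec (encField γ).tl x y) h3 h5
  obtain ⟨h9, h10⟩ := hP.scale (x.1.coeff 0) hb hv2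
  obtain ⟨h11, h12⟩ := hP.scale (-y.1.coeff 0) hb hu2
  obtain ⟨h13, h14⟩ := hP.add hb h9 h11
  have hE : encField γ = .cons (encNat p) (encField γ).tl := rfl
  rw [← hE] at h1 h2
  have h15 := tmul_mono hpb
  have h16 := tadd_mono hpb
  have h17 : n * (tmul p + 80) ≤ N * (tmul N + 80) := Nat.mul_le_mul hn (by omega)
  have h18 : n * (tadd p + 100) ≤ N * (tadd N + 100) := Nat.mul_le_mul hn (by omega)
  have h19 : N * (tadd N + 2 * tmul N + 300) = N * (tadd N + 100) + N * (tmul N + 80) +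
    N * (tmul N + 80) + N * 40 := by ring
  have hv0 : (var 0).eval (encField γ) = encNat p := rfl
  refine ⟨⟨?_, ?_, ?_⟩, ?_⟩
  · simpa [elim, e1, e2, hv0, tl_encNat, encNat_pred, h1] using h7
  · simpa [elim, e1, e2, hv0, tl_encNat, encNat_pred, h1] using h13
  · simp [elim]
  · rw [telim]
    simp [elim, e1, e2, hv0, tl_encNat, encNat_pred, h1]
    omega

/-- Multiplication of the first component by a power of `X`. -/
noncomputable def shiftMap (p : ℕ) [Fact p.Prime] (R : Type*) [CommRing R] [Algebra (ZMod p) R]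
    (k : ℕ) : (ZMod p)[X] × R →ₗ[ZMod p] (ZMod p)[X] × R :=
  LinearMap.prodMap (LinearMap.mulLeft (ZMod p) (X ^ k)) LinearMap.id

@[simp] lemma shiftMap_apply (k : ℕ) (x : (ZMod p)[X] × R) :
    shiftMap p R k x = (X ^ k * x.1, x.2) := rfl

lemma shiftMap_injective (k : ℕ) : Function.Injective (shiftMap p R k) := by
  rintro ⟨a, b⟩ ⟨c, d⟩ h
  simpa using h

/-- An element of the sum with first coordinate zero cannot involve `x`, whose first coordinate is
nonzero. -/
lemma comap_sup_span {S : Submodule (ZMod p) ((ZMod p)[X] × R)} {x : (ZMod p)[X] × R}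
    (hx : x.1.coeff 0 ≠ 0) :
    (S.map (shiftMap p R 1) ⊔ Submodule.span _ {x}).comap (shiftMap p R 1) = S := by
  ext y
  rw [Submodule.mem_comap, Submodule.mem_sup]
  constructor
  · rintro ⟨_, ⟨s, hs, rfl⟩, _, hz, h⟩
    obtain ⟨a, rfl⟩ := Submodule.mem_span_singleton.mp hz
    have h0 := congrArg (fun z => z.1.coeff 0) h
    have ha : a = 0 := by simpa [hx] using h0
    rw [ha, zero_smul, add_zero] at h
    rwa [← shiftMap_injective 1 h]
  · intro hy
    exact ⟨_, ⟨y, hy, rfl⟩, 0, zero_mem _, by simp⟩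

lemma span_pair_of_smul {k V : Type*} [Field k] [AddCommGroup V] [Module k V] {x y : V}
    {a c : k} (ha : a ≠ 0) :
    Submodule.span k {a • y + c • x} ⊔ Submodule.span k {x} =
      Submodule.span k {x} ⊔ Submodule.span k {y} := by
  apply le_antisymm
  · rw [sup_le_iff, Submodule.span_singleton_le_iff_mem]
    refine ⟨add_mem (Submodule.smul_mem _ _ (Submodule.mem_sup_right ?_))
      (Submodule.smul_mem _ _ (Submodule.mem_sup_left ?_)), le_sup_left⟩ <;>
    exact Submodule.mem_span_singleton_self _
  · rw [sup_le_iff, Submodule.span_singleton_le_iff_mem, Submodule.span_singleton_le_iff_mem]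
    refine ⟨Submodule.mem_sup_right (Submodule.mem_span_singleton_self _), ?_⟩
    have : y = a⁻¹ • (a • y + c • x) + (-(a⁻¹ * c)) • x := by
      rw [smul_add, smul_smul, inv_mul_cancel₀ ha, one_smul, smul_smul, add_assoc, ← add_smul]
      simp
    have h := add_mem (Submodule.smul_mem _ a⁻¹ (Submodule.mem_sup_left
      (T := Submodule.span k {x}) (Submodule.mem_span_singleton_self (R := k) (a • y + c • x))))
      (Submodule.smul_mem _ (-(a⁻¹ * c)) (Submodule.mem_sup_right
      (Submodule.mem_span_singleton_self x)))
    rwa [← this] at h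

/-- One step of Gaussian elimination: the first vector with nonzero first coordinate becomes the
pivot, later ones are reduced by it, and the pivot is dropped at the end. The span is tracked
instead of a matrix, so linear independence of the list is never needed. -/
lemma cut_spec (hP : P.Spec p b₀ (encField γ) rep) {n N b : ℕ} (hn : n ≤ N) (hb : b₀ ≤ b)
    (hpb : p ≤ N) {L : List Val} {l : List ((ZMod p)[X] × R)}
    (hL : List.Forall₂ (prep p rep n b) L l) :
    (∃ L' l', (cut P).eval (.cons (encList L) (encField γ)) = encList L' ∧
      List.Forall₂ (prep p rep n b) L' l' ∧ L'.length ≤ L.length ∧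
      lspan (ZMod p) l' = (lspan (ZMod p) l).comap (shiftMap p R 1)) ∧
    (cut P).cost (.cons (encList L) (encField γ)) ≤ tcut P L.length N b := by
  obtain ⟨⟨lr, O, l', h1, h2, h3, h4, h5⟩, h6⟩ := for_inv (l := var 0) (a := .nil)
    (s := .ite (.comp .hd (.comp .hd (var 1)))
      (.ite (.comp .hd (var 0))
        (.pair (.comp .hd (var 0))
          (.pair (call₂ (elim P) (.comp .hd (var 0)) (var 1) (drop 3)) (.comp .tl (var 0))))
        (.pair (var 1) (.comp .tl (var 0))))
      (.pair (.comp .hd (var 0))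
        (.pair (.pair (.comp .tl (.comp .hd (var 1))) (.comp .tl (var 1))) (.comp .tl (var 0)))))
    (x := .cons (encList L) (encField γ)) (B := telim P N b + 80)
    -- The first component is the pivot, or `nil` if there is none yet; `prep` demands non-`nil`
    -- values to make this test meaningful. The output vectors have lost their first coordinate and
    -- enter the span through `shiftMap`.
    (fun Lr acc => ∃ lr O l', List.Forall₂ (prep p rep n b) Lr lr ∧
      List.Forall₂ (prep p rep n b) O l' ∧ acc.tl = encList O ∧
      O.length + Lr.length ≤ L.length ∧
      ((acc.hd = .nil ∧
          lspan (ZMod p) l = (lspan (ZMod p) l').map (shiftMap p R 1) ⊔ lspan (ZMod p) lr) ∨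
        ∃ x : (ZMod p)[X] × R, prep p rep n b acc.hd x ∧ x.1.coeff 0 ≠ 0 ∧
          lspan (ZMod p) l = (lspan (ZMod p) l').map (shiftMap p R 1) ⊔
            Submodule.span (ZMod p) {x} ⊔ lspan (ZMod p) lr)) (L := L) (by simp)
    ⟨l, [], [], hL, .nil, by simp, by simp, .inl ⟨by simp, by simp⟩⟩ (by
      rintro z Lr acc ⟨lr, O, l', h1, h2, h3, h4, h5⟩
      cases h1 with
      | @cons _ x _ lr hz h1 =>
      rw [List.length_cons] at h4
      have hz' := hz
      obtain ⟨hz1, hz2, hz3⟩ := hz'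
      have e1 : z.hd.hd = encNat (x.1.coeff 0).val := hz1.hd srep_zero
      by_cases h0 : x.1.coeff 0 = 0
      · have hc : eval (.comp .hd (.comp .hd (var 1)))
            (.cons acc (.cons z (.cons (encList L) (encField γ)))) = .nil := by simp [e1, h0]
        rw [eval_ite_nil _ _ hc, cost_ite_nil _ _ hc]
        have ex : shiftMap p R 1 (x.1.divX, x.2) = x := by
          have := X_mul_divX_add x.1
          rw [h0, C_0, add_zero] at this
          ext1
          · simpa using this
          · rfl
        refine ⟨⟨lr, .cons z.hd.tl z.tl :: O, (x.1.divX, x.2) :: l', h1, .cons ⟨?_, ?_, by simp⟩ h2,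
          by simp [h3], by simp only [List.length_cons]; omega, ?_⟩, ?_⟩
        · exact hz1.tl.mono (Nat.sub_le _ _) fun _ _ h => h
        · exact hz2
        · rcases h5 with ⟨h5, h6⟩ | ⟨y, h5, h6, h7⟩
          · refine .inl ⟨by simpa using h5, ?_⟩
            rw [h6, lspan_cons, lspan_cons, Submodule.map_sup, Submodule.map_span,
              Set.image_singleton, ex]
            ac_rfl
          · refine .inr ⟨y, by simpa using h5, h6, ?_⟩
            rw [h7, lspan_cons, lspan_cons, Submodule.map_sup, Submodule.map_span,
              Set.image_singleton, ex]
            ac_rfl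
        · simp
      · have hc : eval (.comp .hd (.comp .hd (var 1)))
            (.cons acc (.cons z (.cons (encList L) (encField γ)))) ≠ .nil := by
          simp [e1, h0, encNat_eq_nil]
        rw [eval_ite_ne _ _ hc, cost_ite_ne _ _ hc]
        rcases h5 with ⟨h5, h6⟩ | ⟨y, h5, h6, h7⟩
        · have hc' : eval (.comp .hd (var 0))
            (.cons acc (.cons z (.cons (encList L) (encField γ)))) = .nil := by simp [h5]
          rw [eval_ite_nil _ _ hc', cost_ite_nil _ _ hc']
          refine ⟨⟨lr, O, l', h1, h2, by simpa using h3, by omega,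
            .inr ⟨x, by simpa using hz, h0, ?_⟩⟩, ?_⟩
          · rw [h6, lspan_cons, sup_assoc]
          · simp
        · have hc' : eval (.comp .hd (var 0))
            (.cons acc (.cons z (.cons (encList L) (encField γ)))) ≠ .nil := by simpa using h5.2.2
          rw [eval_ite_ne _ _ hc', cost_ite_ne _ _ hc']
          obtain ⟨h8, h9⟩ := elim_spec γ hP hn hb hpb h5 hz
          refine ⟨⟨lr, _ :: O, _ :: l', h1, .cons h8 h2, by simp [h3],
            by simp only [List.length_cons]; omega, .inr ⟨y, by simpa using h5, h6, ?_⟩⟩, ?_⟩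
          · have ex : shiftMap p R 1 (y.1.coeff 0 • x.1.divX + (-x.1.coeff 0) • y.1.divX,
                y.1.coeff 0 • x.2 + (-x.1.coeff 0) • y.2) =
                y.1.coeff 0 • x + (-x.1.coeff 0) • y := by
              ext1
              · have e2 : X * x.1.divX = x.1 - C (x.1.coeff 0) :=
                  eq_sub_of_add_eq (X_mul_divX_add x.1)
                have e3 : X * y.1.divX = y.1 - C (y.1.coeff 0) :=
                  eq_sub_of_add_eq (X_mul_divX_add y.1)
                simp only [shiftMap_apply, pow_one, Prod.fst_add, Prod.smul_fst, smul_eq_C_mul,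
                  C_neg]
                linear_combination C (y.1.coeff 0) * e2 - C (x.1.coeff 0) * e3
              · rfl
            rw [h7, lspan_cons, lspan_cons, Submodule.map_sup, Submodule.map_span,
              Set.image_singleton, ex, sup_right_comm (Submodule.span _ _), span_pair_of_smul h6]
            ac_rfl
          · simp
            omega)
  cases h1
  simp only [lspan_nil, sup_bot_eq] at h5
  refine ⟨⟨O, l', by simpa [cut] using h3, h2, by simpa using h4, ?_⟩, ?_⟩
  · rcases h5 with ⟨-, h5⟩ | ⟨x, -, h6, h5⟩
    · rw [h5, Submodule.comap_map_eq_of_injective (shiftMap_injective 1)]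
    · rw [h5, comap_sup_span h6]
  · rw [cut, cost_comp, cost_tl, tcut]
    refine (Nat.add_le_add_right h6 1).trans ?_
    have : L.length * (telim P N b + 80 + 9) ≤ L.length * (telim P N b + 100) :=
      Nat.mul_le_mul_left _ (by omega)
    simp
    omega

/-- Cutting `k` times keeps the combinations whose first `k` coordinates vanish. The second
components then are the solutions of `k` linear equations, and coordinates beyond the `k`-th remain
visible. -/
lemma ker_spec (hP : P.Spec p b₀ (encField γ) rep) {n N b : ℕ} (hn : n ≤ N) (hb : b₀ ≤ b)
    (hpb : p ≤ N) {L : List Val} {l : List ((ZMod p)[X] × R)}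
    (hL : List.Forall₂ (prep p rep n b) L l) (k : ℕ) :
    (∃ L' l', (ker P).eval (.cons (encNat k) (.cons (encList L) (encField γ))) = encList L' ∧
      List.Forall₂ (prep p rep n b) L' l' ∧ L'.length ≤ L.length ∧
      lspan (ZMod p) l' = (lspan (ZMod p) l).comap (shiftMap p R k)) ∧
    (ker P).cost (.cons (encNat k) (.cons (encList L) (encField γ))) ≤
      k * (tcut P L.length N b + 50) + 50 := by
  obtain ⟨h1, h2⟩ := for_nat (l := var 0) (a := var 1) (s := call₁ (cut P) (var 0) (drop 4))
    (x := .cons (encNat k) (.cons (encList L) (encField γ))) (B := tcut P L.length N b + 30)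
    (fun i acc => ∃ L' l', acc = encList L' ∧
      List.Forall₂ (prep p rep n b) L' l' ∧ L'.length ≤ L.length ∧
      lspan (ZMod p) l' = (lspan (ZMod p) l).comap (shiftMap p R i)) (k := k) (by simp)
    ⟨L, l, by simp, hL, le_rfl, by ext; simp⟩ (by
      rintro i - _ ⟨L', l', rfl, h1, h2, h3⟩
      obtain ⟨⟨L'', l'', h4, h5, h6, h7⟩, h8⟩ := cut_spec γ hP hn hb hpb h1
      refine ⟨⟨L'', l'', by simpa using h4, h5, h6.trans h2, ?_⟩, ?_⟩
      · rw [h7, h3]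
        ext x
        simp [pow_succ, mul_assoc]
      · have : tcut P L'.length N b ≤ tcut P L.length N b := by rw [tcut, tcut]; gcongr
        simp
        omega)
  refine ⟨h1, h2.trans ?_⟩
  have : k * (tcut P L.length N b + 30 + 9) ≤ k * (tcut P L.length N b + 50) :=
    Nat.mul_le_mul_left _ (by omega)
  simp
  omega

end ker
end FactorFqt


namespace FactorFqt
open Fn

/-! ### Coordinate vectors -/

/-- The list of the coordinates of a list of `M` elements, given a program for the elements.  The
arguments are the list, the list to which the coordinates are added, and the number `M`. -/
def flat (f : Fn) : Fn :=
  .comp .tl (for_ (var 2) (.pair (var 0) (var 1))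
    (.pair (.comp .tl (.comp .hd (var 0)))
      (call₃ f (.comp .hd (.comp .hd (var 0))) (.comp .tl (var 0)) (var 4) (drop 5))))

/-- The program `f` computes, in front of the list `out`, the `N b` coordinates of elements of
size at most `b`, which are the coefficients of `Ψ b`. -/
structure FlatSpec (f : Fn) (t N : ℕ → ℕ) (p b₀ : ℕ) [Fact p.Prime] (E : Val) {R : Type*}
    [CommRing R] [Algebra (ZMod p) R] (rep : ℕ → Val → R → Prop)
    (Ψ : ℕ → R →ₗ[ZMod p] (ZMod p)[X]) : Prop where
  eval : ∀ {b v x out n o}, b₀ ≤ b → rep b v x → ListRep (srep p) n out o →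
    ListRep (srep p) (N b + n) (f.eval (.cons v (.cons out (.cons (encNat b) E))))
      (Ψ b x + X ^ N b * o) ∧ f.cost (.cons v (.cons out (.cons (encNat b) E))) ≤ t b
  degree : ∀ b x, (Ψ b x).degree < N b
  injective : ∀ {b v x}, b₀ ≤ b → rep b v x → Ψ b x = 0 → x = 0

section flat
variable {p m : ℕ} [Fact p.Prime]

/-- The coordinates of the first `k` coefficients of a polynomial. -/
noncomputable def flatMap {R : Type*} [CommRing R] [Algebra (ZMod p) R]
    (Ψ : R →ₗ[ZMod p] (ZMod p)[X]) (N : ℕ) : ℕ → R[X] →ₗ[ZMod p] (ZMod p)[X]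
  | 0 => 0
  | k + 1 => Ψ ∘ₗ (lcoeff R k).restrictScalars (ZMod p) +
      LinearMap.mulLeft (ZMod p) (X ^ N) ∘ₗ flatMap Ψ N k

lemma add_X_pow_mul_degree_lt {k : Type*} [Field k] {a c : k[X]} {N M : ℕ}
    (ha : a.degree < N) (hc : c.degree < M) : (a + X ^ N * c).degree < ((N + M : ℕ) : WithBot ℕ) := by
  rw [degree_lt_iff_coeff_zero] at *
  intro i hi
  rw [coeff_add, ha i (by omega), coeff_X_pow_mul', zero_add]
  split_ifs
  · exact hc _ (by omega)
  · rfl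

/-- The coefficients of `a` lie below position `N` and those of `X ^ N * c` do not, so nothing can
cancel. -/
lemma eq_zero_of_add_X_pow_mul {k : Type*} [Field k] {a c : k[X]} {N : ℕ}
    (ha : a.degree < N) (h : a + X ^ N * c = 0) : a = 0 ∧ c = 0 := by
  rw [degree_lt_iff_coeff_zero] at ha
  have ha0 : a = 0 := by
    ext i
    by_cases hi : N ≤ i
    · rw [ha i hi, coeff_zero]
    · have := congrArg (fun q => q.coeff i) h
      simpa [coeff_X_pow_mul', hi] using this
  refine ⟨ha0, ?_⟩
  simpa [ha0] using h

lemma flatMap_degree {R : Type*} [CommRing R] [Algebra (ZMod p) R]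
    {Ψ : R →ₗ[ZMod p] (ZMod p)[X]} {N : ℕ} (h : ∀ x, (Ψ x).degree < N) (k : ℕ) (y : R[X]) :
    (flatMap Ψ N k y).degree < ((k * N : ℕ) : WithBot ℕ) := by
  induction k with
  | zero => simp [flatMap]
  | succ k ih =>
    have := add_X_pow_mul_degree_lt (h (y.coeff k)) ih
    rw [Nat.succ_mul, add_comm (k * N)]
    simpa [flatMap] using this

/-- `flatMap` concatenates disjoint blocks of `N` coordinates, one for each of the first `k`
coefficients, so each block vanishes separately. -/
lemma flatMap_eq_zero {R : Type*} [CommRing R] [Algebra (ZMod p) R]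
    {Ψ : R →ₗ[ZMod p] (ZMod p)[X]} {N : ℕ} (h : ∀ x, (Ψ x).degree < N) (k : ℕ) {y : R[X]}
    (hy : flatMap Ψ N k y = 0) {i : ℕ} (hi : i < k) : Ψ (y.coeff i) = 0 := by
  induction k with
  | zero => omega
  | succ k ih =>
    have h1 : Ψ (y.coeff k) + X ^ N * flatMap Ψ N k y = 0 := by simpa [flatMap] using hy
    obtain ⟨h2, h3⟩ := eq_zero_of_add_X_pow_mul (h _) h1
    rcases Nat.lt_succ_iff_lt_or_eq.mp hi with hi | rfl
    · exact ih h3 hi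
    · exact h2

lemma coeff_iterate_divX {R : Type*} [CommRing R] (x : R[X]) (k i : ℕ) :
    (divX^[k] x).coeff i = x.coeff (i + k) := by
  induction k generalizing i with
  | zero => simp
  | succ k ih => rw [Function.iterate_succ_apply', coeff_divX, ih]; congr 1; omega

/-- The time of `flat`. -/
def tflat (t : ℕ → ℕ) (b : ℕ) : ℕ := b * (t b + 100) + 100

/-- The coefficients are processed from degree 0 upwards and each block is put in front of the
previous ones, which is the order in the recursion for `flatMap`. Injectivity is confined to
represented elements, since coefficients from degree `b` on are not read. -/
lemma FlatSpec.lift {f : Fn} {t N : ℕ → ℕ} {b₀ : ℕ} {E : Val} {R : Type*} [CommRing R]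
    [Algebra (ZMod p) R] {rep : ℕ → Val → R → Prop} {Ψ : ℕ → R →ₗ[ZMod p] (ZMod p)[X]}
    (h : FlatSpec f t N p b₀ E rep Ψ) (h0 : ∀ b, rep b .nil 0) :
    FlatSpec (flat f) (tflat t) (fun b => b * N b) p b₀ E (liftRep rep)
      (fun b => flatMap (Ψ b) (N b) b) where
  eval {b v x out n o} hb hv ho := by
    obtain ⟨⟨h1, h2⟩, h3⟩ := for_nat (l := var 2) (a := .pair (var 0) (var 1))
      (s := .pair (.comp .tl (.comp .hd (var 0)))
        (call₃ f (.comp .hd (.comp .hd (var 0))) (.comp .tl (var 0)) (var 4) (drop 5)))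
      (x := .cons v (.cons out (.cons (encNat b) E))) (B := t b + 80)
      (fun i acc => liftRep rep b acc.hd (divX^[i] x) ∧
        ListRep (srep p) (i * N b + n) acc.tl (flatMap (Ψ b) (N b) i x + X ^ (i * N b) * o))
      (k := b) (by simp) ⟨by simpa using hv, by simpa [flatMap] using ho⟩ (by
        rintro i - acc ⟨h1, h2⟩
        have hh : rep b acc.hd.hd (x.coeff i) := by
          have := h1.hd (h0 b)
          rwa [coeff_iterate_divX, zero_add] at this
        obtain ⟨h3, h4⟩ := h.eval hb hh h2
        refine ⟨⟨?_, ?_⟩, ?_⟩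
        · rw [Function.iterate_succ_apply']
          simpa [liftRep] using ListRep.mono h1.tl (Nat.sub_le _ _) fun _ _ h => h
        · convert h3 using 1
          · ring
          · simp
          · simp [flatMap]
            ring
        · simp
          omega)
    refine ⟨by simpa [flat] using h2, ?_⟩
    rw [flat, cost_comp, cost_tl, tflat]
    refine (Nat.add_le_add_right h3 1).trans ?_
    have : b * (t b + 80 + 9) ≤ b * (t b + 100) := Nat.mul_le_mul_left _ (by omega)
    simp
    omega
  degree b x := flatMap_degree (h.degree b) b x
  injective {b v x} hb hv hx := by
    obtain ⟨L, rfl, hL, hv⟩ := hv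
    ext i
    rw [coeff_zero]
    by_cases hi : i < b
    · exact h.injective hb (hv.getD (h0 b) i) (flatMap_eq_zero (h.degree b) b hx hi)
    · exact hv.coeff_eq_zero (by omega)

lemma flatSpec_scalar (b₀ : ℕ) (E : Val) :
    FlatSpec (.pair (var 0) (var 1)) (fun _ => 20) (fun _ => 1) p b₀ E (fun _ => srep p)
      (fun _ => (CAlgHom : ZMod p →ₐ[ZMod p] (ZMod p)[X]).toLinearMap) where
  eval {b v x out n o} hb hv ho := by
    refine ⟨?_, by simp⟩
    rw [add_comm 1 n]
    simpa using ListRep.cons hv ho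
  degree b x := by simpa using degree_C_lt
  injective {b v x} hb hv hx := by simpa using hx

variable {F : Type u} [Field F] [Algebra (ZMod p) F] (γ : Module.Basis (Fin m) (ZMod p) F)

/-- The polynomial whose coefficients are the coordinates of an element of the field. -/
noncomputable def coordPoly : F →ₗ[ZMod p] (ZMod p)[X] :=
  ∑ i : Fin m, monomial (i : ℕ) ∘ₗ γ.coord i

lemma coordPoly_coeff (x : F) (i : ℕ) :
    (coordPoly γ x).coeff i = if h : i < m then γ.repr x ⟨i, h⟩ else 0 := by
  simp only [coordPoly, LinearMap.sum_apply, LinearMap.comp_apply, finsetSum_coeff, coeff_monomial]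
  split_ifs with h
  · rw [Finset.sum_eq_single ⟨i, h⟩] <;> simp +contextual [Fin.ext_iff]
  · exact Finset.sum_eq_zero fun j _ => if_neg (by have := j.2; omega)

lemma coordPoly_ofCoord {y : (ZMod p)[X]} (h : ∀ i, m ≤ i → y.coeff i = 0) :
    coordPoly γ (ofCoord γ y) = y := by
  ext i
  rw [coordPoly_coeff]
  split_ifs with hi
  · rw [ofCoord_apply, map_sum, Finsupp.finsetSum_apply, Finset.sum_eq_single ⟨i, hi⟩]
    · simp
    · intro j _ hj
      simp [hj]
    · simp
  · rw [h i (by omega)]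

lemma ofCoord_coordPoly (x : F) : ofCoord γ (coordPoly γ x) = x := by
  rw [ofCoord_apply]
  conv_rhs => rw [← γ.sum_repr x]
  exact Finset.sum_congr rfl fun i _ => by rw [coordPoly_coeff, dif_pos i.2]

variable {γ} in
lemma frep.coord {b : ℕ} {v : Val} {x : F} (h : frep γ b v x) :
    ListRep (srep p) m v (coordPoly γ x) := by
  obtain ⟨y, hy, rfl⟩ := h
  rwa [coordPoly_ofCoord γ fun i hi => hy.coeff_eq_zero hi]

/-- The coordinates of the elements of `𝔽_q`. -/
def fflat : Fn := flat (.pair (var 0) (var 1))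

/-- An element of `𝔽_q` is already a list of at most `m` coordinates. Treating it as a polynomial
over `𝔽_p` pads this list to the fixed length `b`. -/
lemma fflat_spec : FlatSpec fflat (tflat fun _ => 20) (fun b => b * 1) p (p + m) (encField γ)
    (frep γ) (fun b => flatMap (CAlgHom : ZMod p →ₐ[ZMod p] (ZMod p)[X]).toLinearMap 1 b ∘ₗ
      coordPoly γ) where
  eval {b v x out n o} hb hv ho :=
    ((flatSpec_scalar (p + m) (encField γ)).lift (p := p) fun _ => srep_zero).eval hb
      (ListRep.mono hv.coord (by omega) fun _ _ h => h) ho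
  degree b x := ((flatSpec_scalar (p + m) (encField γ)).lift fun _ => srep_zero).degree b _
  injective {b v x} hb hv hx := by
    have := ((flatSpec_scalar (p + m) (encField γ)).lift (p := p) fun _ => srep_zero).injective hb
      (ListRep.mono hv.coord (by omega) fun _ _ h => h) hx
    rw [← ofCoord_coordPoly γ x, this, map_zero]

/-! ### Monomials -/

/-- The polynomials of degree `< M` whose coefficients are in `S`. -/
def polySub {R : Type*} [CommRing R] [Algebra (ZMod p) R] (S : Submodule (ZMod p) R) (M : ℕ) :
    Submodule (ZMod p) R[X] where
  carrier := {y | ∀ i, y.coeff i ∈ S ∧ (M ≤ i → y.coeff i = 0)}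
  add_mem' {x y} hx hy i := by
    refine ⟨by rw [coeff_add]; exact add_mem (hx i).1 (hy i).1, fun hi => ?_⟩
    rw [coeff_add, (hx i).2 hi, (hy i).2 hi, add_zero]
  zero_mem' i := ⟨by simp, by simp⟩
  smul_mem' c x hx i := by
    refine ⟨by rw [coeff_smul]; exact Submodule.smul_mem _ _ (hx i).1, fun hi => ?_⟩
    rw [coeff_smul, (hx i).2 hi, smul_zero]

lemma mem_polySub {R : Type*} [CommRing R] [Algebra (ZMod p) R] {S : Submodule (ZMod p) R} {M : ℕ}
    {y : R[X]} : y ∈ polySub S M ↔ ∀ i, y.coeff i ∈ S ∧ (M ≤ i → y.coeff i = 0) := Iff.rfl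

/-- The products of the elements of a list and the powers of the variable with exponent `< M`. -/
def monos : Fn :=
  for_ (var 0) .nil
    (for_ (var 3) (for_ (var 0) .nil (.pair (.pair .nil (var 1)) (var 0)))
      (.pair (.pair (var 1) .nil) (var 0)))

/-- The time of `monos`. -/
def tmonos (M k : ℕ) : ℕ := M * (M * k * 30 + k * 30 + 100) + 50

/-- Polynomials of degree `< i + 1` are `X` times those of degree `< i` plus a constant. Accordingly
each pass shifts the old generators and adds the constant ones. -/
lemma monos_spec {R : Type*} [CommRing R] [Algebra (ZMod p) R] {r : Val → R → Prop}
    (h0 : r .nil 0) {L : List Val} {l : List R} (hL : List.Forall₂ r L l) (M : ℕ) (ρ : Val) :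
    (∃ L' l', monos.eval (.cons (encNat M) (.cons (encList L) ρ)) = encList L' ∧
      List.Forall₂ (ListRep r M) L' l' ∧ L'.length = M * L.length ∧
      lspan (ZMod p) l' = polySub (lspan (ZMod p) l) M) ∧
    monos.cost (.cons (encNat M) (.cons (encList L) ρ)) ≤ tmonos M L.length := by
  have e0 : ∀ {L l}, List.Forall₂ r L l → L.length = l.length := fun h => h.length_eq
  obtain ⟨⟨L', l', h1, h2, h3, h4⟩, h5⟩ := for_nat (l := var 0) (a := .nil)
    (s := for_ (var 3) (for_ (var 0) .nil (.pair (.pair .nil (var 1)) (var 0)))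
      (.pair (.pair (var 1) .nil) (var 0)))
    (x := .cons (encNat M) (.cons (encList L) ρ)) (B := M * L.length * 30 + L.length * 30 + 60)
    (fun i acc => ∃ L' l', acc = encList L' ∧
      List.Forall₂ (ListRep r i) L' l' ∧ L'.length = i * L.length ∧
      lspan (ZMod p) l' = polySub (lspan (ZMod p) l) i) (k := M) (by simp)
    ⟨[], [], by simp, .nil, by simp, by
      ext y
      simp only [lspan_nil, Submodule.mem_bot, mem_polySub]
      exact ⟨fun h => by simp [h], fun h => by ext i; simpa using (h i).2 (Nat.zero_le i)⟩⟩ (by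
      rintro i hi _ ⟨L', l', rfl, h1, h2, h3⟩
      -- The shifting loop, stated for any environment because it sits inside the start value of the
      -- second loop.
      have hin := fun ρ' => for_inv (l := var 0) (a := .nil) (s := .pair (.pair .nil (var 1)) (var 0))
        (x := .cons (encList L') ρ') (B := 20)
        (fun Lr acc => ∃ lr A a, List.Forall₂ (ListRep r i) Lr lr ∧ acc = encList A ∧
          List.Forall₂ (ListRep r (i + 1)) A a ∧ A.length + Lr.length = L'.length ∧
          lspan (ZMod p) a ⊔ (lspan (ZMod p) lr).map (LinearMap.mulLeft (ZMod p) X) =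
            (lspan (ZMod p) l').map (LinearMap.mulLeft (ZMod p) X)) (L := L') (by simp)
        ⟨l', [], [], h1, by simp, .nil, by simp, by simp⟩ (by
          rintro z Lr _ ⟨lr, A, a, h4, rfl, h5, h6, h7⟩
          cases h4 with
          | @cons _ x _ lr hz h4 =>
          rw [List.length_cons] at h6
          refine ⟨⟨lr, .cons .nil z :: A, X * x :: a, h4, by simp, .cons (hz.shift h0) h5,
            by simp only [List.length_cons]; omega, ?_⟩, by simp⟩
          rw [← h7, lspan_cons, lspan_cons, Submodule.map_sup, Submodule.map_span,
            Set.image_singleton, LinearMap.mulLeft_apply]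
          ac_rfl)
      obtain ⟨⟨lr, A, a, h4, h5, h6, h7, h8⟩, h9⟩ :=
        hin (.cons .nil (.cons (encNat M) (.cons (encList L) ρ)))
      cases h4
      simp only [lspan_nil, Submodule.map_bot, sup_bot_eq] at h8
      rw [List.length_nil, add_zero] at h7
      obtain ⟨⟨lr, A', a', h10, h11, h12, h13, h14⟩, h15⟩ := for_inv (l := var 3)
        (a := for_ (var 0) .nil (.pair (.pair .nil (var 1)) (var 0)))
        (s := .pair (.pair (var 1) .nil) (var 0))
        (x := .cons (encList L') (.cons .nil (.cons (encNat M) (.cons (encList L) ρ)))) (B := 20)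
        (fun Lr acc => ∃ lr A' a', List.Forall₂ r Lr lr ∧ acc = encList A' ∧
          List.Forall₂ (ListRep r (i + 1)) A' a' ∧
          A'.length + Lr.length = L'.length + L.length ∧
          lspan (ZMod p) a' ⊔ (lspan (ZMod p) lr).map
            ((CAlgHom : R →ₐ[R] R[X]).toLinearMap.restrictScalars (ZMod p)) =
            (lspan (ZMod p) l').map (LinearMap.mulLeft (ZMod p) X) ⊔
            (lspan (ZMod p) l).map ((CAlgHom : R →ₐ[R] R[X]).toLinearMap.restrictScalars (ZMod p)))
        (L := L) (by simp)
        ⟨l, A, a, hL, h5, h6, by omega, by rw [h8]⟩ (by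
          rintro z Lr _ ⟨lr, A, a, h4, rfl, h5, h6, h7⟩
          cases h4 with
          | @cons _ x _ lr hz h4 =>
          rw [List.length_cons] at h6
          refine ⟨⟨lr, .cons z .nil :: A, C x :: a, h4, by simp,
            .cons (by simpa using (ListRep.nil i).cons hz) h5,
            by simp only [List.length_cons]; omega, ?_⟩, by simp⟩
          rw [← h7, lspan_cons, lspan_cons, Submodule.map_sup, Submodule.map_span,
            Set.image_singleton]
          simp only [LinearMap.coe_restrictScalars, AlgHom.toLinearMap_apply, CAlgHom_apply]
          ac_rfl)
      cases h10
      simp only [lspan_nil, Submodule.map_bot, sup_bot_eq] at h14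
      rw [List.length_nil, add_zero, h2] at h13
      refine ⟨⟨A', a', h11, h12, by rw [h13]; ring, ?_⟩, ?_⟩
      · rw [h14, h3]
        ext y
        rw [Submodule.mem_sup, mem_polySub]
        constructor
        · rintro ⟨_, ⟨y, hy, rfl⟩, _, ⟨x, hx, rfl⟩, rfl⟩ (_ | j)
          · simpa using hx
          · simpa [coeff_C] using hy j
        · intro hy
          refine ⟨_, ⟨y.divX, fun j => ?_, rfl⟩, _, ⟨y.coeff 0, (hy 0).1, rfl⟩, ?_⟩
          · rw [coeff_divX]
            exact ⟨(hy _).1, fun hj => (hy _).2 (by omega)⟩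
          · simp [X_mul_divX_add]
      · have : i * L.length ≤ M * L.length := Nat.mul_le_mul_right _ hi.le
        rw [h2] at h9
        refine h15.trans ((Nat.add_le_add_right (Nat.add_le_add_right
          (Nat.add_le_add_left h9 _) _) _).trans ?_)
        simp
        omega)
  refine ⟨⟨L', l', h1, h2, h3, h4⟩, h5.trans ?_⟩
  rw [tmonos]
  have : M * (M * L.length * 30 + L.length * 30 + 60 + 9) ≤
    M * (M * L.length * 30 + L.length * 30 + 100) := Nat.mul_le_mul_left _ (by omega)
  simp
  omega

end flat
end FactorFqt


namespace FactorFqt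
open Fn

/-! ### Normalization of the output -/

/-- The list of all coordinates of an element of `𝔽_q`. -/
def fnorm : Fn :=
  letIn (for_ (drop 2) (.pair (var 0) .nil)
      (.pair (.comp .tl (.comp .hd (var 0)))
        (.pair (.comp .hd (.comp .hd (var 0))) (.comp .tl (var 0)))))
    (call₂ revApp (.comp .tl (var 0)) .nil .nil)

/-- The list of the coefficients of a polynomial up to its degree. -/
def pnorm (nz norm : Fn) : Fn :=
  letIn (for_ (call₂ revApp (var 0) .nil .nil) .nil
      (.ite (var 0) (.pair (call₁ norm (var 1) (drop 3)) (var 0))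
        (.ite (call₁ nz (var 1) (drop 3)) (.pair (call₁ norm (var 1) (drop 3)) .nil) .nil)))
    (.ite (var 0) (var 0) (.pair (call₁ norm .nil (drop 2)) .nil))

/-- The program `norm` computes the encoding of represented elements. -/
def NormSpec (norm : Fn) (t : ℕ → ℕ) (b₀ : ℕ) (E : Val) {R : Type*}
    (rep : ℕ → Val → R → Prop) (enc : R → Val) : Prop :=
  ∀ b v x, b₀ ≤ b → rep b v x →
    norm.eval (.cons v E) = enc x ∧ norm.cost (.cons v E) ≤ t b

/-- The time of `fnorm`. -/
def tfnorm (b : ℕ) : ℕ := b * 100 + 100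

/-- The time of `pnorm`. -/
def tpnorm (P : ModFn) (t : ℕ → ℕ) (b : ℕ) : ℕ := b * (P.t b + t b + 120) + t b + 150

section norm
variable {p m : ℕ} [Fact p.Prime] {F : Type u} [Field F] [Algebra (ZMod p) F]
  (γ : Module.Basis (Fin m) (ZMod p) F)

/-- A represented element may lack trailing zero coordinates. The loop runs over the `m` rows of the
multiplication table to emit exactly `m` of them. -/
lemma fnorm_spec : NormSpec fnorm tfnorm (p + m) (encField γ) (frep γ) (encScalar γ) := by
  intro b v x hb hx
  have hx := hx.coord
  set T : List Val := List.ofFn fun i => encList (List.ofFn fun j => encScalar γ (γ i * γ j)) with hT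
  have hE : encField γ = .cons (encNat p) (encList T) := rfl
  obtain ⟨⟨i, O, h1, h2, h3, h4⟩, h5⟩ := for_inv (l := drop 2) (a := .pair (var 0) .nil)
    (s := .pair (.comp .tl (.comp .hd (var 0)))
        (.pair (.comp .hd (.comp .hd (var 0))) (.comp .tl (var 0))))
    (x := .cons v (encField γ)) (B := 40)
    (fun Lr acc => ∃ i O, i + Lr.length = m ∧ ListRep (srep p) m acc.hd (divX^[i] (coordPoly γ x)) ∧
      acc.tl = encList O ∧
      O.reverse = (List.range i).map fun j => encNat ((coordPoly γ x).coeff j).val) (L := T)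
    (by simp [hE])
    ⟨0, [], by simp [hT], by simpa using hx, by simp, by simp⟩ (by
      rintro z Lr acc ⟨i, O, h1, h2, h3, h4⟩
      rw [List.length_cons] at h1
      have e : acc.hd.hd = encNat ((coordPoly γ x).coeff i).val := by
        have := h2.hd srep_zero
        rwa [coeff_iterate_divX, zero_add] at this
      refine ⟨⟨i + 1, acc.hd.hd :: O, by omega, ?_, by simp [h3], ?_⟩, by simp⟩
      · rw [Function.iterate_succ_apply']
        simpa using ListRep.mono h2.tl (Nat.sub_le _ _) fun _ _ h => h
      · rw [List.reverse_cons, h4, e, List.range_succ, List.map_append]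
        rfl)
  have hi : i = m := by simpa using h1
  subst hi
  have hO : O.length = i := by
    have := congrArg List.length h4
    simpa using this
  constructor
  · have : fnorm.eval (.cons v (encField γ)) = encList O.reverse := by
      simp only [fnorm, eval_letIn, eval_call₂, Fn.eval_comp, eval_tl, eval_var_zero_cons, h3,
        eval_nil, rev_eval]
    rw [this, h4, encScalar]
    congr 1
    apply List.ext_getElem
    · simp
    · intro j h₁ h₂
      have hj : j < i := by simpa using h₁
      simp [coordPoly_coeff, hj]
  · have h6 := revApp_cost O .nil .nil
    have h7 : T.length = i := by simp [hT]
    rw [h7] at h5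
    rw [tfnorm]
    simp only [fnorm, cost_letIn, cost_call₂, cost_comp, cost_tl, cost_var, cost_nil, cost_drop,
      cost_pair, Fn.eval_comp, eval_tl, eval_var_zero_cons, h3, eval_nil] at h5 ⊢
    omega

/-- Reading from the top, zeros are dropped until a nonzero coefficient has been seen; from then on
everything is kept. -/
lemma NormSpec.lift {norm : Fn} {t : ℕ → ℕ} {b₀ : ℕ} {E : Val} {R : Type u} [CommRing R]
    [Algebra (ZMod p) R] {rep : ℕ → Val → R → Prop} {enc : R → Val} {P : ModFn}
    (h : NormSpec norm t b₀ E rep enc) (hP : P.Spec p b₀ E rep) :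
    NormSpec (pnorm P.nz norm) (tpnorm P t) b₀ E (liftRep rep) (encPoly enc) := by
  classical
  rintro b v x hb ⟨L, rfl, hL, hx⟩
  -- The number of entries left after stripping zeros. For `x = 0` it is `0`, whereas `encPoly` has
  -- one entry there; the program appends it separately.
  obtain ⟨D, hD⟩ : ∃ D, D = if x = 0 then 0 else x.natDegree + 1 := ⟨_, rfl⟩
  have hD0 : ∀ i, D ≤ i → x.coeff i = 0 := by
    intro i hi
    rw [hD] at hi
    split_ifs at hi with h
    · simp [h]
    · exact coeff_eq_zero_of_natDegree_lt (by omega)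
  have hD1 : ∀ k, D ≤ k + 1 → x.coeff k ≠ 0 → D = k + 1 := by
    intro k h1 h2
    by_contra h3
    exact h2 (hD0 k (by omega))
  have hD2 : ∀ k, D = k + 1 → x.coeff k ≠ 0 := by
    intro k hk h0
    rw [hD] at hk
    split_ifs at hk with h
    rw [← Nat.succ_injective hk] at h0
    exact h (leadingCoeff_eq_zero.mp h0)
  obtain ⟨⟨M, h1, h2⟩, h3⟩ := for_inv (l := call₂ revApp (var 0) .nil .nil) (a := .nil)
    (s := .ite (var 0) (.pair (call₁ norm (var 1) (drop 3)) (var 0))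
        (.ite (call₁ P.nz (var 1) (drop 3)) (.pair (call₁ norm (var 1) (drop 3)) .nil) .nil))
    (x := .cons (encList L) E) (B := P.t b + t b + 80)
    (fun Lr acc => ∃ M, L = Lr.reverse ++ M ∧
      acc = encList ((List.range' Lr.length (D - Lr.length)).map fun i => enc (x.coeff i)))
    (L := L.reverse) (by simp [rev_eval])
    ⟨[], by simp, by
      have : D ≤ L.reverse.length := by
        by_contra hlt
        refine hD2 (D - 1) (by omega) (hx.coeff_eq_zero ?_)
        simp at hlt
        omega
      simp only [eval_nil]
      rw [Nat.sub_eq_zero_of_le this]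
      simp⟩ (by
      rintro z Lr _ ⟨M, h1, rfl⟩
      have hz : rep b z (x.coeff Lr.length) := by
        rw [h1] at hx
        simp only [List.reverse_cons, List.append_assoc, List.cons_append, List.nil_append] at hx
        simpa using hx.getD (hP.zero b) Lr.length
      obtain ⟨h2, h3⟩ := h _ _ _ hb hz
      obtain ⟨h4, h5⟩ := hP.nz hb hz
      rw [List.length_cons]
      by_cases hk : D ≤ Lr.length + 1
      · have hc : eval (var 0) (.cons (encList ((List.range' (Lr.length + 1)
            (D - (Lr.length + 1))).map fun i => enc (x.coeff i)))
            (.cons z (.cons (encList L) E))) = .nil := by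
          rw [Nat.sub_eq_zero_of_le hk]
          simp
        rw [eval_ite_nil _ _ hc, cost_ite_nil _ _ hc]
        by_cases h0 : x.coeff Lr.length = 0
        · have hc' : eval (call₁ P.nz (var 1) (drop 3)) (.cons (encList ((List.range' (Lr.length + 1)
              (D - (Lr.length + 1))).map fun i => enc (x.coeff i)))
              (.cons z (.cons (encList L) E))) = .nil := by
            simpa using not_imp_comm.mp h4.1 (by simpa using h0)
          rw [eval_ite_nil _ _ hc', cost_ite_nil _ _ hc']
          refine ⟨⟨z :: M, by simpa using h1, ?_⟩, ?_⟩
          · rw [show D - Lr.length = 0 by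
              by_contra hne
              exact hD2 Lr.length (by omega) h0]
            simp
          · simp
            omega
        · have hc' : eval (call₁ P.nz (var 1) (drop 3)) (.cons (encList ((List.range' (Lr.length + 1)
              (D - (Lr.length + 1))).map fun i => enc (x.coeff i)))
              (.cons z (.cons (encList L) E))) ≠ .nil := by
            simpa using h4.2 h0
          rw [eval_ite_ne _ _ hc', cost_ite_ne _ _ hc']
          refine ⟨⟨z :: M, by simpa using h1, ?_⟩, ?_⟩
          · rw [show D - Lr.length = 1 by have := hD1 _ hk h0; omega]
            simp [h2]
          · simp
            omega
      · have hc : eval (var 0) (.cons (encList ((List.range' (Lr.length + 1)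
            (D - (Lr.length + 1))).map fun i => enc (x.coeff i)))
            (.cons z (.cons (encList L) E))) ≠ .nil := by
          rw [show D - (Lr.length + 1) = (D - (Lr.length + 1) - 1) + 1 by omega]
          simp [List.range'_succ]
        rw [eval_ite_ne _ _ hc, cost_ite_ne _ _ hc]
        refine ⟨⟨z :: M, by simpa using h1, ?_⟩, ?_⟩
        · rw [show D - Lr.length = (D - (Lr.length + 1)) + 1 by omega, List.range'_succ]
          simp [h2]
        · simp
          omega)
  have h4 : ∀ k, List.range' 0 k = List.range k := fun k => List.range_eq_range'.symm
  simp only [List.length_nil, Nat.sub_zero, h4] at h2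
  have h5 := revApp_cost L .nil .nil
  have h6 : L.length * (P.t b + t b + 80 + 9) + L.length * 20 ≤ b * (P.t b + t b + 120) := by
    rw [← mul_add]
    exact Nat.mul_le_mul hL (by omega)
  rw [pnorm, eval_letIn, cost_letIn, tpnorm, h2]
  simp only [cost_call₂, cost_var, cost_nil, eval_var_zero_cons, eval_nil, List.length_reverse]
    at h3
  by_cases h0 : x = 0
  · have hc : ∀ ρ, eval (var 0) (.cons (encList ((List.range D).map fun i => enc (x.coeff i)))
        ρ) = .nil := by
      intro ρ
      rw [hD, if_pos h0]
      simp
    obtain ⟨h7, h8⟩ := h _ _ _ hb (hP.zero b)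
    rw [eval_ite_nil _ _ (hc _), cost_ite_nil _ _ (hc _)]
    refine ⟨?_, ?_⟩
    · simp [encPoly, h0, h7]
    · simp [-cost_for]
      omega
  · have hc : ∀ ρ, eval (var 0) (.cons (encList ((List.range D).map fun i => enc (x.coeff i)))
        ρ) ≠ .nil := by
      intro ρ
      rw [hD, if_neg h0, List.range_succ_eq_map]
      simp
    rw [eval_ite_ne _ _ (hc _), cost_ite_ne _ _ (hc _)]
    refine ⟨?_, ?_⟩
    · rw [hD, if_neg h0]
      simp [encPoly]
    · simp [-cost_for]
      omega

end norm

/-! ### Arithmetic in `𝔽_q[t][X]` -/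

/-- The operations in `𝔽_q[t][X]`. -/
def bivFn : ModFn := fieldFn.lift.lift

/-- Multiplication in `𝔽_q[t][X]`. -/
def bmul : Fn := pmul fieldFn.lift.add (pmul fieldFn.add fmul)

/-- The time of `bmul`. -/
def tbmul : ℕ → ℕ := tpmul fieldFn.lift.t (tpmul fieldFn.t tfmul)

/-- The derivative in `𝔽_q[t][X]`. -/
def bderiv : Fn := pderiv fieldFn.lift.add

/-- The time of `bderiv`. -/
def tbderiv (b : ℕ) : ℕ := b * (b * (fieldFn.lift.t b + 100) + 300) + 100

/-- The coordinates of the elements of `𝔽_q[t][X]`. -/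
def bflat : Fn := flat (flat fflat)

/-- The time of `bflat`. -/
def tbflat : ℕ → ℕ := tflat (tflat (tflat fun _ => 20))

/-- Normalization in `𝔽_q[t][X]`. -/
def bnorm : Fn := pnorm fieldFn.lift.nz (pnorm fieldFn.nz fnorm)

/-- The time of `bnorm`. -/
def tbnorm : ℕ → ℕ := tpnorm fieldFn.lift (tpnorm fieldFn tfnorm)

/-- The product of the `k`-th power of the first argument and the second argument. -/
def powmul : Fn := for_ (var 2) (var 1) (call₂ bmul (var 2) (var 0) (drop 5))

/-- The `k`-th derivative. -/
def iterD : Fn := for_ (var 1) (var 0) (call₁ bderiv (var 0) (drop 4))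

/-- The operator whose kernel is spanned by the logarithmic derivatives of the factors of `f`,
multiplied by `f`. -/
def nied : Fn :=
  call₂ bivFn.add
    (call₂ iterD (call₃ powmul (var 1) (var 0) (.comp .tl (var 2)) (drop 2))
      (.comp .tl (var 2)) (drop 2))
    (call₃ powmul (var 0) (var 0) (.comp .tl (var 2)) (drop 2)) (drop 2)

/-- The time of `nied`. -/
def tnied (c b : ℕ) : ℕ :=
  bivFn.t c + b * (tbderiv c + 50) + 2 * (b * (tbmul c + 50)) + 400

section biv
variable {p m : ℕ} [hp : Fact p.Prime] {F : Type u} [Field F] [Algebra (ZMod p) F]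
  (γ : Module.Basis (Fin m) (ZMod p) F)

/-- The representation of the elements of `𝔽_q[t][X]`. -/
def brep : ℕ → Val → F[X][X] → Prop := liftRep (liftRep (frep γ))

lemma bivFn_spec : bivFn.Spec p (p + m) (encField γ) (brep γ) := (fieldFn_spec γ).lift.lift

lemma bmul_spec : MulSpec bmul tbmul (p + m) (encField γ) (brep γ) :=
  MulSpec.lift (MulSpec.lift (fmul_spec γ) (fieldFn_spec γ)) (fieldFn_spec γ).lift

/-- The number of coordinates of the elements of size at most `b`. -/
def bnum (b : ℕ) : ℕ := b * (b * (b * 1))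

/-- The coordinates of the elements of size at most `b`. -/
noncomputable def bcoord (b : ℕ) : F[X][X] →ₗ[ZMod p] (ZMod p)[X] :=
  flatMap (flatMap (flatMap (CAlgHom : ZMod p →ₐ[ZMod p] (ZMod p)[X]).toLinearMap 1 b ∘ₗ
      coordPoly γ) (b * 1) b) (b * (b * 1)) b

lemma bflat_spec : FlatSpec bflat tbflat bnum p (p + m) (encField γ) (brep γ) (bcoord γ) :=
  ((fflat_spec γ).lift (fieldFn_spec γ).zero).lift (fieldFn_spec γ).lift.zero

lemma bnorm_spec : NormSpec bnorm tbnorm (p + m) (encField γ) (brep γ) (encBiv γ) :=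
  ((fnorm_spec γ).lift (fieldFn_spec γ)).lift (fieldFn_spec γ).lift

lemma bderiv_spec {b : ℕ} (hb : p + m ≤ b) {v : Val} {x : F[X][X]} (hv : brep γ b v x) :
    brep γ b (bderiv.eval (.cons v (encField γ))) (derivative x) ∧
      bderiv.cost (.cons v (encField γ)) ≤ tbderiv b :=
  pderiv_spec ((fieldFn_spec γ).lift.zero b)
    (fun _ _ _ _ hu hv => (fieldFn_spec γ).lift.add hb hu hv) hv

lemma powmul_spec {b : ℕ} (hb : p + m ≤ b) {u v : Val} {x y : F[X][X]} (hu : brep γ b u x)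
    (hv : brep γ b v y) (k : ℕ) :
    brep γ ((k + 1) * b) (powmul.eval (.cons u (.cons v (.cons (encNat k) (encField γ)))))
      (x ^ k * y) ∧
    powmul.cost (.cons u (.cons v (.cons (encNat k) (encField γ)))) ≤
      k * (tbmul ((k + 1) * b) + 45) + 30 := by
  obtain ⟨h1, h2⟩ := for_nat (l := var 2) (a := var 1) (s := call₂ bmul (var 2) (var 0) (drop 5))
    (x := .cons u (.cons v (.cons (encNat k) (encField γ)))) (B := tbmul ((k + 1) * b) + 36)
    (fun i acc => brep γ ((i + 1) * b) acc (x ^ i * y)) (k := k) (by simp) (by simpa using hv) (by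
      intro i hi acc hacc
      have hib : b ≤ (i + 1) * b := Nat.le_mul_of_pos_left b (by omega)
      have hkb : (i + 1) * b ≤ k * b := Nat.mul_le_mul_right _ hi
      have h1 := (bmul_spec γ hb (by omega) hu hacc).1
      have h2 := (bmul_spec γ hb (by omega) hu ((bivFn_spec γ).mono hkb hacc)).2
      rw [show b + k * b = (k + 1) * b by ring] at h2
      refine ⟨?_, ?_⟩
      · convert h1 using 1
        · ring
        · simp
        · ring
      · simp
        omega)
  refine ⟨h1, h2.trans ?_⟩
  have : k * (tbmul ((k + 1) * b) + 36 + 9) = k * (tbmul ((k + 1) * b) + 45) := by ring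
  simp
  omega

lemma iterD_spec {b : ℕ} (hb : p + m ≤ b) {v : Val} {x : F[X][X]} (hv : brep γ b v x) (k : ℕ) :
    brep γ b (iterD.eval (.cons v (.cons (encNat k) (encField γ)))) (derivative^[k] x) ∧
    iterD.cost (.cons v (.cons (encNat k) (encField γ))) ≤ k * (tbderiv b + 45) + 30 := by
  obtain ⟨h1, h2⟩ := for_nat (l := var 1) (a := var 0) (s := call₁ bderiv (var 0) (drop 4))
    (x := .cons v (.cons (encNat k) (encField γ))) (B := tbderiv b + 36)
    (fun i acc => brep γ b acc (derivative^[i] x)) (k := k) (by simp) (by simpa using hv) (by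
      intro i hi acc hacc
      obtain ⟨h1, h2⟩ := bderiv_spec γ hb hacc
      refine ⟨?_, ?_⟩
      · rw [Function.iterate_succ_apply']
        simpa using h1
      · simp
        omega)
  refine ⟨h1, h2.trans ?_⟩
  have : k * (tbderiv b + 36 + 9) = k * (tbderiv b + 45) := by ring
  simp
  omega

/-- The operator `h ↦ D ^ (p - 1) (f ^ (p - 1) h) + h ^ p`. -/
noncomputable def niedL (f : F[X][X]) : F[X][X] →ₗ[ZMod p] F[X][X] :=
  haveI : CharP F[X][X] p := (Algebra.charP_iff (ZMod p) F[X][X] p).mp inferInstance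
  (((derivative (R := F[X])).restrictScalars (ZMod p)) ^ (p - 1)) ∘ₗ
    LinearMap.mulLeft (ZMod p) (f ^ (p - 1)) +
  { (frobenius F[X][X] p : F[X][X] →+ F[X][X]) with
    map_smul' := fun c x => by
      simp [frobenius_def, Algebra.smul_def, mul_pow, ← map_pow, ZMod.pow_card] }

lemma niedL_apply (f h : F[X][X]) :
    niedL (p := p) f h = derivative^[p - 1] (f ^ (p - 1) * h) + h ^ p := by
  have : ∀ k (x : F[X][X]), (((derivative (R := F[X])).restrictScalars (ZMod p)) ^ k) x =
      derivative^[k] x := by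
    intro k x
    rw [Module.End.pow_apply]
    rfl
  simp [niedL, this, frobenius_def]

/-- Sizes add under multiplication, so `f ^ (p - 1) h` and `h ^ p` have size `p * b`; derivatives do
not increase it. -/
lemma nied_spec {b : ℕ} (hb : p + m ≤ b) {u v : Val} {f h : F[X][X]} (hf : brep γ b v f)
    (hh : brep γ b u h) :
    brep γ (p * b) (nied.eval (.cons u (.cons v (encField γ)))) (niedL (p := p) f h) ∧
      nied.cost (.cons u (.cons v (encField γ))) ≤ tnied (p * b) b := by
  have hp1 := hp.out.one_lt
  have e : (p - 1 + 1) * b = p * b := by congr 1; omega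
  have hpb : b ≤ p * b := Nat.le_mul_of_pos_left b (by omega)
  obtain ⟨h1, h2⟩ := powmul_spec γ hb hf hh (p - 1)
  obtain ⟨h3, h4⟩ := powmul_spec γ hb hh hh (p - 1)
  rw [e] at h1 h2 h3 h4
  obtain ⟨h5, h6⟩ := iterD_spec γ (by omega) h1 (p - 1)
  obtain ⟨h7, h8⟩ := (bivFn_spec γ).add (by omega) h5 h3
  have hE : (var 0).eval (encField γ) = encNat p := rfl
  have h9 : (p - 1) * (tbmul (p * b) + 45) ≤ b * (tbmul (p * b) + 50) :=
    Nat.mul_le_mul (by omega) (by omega)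
  have h10 : (p - 1) * (tbderiv (p * b) + 45) ≤ b * (tbderiv (p * b) + 50) :=
    Nat.mul_le_mul (by omega) (by omega)
  constructor
  · rw [niedL_apply]
    convert h7 using 1
    · simp [nied, hE, tl_encNat]
    · rw [← pow_succ, Nat.sub_add_cancel hp1.le]
  · rw [tnied]
    simp [nied, hE, tl_encNat]
    omega

end biv
end FactorFqt


namespace FactorFqt

/-! ### The irreducible factors of `f` -/

section factors
variable {F : Type u} [Field F]

lemma algebraMap_ratFunc_injective : Function.Injective (algebraMap F[X] (RatFunc F)) :=
  IsFractionRing.injective F[X] (RatFunc F)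

lemma toK_mul (x y : F[X][X]) : toK (x * y) = toK x * toK y := Polynomial.map_mul _

lemma natDegree_toK (x : F[X][X]) : (toK x).natDegree = x.natDegree :=
  natDegree_map_eq_of_injective algebraMap_ratFunc_injective _

lemma toK_ne_zero {x : F[X][X]} (hx : x ≠ 0) : toK x ≠ 0 :=
  (Polynomial.map_ne_zero_iff algebraMap_ratFunc_injective).mpr hx

/-- `f = c ∏ g_i` with irreducible `g_i` of positive degree not dividing the derivative of `f`. -/
structure IsFactorData (f : F[X][X]) {s : ℕ} (c : F[X]) (g : Fin s → F[X][X]) : Prop where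
  ne_zero : c ≠ 0
  eq : f = C c * ∏ i, g i
  irreducible : ∀ i, Irreducible (g i)
  pos : ∀ i, 0 < (g i).natDegree
  not_dvd : ∀ i, ¬ g i ∣ derivative f

/-- Unique factorization in `𝔽_q[t][X]`, where the unit and the primes lying in `𝔽_q[t]` are
collected in `c`. -/
lemma exists_factors (f : F[X][X]) : f ≠ 0 → ∃ (s : ℕ) (c : F[X]) (g : Fin s → F[X][X]), c ≠ 0 ∧
    f = C c * ∏ i, g i ∧ (∀ i, Irreducible (g i)) ∧ ∀ i, 0 < (g i).natDegree := by
  induction f using UniqueFactorizationMonoid.induction_on_prime with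
  | h₁ => exact fun h => absurd rfl h
  | h₂ x hx =>
    intro h
    have hd := natDegree_eq_zero_of_isUnit hx
    refine ⟨0, x.coeff 0, Fin.elim0, ?_, ?_, fun i => i.elim0, fun i => i.elim0⟩
    · intro h0
      rw [eq_C_of_natDegree_eq_zero hd, h0, C_0] at h
      exact h rfl
    · simpa using eq_C_of_natDegree_eq_zero hd
  | h₃ a q ha hq ih =>
    intro h
    obtain ⟨s, c, g, hc, h1, h2, h3⟩ := ih ha
    rcases Nat.eq_zero_or_pos q.natDegree with h0 | h0
    · have e := eq_C_of_natDegree_eq_zero h0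
      refine ⟨s, q.coeff 0 * c, g, mul_ne_zero (fun h' => ?_) hc, ?_, h2, h3⟩
      · rw [e, h', C_0] at hq
        exact hq.ne_zero rfl
      · rw [h1, C_mul, ← e, mul_assoc]
    · refine ⟨s + 1, c, Fin.cons q g, hc, ?_, ?_, ?_⟩
      · rw [Fin.prod_cons, h1]
        ring
      · exact fun i => Fin.cases hq.irreducible h2 i
      · exact fun i => Fin.cases h0 h3 i

/-- If `g_i` divided `f'`, it would be a common factor of `f` and `f'` over `K`, hence a unit,
although its degree is positive. -/
lemma exists_isFactorData {f : F[X][X]} (hf : (toK f).Separable) :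
    ∃ (s : ℕ) (c : F[X]) (g : Fin s → F[X][X]), IsFactorData f c g := by
  have h0 : f ≠ 0 := by
    rintro rfl
    exact hf.ne_zero (by simp [toK])
  obtain ⟨s, c, g, hc, h1, h2, h3⟩ := exists_factors f h0
  refine ⟨s, c, g, hc, h1, h2, h3, fun i hi => ?_⟩
  have hu : IsUnit (toK (g i)) := by
    refine hf.isUnit_of_dvd' ?_ ?_
    · rw [h1, toK_mul]
      exact Dvd.dvd.mul_left (Polynomial.map_dvd _ (Finset.dvd_prod_of_mem _ (Finset.mem_univ i))) _
    · unfold toK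
      rw [derivative_map]
      exact Polynomial.map_dvd _ hi
  have := natDegree_eq_zero_of_isUnit hu
  rw [natDegree_toK] at this
  have := h3 i
  omega

/-- The cofactor of `g_i`. -/
noncomputable def cofactor {s : ℕ} (c : F[X]) (g : Fin s → F[X][X]) (i : Fin s) : F[X][X] :=
  C c * ∏ j ∈ Finset.univ.erase i, g j

/-- The logarithmic derivative of `g_i`, multiplied by `f`. -/
noncomputable def logDer {s : ℕ} (c : F[X]) (g : Fin s → F[X][X]) (i : Fin s) : F[X][X] :=
  cofactor c g i * derivative (g i)

namespace IsFactorData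
variable {f : F[X][X]} {s : ℕ} {c : F[X]} {g : Fin s → F[X][X]} (H : IsFactorData f c g)
include H

lemma f_ne_zero : f ≠ 0 := by
  rw [H.eq]
  exact mul_ne_zero (C_ne_zero.mpr H.ne_zero)
    (Finset.prod_ne_zero_iff.mpr fun i _ => (H.irreducible i).ne_zero)

lemma prime (i : Fin s) : Prime (g i) := (H.irreducible i).prime

lemma cofactor_mul (i : Fin s) : cofactor c g i * g i = f := by
  rw [cofactor, mul_assoc, Finset.prod_erase_mul _ _ (Finset.mem_univ i), H.eq]

lemma dvd (i : Fin s) : g i ∣ f := ⟨cofactor c g i, by rw [mul_comm, H.cofactor_mul]⟩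

omit H in
lemma dvd_cofactor {i j : Fin s} (h : j ≠ i) : g j ∣ cofactor c g i :=
  Dvd.dvd.mul_left (Finset.dvd_prod_of_mem _ (Finset.mem_erase.mpr ⟨h, Finset.mem_univ j⟩)) _

omit H in
lemma dvd_logDer {i j : Fin s} (h : j ≠ i) : g j ∣ logDer c g i :=
  Dvd.dvd.mul_right (dvd_cofactor h) _

lemma derivative_eq : derivative f = ∑ i, logDer c g i := by
  classical
  rw [H.eq, derivative_C_mul, derivative_prod_finset, Finset.mul_sum]
  simp only [logDer, cofactor, mul_assoc]

lemma dvd_derivative_sub (i : Fin s) : g i ∣ derivative f - logDer c g i := by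
  rw [H.derivative_eq, ← Finset.add_sum_erase _ _ (Finset.mem_univ i), add_sub_cancel_left]
  exact Finset.dvd_sum fun j hj => dvd_logDer (Finset.ne_of_mem_erase hj).symm

/-- Modulo `g_i` the element `logDer c g i` agrees with `f'`, because all other summands of `f'`
contain the factor `g_i`. -/
lemma not_dvd_logDer (i : Fin s) : ¬ g i ∣ logDer c g i := fun h =>
  H.not_dvd i (by simpa using dvd_add (H.dvd_derivative_sub i) h)

lemma not_dvd_cofactor (i : Fin s) : ¬ g i ∣ cofactor c g i := fun h =>
  H.not_dvd_logDer i (Dvd.dvd.mul_right h _)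

lemma isRelPrime {i j : Fin s} (h : i ≠ j) : IsRelPrime (g i) (g j) :=
  (H.irreducible i).isRelPrime_iff_not_dvd.mpr fun hd =>
    H.not_dvd_cofactor i (hd.trans (dvd_cofactor h.symm))

lemma prod_dvd {x : F[X][X]} (h : ∀ i, g i ∣ x) : ∏ i, g i ∣ x :=
  Fintype.prod_dvd_of_isRelPrime (fun _ _ hij => H.isRelPrime hij) h

lemma natDegree_prod : (∏ i, g i).natDegree = f.natDegree := by
  rw [H.eq, natDegree_C_mul H.ne_zero]

/-- The uniqueness half of the Chinese remainder theorem: the `g_i` are pairwise coprime and their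
degrees add up to that of `f`. -/
lemma eq_zero_of_dvd {x : F[X][X]} (h : ∀ i, g i ∣ x) (hx : x.degree < f.natDegree) : x = 0 := by
  refine eq_zero_of_dvd_of_degree_lt (H.prod_dvd h) ?_
  rw [degree_eq_natDegree (Finset.prod_ne_zero_iff.mpr fun i _ => (H.irreducible i).ne_zero),
    H.natDegree_prod]
  exact hx

lemma degree_logDer (i : Fin s) : (logDer c g i).degree < f.natDegree := by
  have h0 := H.f_ne_zero
  rw [← H.cofactor_mul i] at h0
  rw [← degree_eq_natDegree H.f_ne_zero]
  conv_rhs => rw [← H.cofactor_mul i]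
  rw [logDer, degree_mul, degree_mul, degree_eq_natDegree (left_ne_zero_of_mul h0)]
  exact WithBot.add_lt_add_left WithBot.coe_ne_bot (degree_derivative_lt (H.irreducible i).ne_zero)

/-- An element divisible by all `g_j`, `j ≠ i`, times one divisible by `g_i`. -/
lemma dvd_cofactor_mul {i : Fin s} {x : F[X][X]} (h : g i ∣ x) (y : F[X][X]) :
    f ∣ cofactor c g i * y * x := by
  obtain ⟨z, rfl⟩ := h
  exact ⟨y * z, by rw [← H.cofactor_mul i]; ring⟩

/-- This turns divisibility by the unknown `g_i` into divisibility by the known `f`: the cofactor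
inside `logDer c g i` supplies the rest of `f`, and `logDer c g i` itself is prime to `g_i`. -/
lemma dvd_logDer_mul {i : Fin s} {x : F[X][X]} : f ∣ logDer c g i * x ↔ g i ∣ x := by
  constructor
  · intro h
    exact ((H.prime i).dvd_or_dvd ((H.dvd i).trans h)).resolve_left (H.not_dvd_logDer i)
  · exact fun h => H.dvd_cofactor_mul h _

lemma natDegree_pos (i : Fin s) : 0 < f.natDegree :=
  (H.pos i).trans_le (natDegree_le_of_dvd (H.dvd i) H.f_ne_zero)

end IsFactorData
end factors

/-! ### The kernel of Niederreiter's operator -/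

section kernel
variable {p : ℕ} [hp : Fact p.Prime] {F : Type u} [Field F] [Algebra (ZMod p) F]

/-- Induction on `k` from `D(f ^ (k+1) h) = f ^ k ((k+1) f' h + f h')`: each derivative lowers the
power of `f` by one, and the other term keeps a factor `f`. -/
lemma exists_iterate_derivative_pow_mul {R : Type*} [CommRing R] (f : R[X]) (k : ℕ) (h : R[X]) :
    ∃ q, derivative^[k] (f ^ k * h) = (k.factorial : R[X]) * derivative f ^ k * h + f * q := by
  induction k generalizing h with
  | zero => exact ⟨0, by simp⟩
  | succ k ih =>
    obtain ⟨q, hq⟩ := ih ((k + 1 : R[X]) * derivative f * h + f * derivative h)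
    have e : derivative (f ^ (k + 1) * h) =
        f ^ k * ((k + 1 : R[X]) * derivative f * h + f * derivative h) := by
      rw [derivative_mul, derivative_pow]
      push_cast
      simp only [C_add, C_1, map_natCast]
      ring
    refine ⟨q + (k.factorial : R[X]) * derivative f ^ k * derivative h, ?_⟩
    rw [Function.iterate_succ_apply, e, hq, Nat.factorial_succ]
    push_cast
    ring

lemma charP_biv : CharP F[X][X] p := (Algebra.charP_iff (ZMod p) F[X][X] p).mp inferInstance

lemma factorial_biv : ((p - 1).factorial : F[X][X]) = -1 := by
  have := congrArg (algebraMap (ZMod p) F[X][X]) (ZMod.wilsons_lemma p)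
  rwa [map_natCast, map_neg, map_one] at this

/-- Modulo `f` the operator is `h ↦ h ^ p - f' ^ (p - 1) h`; the sign is Wilson's theorem `(p - 1)!
= -1`. -/
lemma dvd_niedL_sub (f h : F[X][X]) :
    f ∣ niedL (p := p) f h - (h ^ p - derivative f ^ (p - 1) * h) := by
  obtain ⟨q, hq⟩ := exists_iterate_derivative_pow_mul f (p - 1) h
  refine ⟨q, ?_⟩
  rw [niedL_apply, hq, factorial_biv (p := p)]
  ring

/-- The solutions of `h ^ p = a ^ (p - 1) h` in a domain of characteristic `p`. -/
lemma exists_eq_smul_of_pow_eq {B : Type*} [CommRing B] [IsDomain B] [Algebra (ZMod p) B] {a h : B}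
    (ha : a ≠ 0) (e : h ^ p = a ^ (p - 1) * h) : ∃ l : ZMod p, h = l • a := by
  let L := FractionRing B
  let ψ := algebraMap B L
  have : CharP B p := (Algebra.charP_iff (ZMod p) B p).mp inferInstance
  have hψ : Function.Injective ψ := IsFractionRing.injective B L
  have : CharP L p := charP_of_injective_ringHom hψ p
  have ha' : ψ a ≠ 0 := by simpa using (map_ne_zero_iff ψ hψ).mpr ha
  -- The quotient `h / a` in the fraction field is fixed by Frobenius and hence lies in the prime
  -- field.
  have h1 : (ψ h / ψ a) ^ p = ψ h / ψ a := by
    rw [div_pow, ← map_pow, e, div_eq_div_iff (pow_ne_zero _ ha') ha', ← map_pow,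
      ← pow_sub_one_mul hp.out.ne_zero a]
    simp only [map_mul]
    ring
  rw [← Subfield.mem_bot_iff_pow_eq_self, ← ZMod.fieldRange_castHom_eq_bot p] at h1
  obtain ⟨l, hl⟩ := h1
  refine ⟨l, hψ ?_⟩
  rw [Algebra.smul_def, map_mul, eq_comm, ← eq_div_iff ha', ← hl]
  exact DFunLike.congr_fun (Subsingleton.elim (ψ.comp (algebraMap (ZMod p) B)) (ZMod.castHom dvd_rfl L)) l

namespace IsFactorData
variable {f : F[X][X]} {s : ℕ} {c : F[X]} {g : Fin s → F[X][X]} (H : IsFactorData f c g)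
include H

/-- In the domain of polynomials modulo `g_i` the equation becomes `h ^ p = f' ^ (p - 1) h` with `f'
≠ 0`, so `h` is an `𝔽_p`-multiple of `f'`, and `f'` agrees with `logDer c g i` there. -/
lemma exists_dvd_sub_smul {h : F[X][X]} (hh : niedL (p := p) f h = 0) (i : Fin s) :
    ∃ l : ZMod p, g i ∣ h - l • logDer c g i := by
  have : (Ideal.span {g i}).IsPrime :=
    (Ideal.span_singleton_prime (H.prime i).ne_zero).mpr (H.prime i)
  have hq : ∀ x, Ideal.Quotient.mk (Ideal.span {g i}) x = 0 ↔ g i ∣ x := fun x => by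
    rw [Ideal.Quotient.eq_zero_iff_mem, Ideal.mem_span_singleton]
  obtain ⟨l, hl⟩ := exists_eq_smul_of_pow_eq (p := p) (B := F[X][X] ⧸ Ideal.span {g i})
    (a := Ideal.Quotient.mk _ (derivative f)) (h := Ideal.Quotient.mk _ h)
    (by rw [Ne, hq]; exact H.not_dvd i) (by
      rw [← sub_eq_zero, ← map_pow, ← map_pow, ← map_mul, ← map_sub, hq]
      have := (H.dvd i).trans (dvd_niedL_sub (p := p) f h)
      rw [hh, zero_sub] at this
      exact dvd_neg.mp this)
  refine ⟨l, ?_⟩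
  have h1 : g i ∣ h - l • derivative f := by
    rw [← hq, map_sub, hl, sub_eq_zero]
    rfl
  have h2 : g i ∣ l • (derivative f - logDer c g i) := dvd_smul_of_dvd l (H.dvd_derivative_sub i)
  have := dvd_add h1 h2
  rwa [smul_sub, sub_add_sub_cancel] at this

/-- The residues of `h` modulo all `g_i` are those of a combination of the `logDer c g i`, and both
sides have degree less than `n`. -/
lemma exists_eq_sum {h : F[X][X]} (hd : h.degree < f.natDegree) (hh : niedL (p := p) f h = 0) :
    ∃ l : Fin s → ZMod p, h = ∑ i, l i • logDer c g i := by
  choose l hl using H.exists_dvd_sub_smul hh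
  refine ⟨l, sub_eq_zero.mp (H.eq_zero_of_dvd (fun i => ?_) ?_)⟩
  · rw [← Finset.add_sum_erase _ _ (Finset.mem_univ i), ← sub_sub]
    exact dvd_sub (hl i) (Finset.dvd_sum fun j hj =>
      dvd_smul_of_dvd _ (dvd_logDer (Finset.ne_of_mem_erase hj).symm))
  · refine (degree_sub_le _ _).trans_lt (max_lt hd ((degree_sum_le _ _).trans_lt ?_))
    rw [Finset.sup_lt_iff (WithBot.bot_lt_coe _)]
    exact fun i _ => (degree_smul_le _ _).trans_lt (H.degree_logDer i)

omit H in
-- Both terms have degree at most `p (n - 1)`; for the first one, `(p - 1) n + (n - 1) - (p - 1) = p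
-- (n - 1)`.
lemma natDegree_niedL_le {h : F[X][X]} (hn : 0 < f.natDegree) (hd : h.degree < f.natDegree) :
    (niedL (p := p) f h).natDegree ≤ p * (f.natDegree - 1) := by
  have h1 : h.natDegree ≤ f.natDegree - 1 := by
    rcases eq_or_ne h 0 with rfl | h0
    · simp
    · have := (natDegree_lt_iff_degree_lt h0).mpr hd
      omega
  have hp1 := hp.out.one_lt
  rw [niedL_apply]
  refine (natDegree_add_le _ _).trans (max_le ?_ ?_)
  · refine (natDegree_iterate_derivative _ _).trans ?_
    have h2 : (f ^ (p - 1) * h).natDegree ≤ (p - 1) * f.natDegree + (f.natDegree - 1) :=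
      natDegree_mul_le_of_le (natDegree_pow_le_of_le _ le_rfl) h1
    obtain ⟨q, rfl⟩ : ∃ q, p = q + 1 := ⟨p - 1, by omega⟩
    obtain ⟨n, hn'⟩ : ∃ n, f.natDegree = n + 1 := ⟨f.natDegree - 1, by omega⟩
    rw [hn'] at h2 ⊢
    simp only [Nat.add_sub_cancel] at h2 ⊢
    rw [Nat.sub_le_iff_le_add]
    exact h2.trans (by ring_nf; omega)
  · exact natDegree_pow_le_of_le _ h1

omit H in
-- The `p`-th iterated derivative carries the factor `p! = 0`, and the derivative of `h ^ p` is
-- zero.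
lemma derivative_niedL (h : F[X][X]) : derivative (niedL (p := p) f h) = 0 := by
  have := charP_biv (p := p) (F := F)
  rw [niedL_apply, derivative_add, ← Function.iterate_succ_apply' derivative,
    Nat.succ_eq_add_one, Nat.sub_add_cancel hp.out.one_lt.le, derivative_pow]
  have h1 : (p.factorial : F[X][X]) = 0 :=
    (CharP.cast_eq_zero_iff F[X][X] p _).mpr (Nat.dvd_factorial hp.out.pos le_rfl)
  rw [iterate_derivative_eq_factorial_smul_sum, nsmul_eq_mul, h1]
  simp

lemma separable_prod (hf : (toK f).Separable) : (toK (∏ i, g i)).Separable :=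
  hf.of_dvd (by rw [H.eq, toK_mul]; exact Dvd.intro_left _ rfl)

/-- A polynomial with zero derivative is a polynomial in `X ^ p`, hence a `p`-th power `G ^ p` over
the algebraic closure. There `∏ g_i` stays squarefree, so it divides `G`; but `G` has degree at most
`n - 1`. -/
lemma niedL_eq_zero (hf : (toK f).Separable) (hn : 0 < f.natDegree) {h : F[X][X]}
    (hd : h.degree < f.natDegree) (hg : ∀ i, g i ∣ niedL (p := p) f h) :
    niedL (p := p) f h = 0 := by
  let L := AlgebraicClosure (RatFunc F)
  let φ : F[X] →+* L := (algebraMap (RatFunc F) L).comp (algebraMap F[X] (RatFunc F))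
  have hφ : Function.Injective φ :=
    (algebraMap (RatFunc F) L).injective.comp algebraMap_ratFunc_injective
  have : CharP F[X] p := (Algebra.charP_iff (ZMod p) F[X] p).mp inferInstance
  have : CharP L p := charP_of_injective_ringHom hφ p
  have : ExpChar L p := .prime hp.out
  set E := niedL (p := p) f h with hE
  obtain ⟨E', hE'⟩ : ∃ E', E' = contract p (E.map φ) := ⟨_, rfl⟩
  have h1 : expand L p E' = E.map φ := by
    rw [hE', expand_contract p _ hp.out.ne_zero]
    rw [derivative_map, derivative_niedL, Polynomial.map_zero]
  obtain ⟨G, hG⟩ : ∃ G : L[X], G ^ p = E.map φ :=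
    ⟨_, by rw [← h1]; exact (polynomial_expand_eq (R := L) (p := p) E').symm⟩
  have hsq : Squarefree ((∏ i, g i).map φ) := by
    have := ((H.separable_prod hf).map (f := algebraMap (RatFunc F) L)).squarefree
    rwa [toK, Polynomial.map_map] at this
  have h2 : (∏ i, g i).map φ ∣ G := by
    rw [← hsq.dvd_pow_iff_dvd hp.out.ne_zero, hG]
    exact Polynomial.map_dvd _ (H.prod_dvd hg)
  have h3 : p * G.natDegree ≤ p * (f.natDegree - 1) := by
    rw [← natDegree_pow, hG, natDegree_map_eq_of_injective hφ]
    exact natDegree_niedL_le hn hd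
  have h4 : G = 0 := by
    refine eq_zero_of_dvd_of_natDegree_lt h2 ?_
    rw [natDegree_map_eq_of_injective hφ, H.natDegree_prod]
    have := Nat.le_of_mul_le_mul_left h3 hp.out.pos
    omega
  rw [h4, zero_pow hp.out.ne_zero, eq_comm, Polynomial.map_eq_zero_iff hφ] at hG
  exact hG

/-- All `g_j` divide the value: for `j ≠ i` they divide both terms modulo `f`, and for `j = i` the
congruence of `f'` and `logDer c g i` makes `h ^ p - f' ^ (p - 1) h` vanish. -/
lemma niedL_logDer (hf : (toK f).Separable) (i : Fin s) : niedL (p := p) f (logDer c g i) = 0 := by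
  refine H.niedL_eq_zero hf (H.natDegree_pos i) (H.degree_logDer i) fun j => ?_
  have h1 := (H.dvd j).trans (dvd_niedL_sub (p := p) f (logDer c g i))
  have h2 : g j ∣ logDer c g i ^ p - derivative f ^ (p - 1) * logDer c g i := by
    by_cases hj : j = i
    · subst hj
      have h3 := sub_dvd_pow_sub_pow (derivative f) (logDer c g j) (p - 1)
      have h4 := ((H.dvd_derivative_sub j).trans h3).mul_right (logDer c g j)
      rw [sub_mul, ← pow_succ, Nat.sub_add_cancel hp.out.one_lt.le] at h4
      rwa [← dvd_neg, neg_sub]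
    · exact dvd_sub ((dvd_logDer hj).trans (dvd_pow_self _ hp.out.ne_zero))
        ((dvd_logDer hj).mul_left _)
  simpa using dvd_add h1 h2

end IsFactorData
end kernel
end FactorFqt


namespace FactorFqt

/-! ### The degree in `t` -/

section degree
variable {F : Type u} [Field F]

lemma coeff_swap (x : F[X][X]) (i j : ℕ) :
    ((Bivariate.swap x).coeff i).coeff j = (x.coeff j).coeff i := by
  induction x using Polynomial.induction_on' with
  | add x y hx hy => rw [map_add, coeff_add, coeff_add, coeff_add, coeff_add, hx, hy]
  | monomial k a =>
    induction a using Polynomial.induction_on' with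
    | add a b ha hb =>
      rw [map_add, map_add, coeff_add, coeff_add, coeff_add, coeff_add, ha, hb]
    | monomial l r =>
      rw [Bivariate.swap_monomial_monomial]
      simp only [coeff_monomial]
      by_cases h1 : l = i <;> by_cases h2 : k = j <;> simp [h1, h2, coeff_monomial]

/-- The degree in `t`, as the degree of the polynomial with the variables interchanged. -/
noncomputable def tdeg (x : F[X][X]) : ℕ := (Bivariate.swap x).natDegree

lemma tdeg_le_iff {x : F[X][X]} {d : ℕ} : tdeg x ≤ d ↔ ∀ i, (x.coeff i).natDegree ≤ d := by
  simp only [tdeg, natDegree_le_iff_coeff_eq_zero]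
  constructor
  · intro h i N hN
    rw [← coeff_swap, h N hN, coeff_zero]
  · intro h N hN
    ext i
    rw [coeff_swap, h i N hN, coeff_zero]

lemma tdeg_eq_degT (x : F[X][X]) : tdeg x = degT x := by
  apply le_antisymm
  · rw [tdeg_le_iff]
    intro i
    by_cases hi : i ∈ x.support
    · exact Finset.le_sup (f := fun i => (x.coeff i).natDegree) hi
    · simp [notMem_support_iff.mp hi]
  · exact Finset.sup_le fun i _ => tdeg_le_iff.mp le_rfl i

lemma tdeg_mul {x y : F[X][X]} (hx : x ≠ 0) (hy : y ≠ 0) : tdeg (x * y) = tdeg x + tdeg y := by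
  rw [tdeg, map_mul, natDegree_mul (by simpa) (by simpa)]
  rfl

lemma tdeg_mul_le (x y : F[X][X]) : tdeg (x * y) ≤ tdeg x + tdeg y := by
  rw [tdeg, map_mul]
  exact natDegree_mul_le

lemma tdeg_add_le {x y : F[X][X]} {d : ℕ} (hx : tdeg x ≤ d) (hy : tdeg y ≤ d) :
    tdeg (x + y) ≤ d := by
  rw [tdeg, map_add]
  exact (natDegree_add_le _ _).trans (max_le hx hy)

lemma tdeg_sum_le {ι : Type*} (t : Finset ι) (x : ι → F[X][X]) {d : ℕ}
    (h : ∀ i ∈ t, tdeg (x i) ≤ d) : tdeg (∑ i ∈ t, x i) ≤ d := by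
  classical
  induction t using Finset.induction_on with
  | empty => simp [tdeg]
  | insert i t hi ih =>
    rw [Finset.sum_insert hi]
    exact tdeg_add_le (h i (by simp)) (ih fun j hj => h j (by simp [hj]))

lemma tdeg_derivative_le (x : F[X][X]) : tdeg (derivative x) ≤ tdeg x := by
  rw [tdeg_le_iff]
  intro i
  rw [coeff_derivative, ← Nat.cast_succ, ← C_eq_natCast]
  refine natDegree_mul_le.trans ?_
  rw [natDegree_C, add_zero]
  exact tdeg_le_iff.mp le_rfl _

lemma tdeg_C (a : F[X]) : tdeg (C a) = a.natDegree := by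
  rw [tdeg, Bivariate.swap_C, natDegree_map]

lemma tdeg_prod {ι : Type*} (t : Finset ι) (x : ι → F[X][X]) (h : ∀ i ∈ t, x i ≠ 0) :
    tdeg (∏ i ∈ t, x i) = ∑ i ∈ t, tdeg (x i) := by
  rw [tdeg, map_prod, natDegree_prod]
  · rfl
  · simpa using h

end degree

section box
variable {p : ℕ} [hp : Fact p.Prime] {F : Type u} [Field F] [Algebra (ZMod p) F]

lemma tdeg_smul_le (l : ZMod p) (x : F[X][X]) : tdeg (l • x) ≤ tdeg x := by
  rw [tdeg_le_iff]
  intro i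
  rw [coeff_smul]
  exact (natDegree_smul_le _ _).trans (tdeg_le_iff.mp le_rfl i)

variable (p F) in
/-- The polynomials of degree `< n` in `X` and degree `< D` in `t`. -/
noncomputable def box (n D : ℕ) : Submodule (ZMod p) F[X][X] := polySub (polySub ⊤ D) n

lemma mem_box {n D : ℕ} {x : F[X][X]} :
    x ∈ box p F n D ↔ x.degree < n ∧ ∀ i, (x.coeff i).degree < D := by
  simp only [box, mem_polySub, Submodule.mem_top, true_and, degree_lt_iff_coeff_zero]
  constructor
  · exact fun h => ⟨fun i hi => (h i).2 hi, fun i j hj => (h i).1 j hj⟩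
  · exact fun h i => ⟨fun j hj => h.2 i j hj, fun hi => h.1 i hi⟩

lemma mem_box_of_tdeg {n D : ℕ} {x : F[X][X]} (hx : x.degree < n) (ht : tdeg x < D) :
    x ∈ box p F n D :=
  mem_box.mpr ⟨hx, fun i => lt_of_le_of_lt degree_le_natDegree
    (by exact_mod_cast (tdeg_le_iff.mp le_rfl i).trans_lt ht)⟩

/-- The degrees in `X` and in `t` are both additive, so the cofactor is confined to a box.
Divisibility by `f` thus becomes a finite linear system over `𝔽_p`. -/
lemma exists_box_of_dvd {f y : F[X][X]} {M : ℕ} (hf : f ≠ 0) (h : f ∣ y)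
    (h1 : y.natDegree < f.natDegree + M) (h2 : tdeg y < tdeg f + M) :
    ∃ z ∈ box p F M M, y + f * z = 0 := by
  obtain ⟨z, rfl⟩ := h
  refine ⟨-z, neg_mem ?_, by ring⟩
  rcases eq_or_ne z 0 with rfl | hz
  · exact zero_mem _
  · rw [natDegree_mul hf hz] at h1
    rw [tdeg_mul hf hz] at h2
    refine mem_box_of_tdeg ?_ (by omega)
    rw [← natDegree_lt_iff_degree_lt hz]
    omega

end box

/-! ### Splitting the space of logarithmic derivatives -/

section split
variable {p : ℕ} [hp : Fact p.Prime] {F : Type u} [Field F] [Algebra (ZMod p) F]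
  {s : ℕ} (c : F[X]) (g : Fin s → F[X][X])

variable (p) in
/-- The combinations of the logarithmic derivatives. -/
noncomputable def comb : (Fin s → ZMod p) →ₗ[ZMod p] F[X][X] :=
  Fintype.linearCombination (ZMod p) (logDer c g)

lemma comb_apply (χ : Fin s → ZMod p) : comb p c g χ = ∑ i, χ i • logDer c g i := rfl

variable (p) in
/-- The span of the logarithmic derivatives with index in `S`. -/
noncomputable def blockSub (S : Finset (Fin s)) : Submodule (ZMod p) F[X][X] :=
  (Submodule.pi (Finset.univ \ S : Finset (Fin s)) fun _ => ⊥).map (comb p c g)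

variable {c g}

lemma mem_blockSub {S : Finset (Fin s)} {x : F[X][X]} :
    x ∈ blockSub p c g S ↔ ∃ χ : Fin s → ZMod p, (∀ i ∉ S, χ i = 0) ∧ comb p c g χ = x := by
  simp [blockSub, Submodule.mem_map, Submodule.mem_pi]

namespace IsFactorData
variable {f : F[X][X]} (H : IsFactorData f c g)
include H

omit H in
lemma dvd_comb_sub (χ : Fin s → ZMod p) (i : Fin s) :
    g i ∣ comb p c g χ - χ i • logDer c g i := by
  rw [comb_apply, ← Finset.add_sum_erase _ _ (Finset.mem_univ i), add_sub_cancel_left]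
  exact Finset.dvd_sum fun j hj =>
    dvd_smul_of_dvd _ (dvd_logDer (Finset.ne_of_mem_erase hj).symm)

/-- Modulo `g_i` only the `i`-th summand survives, and `g_i` does not divide `logDer c g i`; so the
coefficients can be tested separately. -/
lemma dvd_comb_iff (χ : Fin s → ZMod p) (i : Fin s) : g i ∣ comb p c g χ ↔ χ i = 0 := by
  have h := dvd_comb_sub (c := c) (g := g) χ i
  constructor
  · intro h1
    by_contra h0
    have h2 := dvd_sub h1 h
    rw [sub_sub_cancel] at h2
    have h3 := dvd_smul_of_dvd (χ i)⁻¹ h2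
    rw [smul_smul, inv_mul_cancel₀ h0, one_smul] at h3
    exact H.not_dvd_logDer i h3
  · intro h0
    rwa [h0, zero_smul, sub_zero] at h

lemma comb_injective : Function.Injective (comb p c g) := by
  rw [← LinearMap.ker_eq_bot, LinearMap.ker_eq_bot']
  intro χ h
  ext i
  rw [Pi.zero_apply, ← H.dvd_comb_iff χ i, h]
  exact dvd_zero _

lemma comb_one : comb p c g (fun _ => 1) = derivative f := by
  simp [comb_apply, H.derivative_eq]

lemma degree_comb (χ : Fin s → ZMod p) : (comb p c g χ).degree < f.natDegree := by
  rw [comb_apply]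
  refine (degree_sum_le _ _).trans_lt ?_
  rw [Finset.sup_lt_iff (WithBot.bot_lt_coe _)]
  exact fun i _ => (degree_smul_le _ _).trans_lt (H.degree_logDer i)

lemma natDegree_comb (χ : Fin s → ZMod p) : (comb p c g χ).natDegree ≤ f.natDegree := by
  have := H.degree_comb χ
  exact natDegree_le_of_degree_le this.le

lemma tdeg_logDer (i : Fin s) : tdeg (logDer c g i) ≤ tdeg f := by
  have h0 := H.f_ne_zero
  have h := H.cofactor_mul i
  rw [← h] at h0
  rw [← h, tdeg_mul (left_ne_zero_of_mul h0) (right_ne_zero_of_mul h0)]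
  exact (tdeg_mul_le _ _).trans (Nat.add_le_add_left (tdeg_derivative_le _) _)

lemma tdeg_comb (χ : Fin s → ZMod p) : tdeg (comb p c g χ) ≤ tdeg f := by
  rw [comb_apply]
  exact tdeg_sum_le _ _ fun i _ => (tdeg_smul_le _ _).trans (H.tdeg_logDer i)

lemma comb_mem_box (χ : Fin s → ZMod p) {M : ℕ} (hM : tdeg f < M) :
    comb p c g χ ∈ box p F f.natDegree M :=
  mem_box_of_tdeg (H.degree_comb χ) ((H.tdeg_comb χ).trans_lt hM)

/-- The kernel of Niederreiter's operator. -/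
lemma mem_ker_iff (hf : (toK f).Separable) {M : ℕ} (hM : tdeg f < M) (x : F[X][X]) :
    (x ∈ box p F f.natDegree M ∧ niedL (p := p) f x = 0) ↔
      x ∈ blockSub p c g Finset.univ := by
  rw [mem_blockSub]
  constructor
  · rintro ⟨h1, h2⟩
    obtain ⟨l, hl⟩ := H.exists_eq_sum (mem_box.mp h1).1 h2
    exact ⟨l, by simp, hl.symm⟩
  · rintro ⟨χ, -, rfl⟩
    refine ⟨H.comb_mem_box χ hM, ?_⟩
    simp [comb_apply, H.niedL_logDer hf]

lemma dvd_logDer_mul_logDer {i j : Fin s} (h : i ≠ j) : f ∣ logDer c g i * logDer c g j :=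
  H.dvd_logDer_mul.mpr (dvd_logDer h)

/-- The `logDer c g i` behave like orthogonal elements modulo `f`: mixed products are divisible by
`f`, while the square of `logDer c g i` is not divisible by `g_i`. -/
lemma dvd_comb_mul_iff (ν χ : Fin s → ZMod p) :
    f ∣ comb p c g ν * comb p c g χ ↔ ∀ i, ν i = 0 ∨ χ i = 0 := by
  constructor
  · intro h i
    rw [← H.dvd_comb_iff, ← H.dvd_comb_iff]
    exact (H.prime i).dvd_or_dvd ((H.dvd i).trans h)
  · intro h
    simp only [comb_apply, Finset.sum_mul_sum]
    refine Finset.dvd_sum fun i _ => Finset.dvd_sum fun j _ => ?_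
    rw [smul_mul_smul_comm]
    by_cases hij : i = j
    · subst hij
      rcases h i with h | h <;> simp [h]
    · exact dvd_smul_of_dvd _ (H.dvd_logDer_mul_logDer hij)

/-- Solving one linear system restricts a block to the zero set of `ν`. The bounds on `M` ensure
that the box contains every cofactor that occurs. -/
lemma mem_split_iff {M : ℕ} (hM : tdeg f < M) (hn : f.natDegree < M) (ν : Fin s → ZMod p)
    (S : Finset (Fin s)) (x : F[X][X]) :
    (x ∈ blockSub p c g S ∧ ∃ z ∈ box p F M M, comb p c g ν * x + f * z = 0) ↔
      x ∈ blockSub p c g {i ∈ S | ν i = 0} := by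
  simp only [mem_blockSub]
  constructor
  · rintro ⟨⟨χ, h1, rfl⟩, z, -, hz⟩
    refine ⟨χ, fun i hi => ?_, rfl⟩
    by_cases hS : i ∈ S
    · have h2 : f ∣ comb p c g ν * comb p c g χ :=
        ⟨-z, by rw [eq_neg_of_add_eq_zero_left hz]; ring⟩
      refine ((H.dvd_comb_mul_iff ν χ).mp h2 i).resolve_left fun h => hi ?_
      simp [hS, h]
    · exact h1 i hS
  · rintro ⟨χ, h1, rfl⟩
    refine ⟨⟨χ, fun i hi => h1 i (by simp [hi]), rfl⟩, ?_⟩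
    refine exists_box_of_dvd H.f_ne_zero ((H.dvd_comb_mul_iff ν χ).mpr fun i => ?_) ?_ ?_
    · by_cases hi : i ∈ S ∧ ν i = 0
      · exact .inl hi.2
      · exact .inr (h1 i (by simpa using hi))
    · have h2 := natDegree_mul_le_of_le (H.natDegree_comb ν) (H.natDegree_comb χ)
      omega
    · have h2 := tdeg_mul_le (comb p c g ν) (comb p c g χ)
      have h3 := H.tdeg_comb ν
      have h4 := H.tdeg_comb χ
      omega

end IsFactorData

/-! ### The factors -/

variable (c g) in
/-- The multiple of `g_i` with the same leading coefficient as `f`. -/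
noncomputable def outFactor (i : Fin s) : F[X][X] :=
  C (c * ∏ j ∈ Finset.univ.erase i, (g j).leadingCoeff) * g i

namespace IsFactorData
variable {f : F[X][X]} (H : IsFactorData f c g)
include H

lemma leadingCoeff_eq : f.leadingCoeff = c * ∏ j, (g j).leadingCoeff := by
  rw [H.eq, leadingCoeff_mul, leadingCoeff_C, leadingCoeff_prod]

lemma scale_ne_zero (i : Fin s) : c * ∏ j ∈ Finset.univ.erase i, (g j).leadingCoeff ≠ 0 :=
  mul_ne_zero H.ne_zero (Finset.prod_ne_zero_iff.mpr fun j _ =>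
    leadingCoeff_ne_zero.mpr (H.irreducible j).ne_zero)

lemma scale_mul (i : Fin s) :
    c * (∏ j ∈ Finset.univ.erase i, (g j).leadingCoeff) * (g i).leadingCoeff = f.leadingCoeff := by
  rw [H.leadingCoeff_eq, mul_assoc,
    Finset.prod_erase_mul _ (fun j => (g j).leadingCoeff) (Finset.mem_univ i)]

lemma leadingCoeff_outFactor (i : Fin s) : (outFactor c g i).leadingCoeff = f.leadingCoeff := by
  rw [outFactor, leadingCoeff_mul, leadingCoeff_C, H.scale_mul]

lemma natDegree_outFactor (i : Fin s) : (outFactor c g i).natDegree = (g i).natDegree := by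
  rw [outFactor, natDegree_C_mul (H.scale_ne_zero i)]

lemma outFactor_ne_zero (i : Fin s) : outFactor c g i ≠ 0 :=
  mul_ne_zero (C_ne_zero.mpr (H.scale_ne_zero i)) (H.irreducible i).ne_zero

/-- The scaling factor replaces each `g_j`, `j ≠ i`, by its leading coefficient, which has no larger
degree in `t`. -/
lemma tdeg_outFactor (i : Fin s) : tdeg (outFactor c g i) ≤ tdeg f := by
  have h0 : ∀ j, g j ≠ 0 := fun j => (H.irreducible j).ne_zero
  have h1 : ∀ j, (g j).leadingCoeff ≠ 0 := fun j => leadingCoeff_ne_zero.mpr (h0 j)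
  have h2 : (∏ j ∈ Finset.univ.erase i, (g j).leadingCoeff).natDegree ≤
      ∑ j ∈ Finset.univ.erase i, tdeg (g j) := by
    refine (natDegree_prod_le _ _).trans (Finset.sum_le_sum fun j _ => ?_)
    exact tdeg_le_iff.mp le_rfl _
  rw [outFactor, tdeg_mul (C_ne_zero.mpr (H.scale_ne_zero i)) (h0 i), tdeg_C, H.eq,
    tdeg_mul (C_ne_zero.mpr H.ne_zero) (Finset.prod_ne_zero_iff.mpr fun j _ => h0 j), tdeg_C,
    tdeg_prod _ _ (fun j _ => h0 j), ← Finset.sum_erase_add _ _ (Finset.mem_univ i)]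
  have h3 := natDegree_mul_le (p := c) (q := ∏ j ∈ Finset.univ.erase i, (g j).leadingCoeff)
  omega

omit H in
lemma degree_top_le {k M : ℕ} (l : ZMod p) {w : F[X][X]} (hw : w ∈ box p F k M) :
    (l • (C f.leadingCoeff * X ^ k) + w).degree ≤ (k : WithBot ℕ) :=
  (degree_add_le _ _).trans (max_le ((degree_smul_le _ _).trans (degree_C_mul_X_pow_le _ _))
    (mem_box.mp hw).1.le)

omit H in
lemma coeff_top {k M : ℕ} (l : ZMod p) {w : F[X][X]} (hw : w ∈ box p F k M) :
    (l • (C f.leadingCoeff * X ^ k) + w).coeff k = l • f.leadingCoeff := by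
  rw [coeff_add, coeff_smul, coeff_C_mul_X_pow, if_pos rfl,
    coeff_eq_zero_of_degree_lt (mem_box.mp hw).1, add_zero]

/-- A nonzero multiple of `g_i` has degree at least that of `g_i`; then the leading term forces `l =
0`. This is why the search for the factor fails below its degree. -/
lemma eq_zero_of_dvd_top {i : Fin s} {k M : ℕ} (hk : k < (g i).natDegree) (l : ZMod p)
    {w : F[X][X]} (hw : w ∈ box p F k M) (h : g i ∣ l • (C f.leadingCoeff * X ^ k) + w) :
    l = 0 ∧ w = 0 := by
  have h1 := eq_zero_of_dvd_of_degree_lt h (by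
    rw [degree_eq_natDegree (H.irreducible i).ne_zero]
    exact (degree_top_le l hw).trans_lt (by exact_mod_cast hk))
  have h2 := coeff_top (f := f) l hw
  rw [h1, coeff_zero, eq_comm, smul_eq_zero] at h2
  have h3 := h2.resolve_right (leadingCoeff_ne_zero.mpr H.f_ne_zero)
  refine ⟨h3, ?_⟩
  simpa [h3] using h1

/-- Subtracting `l • outFactor c g i` cancels the leading terms, and a multiple of `g_i` of smaller
degree is zero. -/
lemma eq_smul_of_dvd_top {i : Fin s} {M : ℕ} (l : ZMod p) {w : F[X][X]}
    (hw : w ∈ box p F (g i).natDegree M)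
    (h : g i ∣ l • (C f.leadingCoeff * X ^ (g i).natDegree) + w) :
    l • (C f.leadingCoeff * X ^ (g i).natDegree) + w = l • outFactor c g i := by
  refine sub_eq_zero.mp (eq_zero_of_dvd_of_degree_lt (dvd_sub h ?_) ?_)
  · exact dvd_smul_of_dvd _ (Dvd.intro_left _ rfl)
  · have h0 : g i ≠ 0 := (H.irreducible i).ne_zero
    rw [degree_eq_natDegree h0, degree_lt_iff_coeff_zero]
    intro j hj
    rcases hj.eq_or_lt with rfl | hj
    · have h2 : (outFactor c g i).coeff (g i).natDegree = f.leadingCoeff := by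
        rw [← H.leadingCoeff_outFactor i, leadingCoeff, H.natDegree_outFactor]
      rw [coeff_sub, coeff_top l hw, coeff_smul, h2, sub_self]
    · rw [coeff_sub, coeff_smul, coeff_eq_zero_of_natDegree_lt (p := outFactor c g i),
        coeff_eq_zero_of_degree_lt ((degree_top_le l hw).trans_lt (by exact_mod_cast hj)),
        smul_zero, sub_zero]
      rwa [H.natDegree_outFactor]

/-- The search succeeds at the degree of `g_i`: `outFactor c g i` without its leading term is the
witness `w`, and the bound on its `t`-degree puts it into the box. -/
lemma exists_top {i : Fin s} {M : ℕ} (hM : tdeg f < M) (hn : f.natDegree < M) (a : ZMod p) :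
    ∃ w ∈ box p F (g i).natDegree M, ∃ z ∈ box p F M M,
      C f.leadingCoeff * X ^ (g i).natDegree + w = outFactor c g i ∧
      (a • logDer c g i) * outFactor c g i + f * z = 0 := by
  have h0 : g i ≠ 0 := (H.irreducible i).ne_zero
  obtain ⟨z, hz, h⟩ := exists_box_of_dvd (p := p) (f := f)
    (y := (a • logDer c g i) * outFactor c g i) (M := M) H.f_ne_zero (by
      rw [smul_mul_assoc]
      exact dvd_smul_of_dvd _ (H.dvd_logDer_mul.mpr (Dvd.intro_left _ rfl))) (by
      have h1 : (a • logDer c g i).natDegree ≤ f.natDegree :=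
        (natDegree_smul_le _ _).trans (natDegree_le_of_degree_le (H.degree_logDer i).le)
      have h2 := natDegree_le_of_dvd (H.dvd i) H.f_ne_zero
      rw [← H.natDegree_outFactor] at h2
      have h3 := natDegree_mul_le_of_le h1 h2
      omega) (by
      have h1 := (tdeg_smul_le a (logDer c g i)).trans (H.tdeg_logDer i)
      have h2 := tdeg_mul_le (a • logDer c g i) (outFactor c g i)
      have h3 := H.tdeg_outFactor i
      omega)
  refine ⟨(outFactor c g i).eraseLead, mem_box.mpr ⟨?_, fun j => ?_⟩, z, hz, ?_, h⟩
  · rw [← H.natDegree_outFactor, ← degree_eq_natDegree (H.outFactor_ne_zero i)]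
    exact degree_eraseLead_lt (H.outFactor_ne_zero i)
  · rw [eraseLead_coeff]
    split_ifs
    · rw [degree_zero]
      exact WithBot.bot_lt_coe _
    · refine degree_le_natDegree.trans_lt ?_
      exact_mod_cast ((tdeg_le_iff.mp (H.tdeg_outFactor i)) j).trans_lt hM
  · rw [← H.leadingCoeff_outFactor i, ← H.natDegree_outFactor, C_mul_X_pow_eq_monomial, add_comm]
    exact eraseLead_add_monomial_natDegree_leadingCoeff _

/-- Gauss' lemma; an irreducible polynomial of positive degree is primitive. -/
lemma irreducible_toK (i : Fin s) : Irreducible (toK (g i)) :=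
  ((H.irreducible i).isPrimitive (H.pos i).ne').irreducible_iff_irreducible_map_fraction_map.mp
    (H.irreducible i)

lemma isFactorization {l : List (Fin s)} (hl : l.Nodup) (hl' : ∀ i, i ∈ l) :
    IsFactorization f (l.map (outFactor c g)) := by
  classical
  have h0 : ∀ i, algebraMap F[X] (RatFunc F) (g i).leadingCoeff ≠ 0 := fun i => by
    rw [Ne, map_eq_zero_iff _ algebraMap_ratFunc_injective]
    exact leadingCoeff_ne_zero.mpr (H.irreducible i).ne_zero
  have hm : ∀ i, toK (g i) = C (algebraMap F[X] (RatFunc F) (g i).leadingCoeff) *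
      normalize (toK (g i)) := by
    intro i
    rw [normalize_apply, coe_normUnit_of_ne_zero (toK_ne_zero (H.irreducible i).ne_zero), toK,
      leadingCoeff_map_of_injective algebraMap_ratFunc_injective, mul_left_comm, ← C_mul,
      mul_inv_cancel₀ (h0 i), C_1, mul_one]
  refine ⟨l.map fun i => normalize (toK (g i)), ?_, ?_, ?_⟩
  · intro q hq
    obtain ⟨i, -, rfl⟩ := List.mem_map.mp hq
    exact ⟨monic_normalize (toK_ne_zero (H.irreducible i).ne_zero),
      (associated_normalize _).irreducible (H.irreducible_toK i)⟩
  · have h1 : (l.map fun i => normalize (toK (g i))).prod = ∏ i, normalize (toK (g i)) := by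
      rw [← List.prod_toFinset _ hl]
      congr 1
      ext i
      simp [hl' i]
    rw [h1, H.leadingCoeff_eq]
    conv_lhs => rw [H.eq, toK_mul]
    rw [map_mul, map_prod, C_mul, map_prod, mul_assoc, ← Finset.prod_mul_distrib]
    congr 1
    · simp [toK]
    · rw [toK, Polynomial.map_prod]
      exact Finset.prod_congr rfl fun i _ => hm i
  · rw [List.map_map, List.map_map]
    refine List.map_congr_left fun i _ => ?_
    simp only [Function.comp_apply, outFactor, toK_mul]
    rw [← H.scale_mul i]
    generalize c * ∏ j ∈ Finset.univ.erase i, (g j).leadingCoeff = a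
    rw [map_mul, C_mul, mul_assoc, ← hm i, toK,
      map_C]

end IsFactorData
end split
end FactorFqt


namespace FactorFqt
open Fn

/-! ### Systems of linear equations in `𝔽_q[t][X]` -/

/-- The generators for the kernel of a linear map. The arguments are the pair of the parameter of
`op` and a size, and the element. -/
def gen (op keep : Fn) : Fn :=
  .pair (call₃ bflat (call₂ op (.comp .hd (var 0)) (var 1) (drop 2)) .nil (.comp .tl (var 0))
    (drop 2)) keep

/-- The solutions of a system of linear equations, without the zero solution. -/
def solve (keep : Fn) : Fn :=
  for_ (ker bivFn) .nil
    (.ite (call₁ bivFn.nz (.comp .tl (var 1)) (drop 4)) (.pair (.comp keep (var 1)) (var 0)) (var 0))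

/-- The time of `solve` for `k` unknowns. -/
def tsolve (K k b : ℕ) : ℕ := K * (tcut bivFn k (K + 1) b + 50) + k * (bivFn.t b + 100) + 100

section solve
variable {p m : ℕ} [hp : Fact p.Prime] {F : Type u} [Field F] [Algebra (ZMod p) F]
  (γ : Module.Basis (Fin m) (ZMod p) F)

/-- The elements which can be represented. -/
def repSub {b : ℕ} (hb : p + m ≤ b) : Submodule (ZMod p) F[X][X] where
  carrier := {x | ∃ v, brep γ b v x}
  add_mem' := by
    rintro x y ⟨u, hu⟩ ⟨v, hv⟩
    exact ⟨_, ((bivFn_spec γ).add hb hu hv).1⟩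
  zero_mem' := ⟨_, (bivFn_spec γ).zero b⟩
  smul_mem' := by
    rintro s x ⟨u, hu⟩
    exact ⟨_, ((bivFn_spec γ).scale s hb hu).1⟩

lemma bcoord_eq_zero {b : ℕ} (hb : p + m ≤ b) {x : F[X][X]} (hx : x ∈ repSub γ hb)
    (h : bcoord γ b x = 0) : x = 0 := by
  obtain ⟨v, hv⟩ := hx
  exact (bflat_spec γ).injective hb hv h

/-- Each generator `x` becomes the coordinates of `φ x` paired with `ψ x`. Elimination on the
coordinates then yields relations, with `ψ` selecting what is remembered: the element itself or
nothing. -/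
lemma gen_spec {op keep : Fn} {b M t : ℕ} (hb : p + m ≤ M) {u : Val}
    {φ ψ : F[X][X] →ₗ[ZMod p] F[X][X]}
    (hop : ∀ v x, brep γ b v x → brep γ M (op.eval (.cons u (.cons v (encField γ)))) (φ x) ∧
      op.cost (.cons u (.cons v (encField γ))) ≤ t)
    (hkeep : ∀ a v x, brep γ b v x →
      brep γ b (keep.eval (.cons a (.cons v (encField γ)))) (ψ x) ∧
      keep.cost (.cons a (.cons v (encField γ))) ≤ 10)
    {L : List Val} {l : List F[X][X]} (hL : List.Forall₂ (brep γ b) L l) :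
    (∃ L', (mapF (gen op keep)).eval
        (.cons (.cons u (encNat M)) (.cons (encList L) (encField γ))) = encList L' ∧
      List.Forall₂ (prep p (brep γ) (bnum M) b) L' (l.map ((bcoord γ M ∘ₗ φ).prod ψ)) ∧
      L'.length = L.length) ∧
    (mapF (gen op keep)).cost (.cons (.cons u (encNat M)) (.cons (encList L) (encField γ))) ≤
      L.length * (t + tbflat M + 200) + 80 := by
  have key : ∀ v x, brep γ b v x →
      prep p (brep γ) (bnum M) b ((gen op keep).eval
        (.cons (.cons u (encNat M)) (.cons v (encField γ)))) (((bcoord γ M ∘ₗ φ).prod ψ) x) ∧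
      (gen op keep).cost (.cons (.cons u (encNat M)) (.cons v (encField γ))) ≤
        t + tbflat M + 120 := by
    intro v x hv
    obtain ⟨h1, h2⟩ := hop v x hv
    obtain ⟨h3, h4⟩ := hkeep (.cons u (encNat M)) v x hv
    obtain ⟨h5, h6⟩ := (bflat_spec γ).eval hb h1 (ListRep.nil (r := srep p) 0)
    refine ⟨⟨?_, ?_, ?_⟩, ?_⟩
    · simpa [gen] using h5
    · simpa [gen] using h3
    · simp [gen]
    · simp [gen]
      omega
  have hc : ∀ v ∈ L, (gen op keep).cost (.cons (.cons u (encNat M)) (.cons v (encField γ))) ≤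
      t + tbflat M + 120 := by
    clear hkeep hop
    induction hL with
    | nil => simp
    | cons h _ ih =>
      intro v hv
      rcases List.mem_cons.mp hv with rfl | hv
      · exact (key _ _ h).2
      · exact ih v hv
  obtain ⟨h1, h2⟩ := mapF_spec L hc
  refine ⟨⟨_, h1, ?_, by simp⟩, h2.trans_eq (by ring)⟩
  rw [List.forall₂_map_left_iff, List.forall₂_map_right_iff]
  exact hL.imp fun v x hv => (key v x hv).1

/-- Redundant generators can produce zero solutions. By `hz` a solution with second component zero
is zero altogether, so discarding these preserves the span and makes "no solution" equivalent to
`nil`. -/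
lemma solve_spec {S : Type*} [AddCommGroup S] [Module (ZMod p) S] {n b K : ℕ} (hn : n ≤ K + 1)
    (hb : p + m ≤ b) (hpK : p ≤ K + 1) {keep : Fn} {rep : Val → S → Prop}
    {κ : (ZMod p)[X] × F[X][X] →ₗ[ZMod p] S}
    (hkeep : ∀ v x, prep p (brep γ) n b v x → rep (keep.eval v) (κ x) ∧ keep.cost v ≤ 10)
    {L : List Val} {l : List ((ZMod p)[X] × F[X][X])}
    (hL : List.Forall₂ (prep p (brep γ) n b) L l) 
    (hz : ∀ x ∈ (lspan (ZMod p) l).comap (shiftMap p F[X][X] K), x.2 = 0 → x = 0) :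
    (∃ L' l', (solve keep).eval (.cons (encNat K) (.cons (encList L) (encField γ))) =
        encList L' ∧
      List.Forall₂ rep L' (l'.map κ) ∧ L'.length ≤ L.length ∧ (∀ x ∈ l', x.2 ≠ 0) ∧
      lspan (ZMod p) l' = (lspan (ZMod p) l).comap (shiftMap p F[X][X] K)) ∧
    (solve keep).cost (.cons (encNat K) (.cons (encList L) (encField γ))) ≤
      tsolve K L.length b := by
  obtain ⟨⟨L₁, l₁, h1, h2, h3, h4⟩, h5⟩ := ker_spec γ (bivFn_spec γ) hn hb hpK hL K
  obtain ⟨⟨O, o, lr, h6, h7, h8, h9, h10, h11⟩, h12⟩ := for_inv (l := ker bivFn) (a := .nil)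
    (s := .ite (call₁ bivFn.nz (.comp .tl (var 1)) (drop 4)) (.pair (.comp keep (var 1)) (var 0))
      (var 0))
    (x := .cons (encNat K) (.cons (encList L) (encField γ))) (B := bivFn.t b + 60)
    (fun Lr acc => ∃ O o lr, acc = encList O ∧ List.Forall₂ rep O (List.map κ o) ∧
      List.Forall₂ (prep p (brep γ) n b) Lr lr ∧ O.length + Lr.length ≤ L.length ∧
      (∀ x ∈ o, x.2 ≠ 0) ∧
      lspan (ZMod p) o ⊔ lspan (ZMod p) lr = (lspan (ZMod p) l).comap (shiftMap p F[X][X] K))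
    (L := L₁) h1 ⟨[], [], l₁, by simp, by simp, h2, by simpa using h3, by simp, by simp [h4]⟩ (by
      rintro z Lr _ ⟨O, o, lr, rfl, h7, h8, h9, h10, h11⟩
      cases h8 with
      | @cons _ x _ lr hx h8 =>
      obtain ⟨h12, h13⟩ := (bivFn_spec γ).nz hb hx.2.1
      obtain ⟨h14, h15⟩ := hkeep z x hx
      rw [lspan_cons] at h11
      simp only [List.length_cons] at h9
      by_cases h0 : x.2 = 0
      · have hc : eval (call₁ bivFn.nz (.comp .tl (var 1)) (drop 4)) (.cons (encList O) (.cons z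
            (.cons (encNat K) (.cons (encList L) (encField γ))))) = .nil := by
          simpa using not_imp_comm.mp h12.1 (by simpa using h0)
        rw [eval_ite_nil _ _ hc, cost_ite_nil _ _ hc]
        have hx0 : x = 0 := hz x (by
          rw [← h11]
          exact Submodule.mem_sup_right (Submodule.mem_sup_left (Submodule.mem_span_singleton_self x)))
          h0
        refine ⟨⟨O, o, lr, rfl, h7, h8, by omega, h10, ?_⟩, ?_⟩
        · rw [← h11, hx0]
          simp
        · simp
          omega
      · have hc : eval (call₁ bivFn.nz (.comp .tl (var 1)) (drop 4)) (.cons (encList O) (.cons z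
            (.cons (encNat K) (.cons (encList L) (encField γ))))) ≠ .nil := by
          simpa using h12.2 h0
        rw [eval_ite_ne _ _ hc, cost_ite_ne _ _ hc]
        refine ⟨⟨keep.eval z :: O, x :: o, lr, by simp, .cons h14 h7, h8, ?_, ?_, ?_⟩, ?_⟩
        · simp only [List.length_cons]
          omega
        · simpa [h0] using h10
        · rw [← h11, lspan_cons, sup_left_comm, sup_assoc]
        · simp
          omega)
  cases h8
  rw [lspan_nil, sup_bot_eq] at h11
  refine ⟨⟨O, o, h6, h7, by simpa using h9, h10, h11⟩, h12.trans ?_⟩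
  rw [tsolve]
  have h13 : L₁.length * (bivFn.t b + 60 + 9) ≤ L.length * (bivFn.t b + 100) :=
    Nat.mul_le_mul h3 (by omega)
  simp only [cost_nil]
  omega

end solve

/-! ### The solution spaces -/

section solutions
variable {p m : ℕ} [hp : Fact p.Prime] {F : Type u} [Field F] [Algebra (ZMod p) F]
  (γ : Module.Basis (Fin m) (ZMod p) F)

lemma mem_lspan_map_append {φ ψ : F[X][X] →ₗ[ZMod p] F[X][X]} {M : ℕ} {l lz : List F[X][X]}
    {q : (ZMod p)[X]} {w : F[X][X]} :
    (q, w) ∈ lspan (ZMod p) (l.map ((bcoord γ M ∘ₗ φ).prod LinearMap.id) ++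
        lz.map ((bcoord γ M ∘ₗ ψ).prod 0)) ↔
      w ∈ lspan (ZMod p) l ∧ ∃ z ∈ lspan (ZMod p) lz, q = bcoord γ M (φ w + ψ z) := by
  rw [lspan_append, lspan_map, lspan_map, Submodule.mem_sup]
  constructor
  · rintro ⟨_, ⟨x, hx, rfl⟩, _, ⟨z, hz, rfl⟩, h⟩
    simp only [LinearMap.prod_apply, Function.prod_apply, LinearMap.comp_apply, LinearMap.id_apply,
      LinearMap.zero_apply, Prod.mk_add_mk, add_zero, Prod.mk.injEq] at h
    obtain ⟨h1, rfl⟩ := h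
    exact ⟨hx, z, hz, by rw [← h1, map_add]⟩
  · rintro ⟨hw, z, hz, rfl⟩
    exact ⟨_, ⟨w, hw, rfl⟩, _, ⟨z, hz, rfl⟩, by simp⟩

/-- The solutions of `φ x + ψ z = 0`. -/
lemma comap_solutions {φ ψ : F[X][X] →ₗ[ZMod p] F[X][X]} {M : ℕ} (hM : p + m ≤ M)
    {l lz : List F[X][X]} (hl : ∀ x ∈ l, φ x ∈ repSub γ hM) (hlz : ∀ z ∈ lz, ψ z ∈ repSub γ hM)
    (x : (ZMod p)[X] × F[X][X]) :
    x ∈ (lspan (ZMod p) (l.map ((bcoord γ M ∘ₗ φ).prod LinearMap.id) ++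
        lz.map ((bcoord γ M ∘ₗ ψ).prod 0))).comap (shiftMap p F[X][X] (bnum M)) ↔
      x.1 = 0 ∧ x.2 ∈ lspan (ZMod p) l ∧ ∃ z ∈ lspan (ZMod p) lz, φ x.2 + ψ z = 0 := by
  have h1 : lspan (ZMod p) l ≤ (repSub γ hM).comap φ := lspan_le.mpr hl
  have h2 : lspan (ZMod p) lz ≤ (repSub γ hM).comap ψ := lspan_le.mpr hlz
  obtain ⟨q, w⟩ := x
  rw [Submodule.mem_comap, shiftMap_apply, mem_lspan_map_append]
  constructor
  · rintro ⟨hw, z, hz, h⟩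
    -- The coordinates occupy positions below `bnum M` and the leftover `q` the positions from there
    -- on, so both vanish separately.
    have h3 : bcoord γ M (φ w + ψ z) + X ^ bnum M * (-q) = 0 := by rw [← h]; ring
    obtain ⟨h4, h5⟩ := eq_zero_of_add_X_pow_mul ((bflat_spec γ).degree _ _) h3
    exact ⟨by simpa using h5, hw, z, hz,
      bcoord_eq_zero γ hM (add_mem (h1 hw) (h2 hz)) h4⟩
  · rintro ⟨h3, hw, z, hz, h4⟩
    exact ⟨hw, z, hz, by rw [h4, map_zero, show q = 0 from h3, mul_zero]⟩

/-- The solutions of `φ x + ψ z = 0` with an additional generator `x₀`, whose coefficient is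
recorded. -/
lemma comap_solutions_cons {φ ψ : F[X][X] →ₗ[ZMod p] F[X][X]} {M : ℕ} (hM : p + m ≤ M)
    {x₀ : F[X][X]} {l lz : List F[X][X]} (h0 : φ x₀ ∈ repSub γ hM)
    (hl : ∀ x ∈ l, φ x ∈ repSub γ hM) (hlz : ∀ z ∈ lz, ψ z ∈ repSub γ hM)
    (x : (ZMod p)[X] × F[X][X]) :
    x ∈ (lspan (ZMod p) ((bcoord γ M (φ x₀) + X ^ bnum M, x₀) ::
        (l.map ((bcoord γ M ∘ₗ φ).prod LinearMap.id) ++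
        lz.map ((bcoord γ M ∘ₗ ψ).prod 0)))).comap (shiftMap p F[X][X] (bnum M)) ↔
      ∃ c : ZMod p, x.1 = C c ∧ ∃ w ∈ lspan (ZMod p) l, x.2 = c • x₀ + w ∧
        ∃ z ∈ lspan (ZMod p) lz, φ x.2 + ψ z = 0 := by
  have h1 : lspan (ZMod p) l ≤ (repSub γ hM).comap φ := lspan_le.mpr hl
  have h2 : lspan (ZMod p) lz ≤ (repSub γ hM).comap ψ := lspan_le.mpr hlz
  obtain ⟨q, y⟩ := x
  rw [Submodule.mem_comap, shiftMap_apply, lspan_cons, Submodule.mem_sup]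
  constructor
  · rintro ⟨_, hc, ⟨q', w⟩, hw, h⟩
    obtain ⟨c, rfl⟩ := Submodule.mem_span_singleton.mp hc
    rw [mem_lspan_map_append] at hw
    obtain ⟨hw, z, hz, rfl⟩ := hw
    simp only [Prod.smul_mk, Prod.mk_add_mk, Prod.mk.injEq] at h
    obtain ⟨h3, rfl⟩ := h
    -- The extra entry of the generator `x₀` stands at position `bnum M`; it survives the
    -- elimination as the constant `q = C c`.
    have h4 : bcoord γ M (φ (c • x₀ + w) + ψ z) + X ^ bnum M * (C c - q) = 0 := by
      rw [mul_sub, ← h3]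
      simp only [map_add, map_smul, smul_add, smul_eq_C_mul]
      ring
    obtain ⟨h5, h6⟩ := eq_zero_of_add_X_pow_mul ((bflat_spec γ).degree _ _) h4
    refine ⟨c, (sub_eq_zero.mp h6).symm, w, hw, rfl, z, hz, ?_⟩
    refine bcoord_eq_zero γ hM (add_mem ?_ (h2 hz)) h5
    rw [map_add, map_smul]
    exact add_mem (Submodule.smul_mem _ _ h0) (h1 hw)
  · rintro ⟨c, h3, w, hw, h4, z, hz, h5⟩
    simp only at h3 h4 h5
    refine ⟨_, Submodule.smul_mem _ c (Submodule.mem_span_singleton_self _),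
      (bcoord γ M (φ w + ψ z), w), (mem_lspan_map_append γ).mpr ⟨hw, z, hz, rfl⟩, ?_⟩
    rw [Prod.smul_mk, Prod.mk_add_mk, ← h4, h3]
    congr 1
    have h6 : bcoord γ M (φ y + ψ z) = 0 := by rw [h5, map_zero]
    rw [h4] at h6
    simp only [map_add, map_smul, smul_add, smul_eq_C_mul] at h6 ⊢
    linear_combination h6

end solutions
end FactorFqt


namespace FactorFqt
open Fn

/-! ### Partitions of the set of factors -/

section pieces
variable {p : ℕ} [hp : Fact p.Prime] {s : ℕ}

/-- The nonempty sets of the elements of `S` where `χ` has the value `0, -1, …, -(k - 1)`. -/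
def pieces (χ : Fin s → ZMod p) (S : Finset (Fin s)) : ℕ → List (Finset (Fin s))
  | 0 => []
  | k + 1 => if ({i ∈ S | χ i + k = 0} : Finset (Fin s)).Nonempty then
      {i ∈ S | χ i + k = 0} :: pieces χ S k else pieces χ S k

/-- The sets in the list are nonempty, disjoint, and cover everything. -/
def IsPartition (SS : List (Finset (Fin s))) : Prop :=
  (∀ S ∈ SS, S.Nonempty) ∧ ∀ i, SS.countP (i ∈ ·) = 1

lemma mem_pieces {χ : Fin s → ZMod p} {S T : Finset (Fin s)} {k : ℕ} (h : T ∈ pieces χ S k) :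
    T.Nonempty ∧ T ⊆ S ∧ ∀ i ∈ T, ∀ j ∈ T, χ i = χ j := by
  induction k with
  | zero => simp [pieces] at h
  | succ k ih =>
    rw [pieces] at h
    split_ifs at h with hne
    · rcases List.mem_cons.mp h with rfl | h
      · refine ⟨hne, Finset.filter_subset _ _, fun i hi j hj => ?_⟩
        rw [eq_neg_of_add_eq_zero_left (Finset.mem_filter.mp hi).2,
          eq_neg_of_add_eq_zero_left (Finset.mem_filter.mp hj).2]
      · exact ih h
    · exact ih h

/-- The index `i` belongs to the level set for the single value `k = (-χ i).val`; with `k = p` every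
element of `S` is counted once. -/
lemma countP_pieces (χ : Fin s → ZMod p) (S : Finset (Fin s)) (i : Fin s) {k : ℕ} (hk : k ≤ p) :
    (pieces χ S k).countP (i ∈ ·) = if i ∈ S ∧ (-χ i).val < k then 1 else 0 := by
  induction k with
  | zero => simp [pieces]
  | succ k ih =>
    have e : χ i + k = 0 ↔ (-χ i).val = k := by
      rw [add_comm, ← eq_neg_iff_add_eq_zero]
      constructor
      · intro h
        rw [← h, ZMod.val_cast_of_lt (by omega)]
      · intro h
        rw [← h, ZMod.natCast_zmod_val]
    have ih := ih (by omega)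
    rw [pieces]
    split_ifs with hne h h
    · rw [List.countP_cons, ih]
      by_cases h1 : (-χ i).val = k
      · simp [h.1, h1, e]
      · simp [h.1, h1, e, show (-χ i).val < k by omega]
    · rw [List.countP_cons, ih, if_neg (by rintro ⟨h1, h2⟩; exact h ⟨h1, by omega⟩), if_neg]
      simp only [Finset.mem_filter, decide_eq_true_eq, e]
      rintro ⟨h1, h2⟩
      exact h ⟨h1, by omega⟩
    · rw [ih, if_pos]
      refine ⟨h.1, ?_⟩
      by_contra h1
      exact hne ⟨i, Finset.mem_filter.mpr ⟨h.1, e.mpr (by omega)⟩⟩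
    · rw [ih, if_neg (by rintro ⟨h1, h2⟩; exact h ⟨h1, by omega⟩)]

/-- Double counting: each nonempty block contributes at least one index and every index is counted
once. This bounds the number of blocks during refinement. -/
lemma IsPartition.length_le {SS : List (Finset (Fin s))} (h : IsPartition SS) : SS.length ≤ s := by
  have key : ∀ SS : List (Finset (Fin s)), (∀ S ∈ SS, S.Nonempty) →
      SS.length ≤ ∑ i : Fin s, SS.countP (i ∈ ·) := by
    intro SS
    induction SS with
    | nil => simp
    | cons S SS ih =>
      intro h
      have h1 := ih fun T hT => h T (by simp [hT])
      have h2 := (h S (by simp)).card_pos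
      simp only [List.countP_cons, Finset.sum_add_distrib, List.length_cons, decide_eq_true_eq,
        Finset.sum_boole, Finset.filter_univ_mem, Nat.cast_id]
      omega
  refine (key SS h.1).trans ?_
  simp [h.2]

lemma IsPartition.exists_list {SS : List (Finset (Fin s))} (h : IsPartition SS)
    (h1 : ∀ S ∈ SS, ∀ i ∈ S, ∀ j ∈ S, i = j) :
    ∃ l : List (Fin s), SS = l.map ({·}) ∧ l.Nodup ∧ ∀ i, i ∈ l := by
  obtain ⟨l, rfl⟩ : ∃ l : List (Fin s), SS = l.map ({·}) := by
    have h2 := h.1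
    clear h
    induction SS with
    | nil => exact ⟨[], rfl⟩
    | cons S SS ih =>
      obtain ⟨l, rfl⟩ := ih (fun T hT => h1 T (by simp [hT])) fun T hT => h2 T (by simp [hT])
      obtain ⟨i, hi⟩ := h2 S (by simp)
      refine ⟨i :: l, ?_⟩
      rw [List.map_cons]
      congr 1
      ext j
      rw [Finset.mem_singleton]
      exact ⟨fun hj => h1 S (by simp) j hj i hi, fun hj => hj ▸ hi⟩
  have h3 : ∀ i, l.count i = 1 := by
    intro i
    rw [← h.2 i, List.countP_map, List.count]
    refine List.countP_congr fun j _ => ?_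
    simp only [Function.comp_apply, Finset.mem_singleton, decide_eq_true_eq, beq_iff_eq]
    exact eq_comm
  exact ⟨l, rfl, List.nodup_iff_count_le_one.mpr fun i => (h3 i).le,
    fun i => List.count_pos_iff.mp (by rw [h3]; exact one_pos)⟩

end pieces

/-! ### Splitting programs -/

/-- The solutions `x` in the span of the second argument of `q x + f z = 0`, where `q` is the
first argument. -/
def split : Fn :=
  call₂ (solve .tl) (var 5)
    (call₂ revApp (call₂ (mapF (gen bmul (var 1))) (.pair (var 0) (var 4)) (var 1) (drop 8))
      (var 3) .nil) (drop 8)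

/-- Splits the space given as second argument by the first argument, and adds the parts to the
third argument. -/
def splitAll : Fn :=
  .comp .tl (for_ (var 9) (.pair (var 0) (var 2))
    (letIn (call₂ split (.comp .hd (var 0)) (var 3) (drop 5))
      (.pair (call₂ bivFn.add (.comp .hd (var 1)) (var 6) (drop 12))
        (.ite (var 0) (.pair (var 0) (.comp .tl (var 1))) (.comp .tl (var 1))))))

/-- Splits all spaces in the second argument by the first argument. -/
def refineF : Fn := for_ (var 1) .nil (call₃ splitAll (var 2) (var 1) (var 0) (drop 4))

/-- Splits all spaces in the second argument by all elements of the first argument. -/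
def refineAll : Fn := for_ (var 0) (var 1) (call₂ refineF (var 1) (var 0) (drop 4))

/-- The time of `split` for spaces given by `k` generators. -/
def tsplit (k b : ℕ) : ℕ :=
  tsolve (bnum (b * b)) (k + b ^ 3) b + k * (tbmul (b + b) + tbflat (b * b) + 250) + 200

/-- The time of `splitAll`. -/
def tsplitAll (k b : ℕ) : ℕ := b * (tsplit k b + bivFn.t b + 150) + 100

/-- The time of `refineF`. -/
def trefine (k b : ℕ) : ℕ := b * (tsplitAll k b + 50) + 50

/-- The time of `refineAll`. -/
def trefineAll (b : ℕ) : ℕ := b ^ 3 * (trefine (b ^ 3 * b ^ 3) b + 50) + 50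

lemma tsolve_mono {K k k' b : ℕ} (h : k ≤ k') : tsolve K k b ≤ tsolve K k' b := by
  simp only [tsolve, tcut]
  gcongr

lemma tsplit_mono {k k' b : ℕ} (h : k ≤ k') : tsplit k b ≤ tsplit k' b := by
  simp only [tsplit]
  have := tsolve_mono (K := bnum (b * b)) (b := b) (show k + b ^ 3 ≤ k' + b ^ 3 by omega)
  gcongr

lemma trefine_mono {k k' b : ℕ} (h : k ≤ k') : trefine k b ≤ trefine k' b := by
  simp only [trefine, tsplitAll]
  have := tsplit_mono (b := b) h
  gcongr

section splitting
variable {p m : ℕ} [hp : Fact p.Prime] {F : Type u} [Field F] [Algebra (ZMod p) F]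
  (γ : Module.Basis (Fin m) (ZMod p) F)

/-- The parts of the environment of the main loops: the derivative of `f`, the generators from the
multiples of `f`, the polynomials in `t`, and `f`. -/
structure Ctx (f : F[X][X]) (b : ℕ) where
  /-- the derivative -/
  dv : Val
  /-- the generators from the multiples of `f` -/
  ZL : List Val
  /-- the polynomials in `t` -/
  TL : List Val
  /-- the polynomial `f` -/
  fv : Val
  /-- the cofactors -/
  lz : List F[X][X]
  /-- the polynomials in `t` -/
  lt : List F[X]
  hb : p + m ≤ b
  two_le : 2 ≤ b
  hd : brep γ b dv (derivative f)
  hZ : List.Forall₂ (prep p (brep γ) (bnum (b * b)) b) ZL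
    (lz.map ((bcoord γ (b * b) ∘ₗ LinearMap.mulLeft (ZMod p) f).prod 0))
  hZr : ∀ z ∈ lz, f * z ∈ repSub γ (hb.trans (Nat.le_mul_self b))
  hZs : lspan (ZMod p) lz = box p F b b
  hZl : ZL.length ≤ b ^ 3
  hT : List.Forall₂ (liftRep (frep γ) b) TL lt
  hTs : lspan (ZMod p) lt = polySub ⊤ b
  hTl : TL.length ≤ b * b
  hf : brep γ b fv f
  hfv : fv = encBiv γ f
  hft : tdeg f < b
  hfn : f.natDegree < b

variable {γ}
variable {f : F[X][X]} {b : ℕ} (Γ : Ctx γ f b)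

/-- The environment. -/
noncomputable def Ctx.val : Val :=
  .cons Γ.dv (.cons (encList Γ.ZL) (.cons (encNat (b * b)) (.cons (encNat (bnum (b * b)))
    (.cons (encList Γ.TL) (.cons Γ.fv (encField γ))))))

include Γ in
lemma Ctx.add_self_le : b + b ≤ b * b := by
  have := Nat.mul_le_mul_right b Γ.two_le
  omega

include Γ in
lemma Ctx.hbM : p + m ≤ b * b := Γ.hb.trans (Nat.le_mul_self b)

include Γ in
lemma Ctx.mul_spec {v w : Val} {x y : F[X][X]} (hv : brep γ b v x) (hw : brep γ b w y) :
    brep γ (b * b) (bmul.eval (.cons v (.cons w (encField γ)))) (x * y) ∧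
      bmul.cost (.cons v (.cons w (encField γ))) ≤ tbmul (b + b) := by
  obtain ⟨h1, h2⟩ := bmul_spec γ Γ.hb Γ.hb hv hw
  exact ⟨(bivFn_spec γ).mono Γ.add_self_le h1, h2⟩

omit hp in
lemma lspan_reverse {k V : Type*} [Field k] [AddCommGroup V] [Module k V] (l : List V) :
    lspan k l.reverse = lspan k l := by
  simp [lspan]

include Γ in
lemma Ctx.mul_mem {UL : List Val} {ul : List F[X][X]} (hU : List.Forall₂ (brep γ b) UL ul)
    {v : Val} {q : F[X][X]} (hv : brep γ b v q) :
    ∀ x ∈ ul, q * x ∈ repSub γ Γ.hbM := by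
  induction hU with
  | nil => simp
  | cons h _ ih =>
    intro x hx
    rcases List.mem_cons.mp hx with rfl | hx
    · exact ⟨_, (Γ.mul_spec hv h).1⟩
    · exact ih x hx

/-- The unknowns are the coefficients of `x` over the given generators and those of the cofactor
`z`. The multiples of `f` are carried along with second component `0`, so only `x` is returned. -/
lemma split_spec {qv : Val} {q : F[X][X]} (hq : brep γ b qv q) {UL : List Val}
    {ul : List F[X][X]} (hU : List.Forall₂ (brep γ b) UL ul) :
    (∃ L' l', split.eval (.cons qv (.cons (encList UL) Γ.val)) = encList L' ∧
      List.Forall₂ (brep γ b) L' l' ∧ L'.length ≤ UL.length + b ^ 3 ∧ (∀ x ∈ l', x ≠ 0) ∧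
      ∀ x, x ∈ lspan (ZMod p) l' ↔ x ∈ lspan (ZMod p) ul ∧ ∃ z ∈ box p F b b, q * x + f * z = 0) ∧
    split.cost (.cons qv (.cons (encList UL) Γ.val)) ≤ tsplit UL.length b := by
  obtain ⟨⟨L₁, h1, h2, h3⟩, h4⟩ := gen_spec γ (op := bmul) (keep := var 1) Γ.hbM
    (φ := LinearMap.mulLeft (ZMod p) q) (ψ := LinearMap.id) (t := tbmul (b + b)) (u := qv)
    (fun v x hv => Γ.mul_spec hq hv) (fun a v x hv => ⟨by simpa using hv, by simp⟩) hU
  have hL : List.Forall₂ (prep p (brep γ) (bnum (b * b)) b) (L₁.reverse ++ Γ.ZL)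
      (ul.reverse.map ((bcoord γ (b * b) ∘ₗ LinearMap.mulLeft (ZMod p) q).prod LinearMap.id) ++
        Γ.lz.map ((bcoord γ (b * b) ∘ₗ LinearMap.mulLeft (ZMod p) f).prod 0)) := by
    refine List.rel_append ?_ Γ.hZ
    rw [List.map_reverse]
    exact List.rel_reverse h2
  have hc := comap_solutions γ (φ := LinearMap.mulLeft (ZMod p) q)
    (ψ := LinearMap.mulLeft (ZMod p) f) Γ.hbM (l := ul.reverse) (lz := Γ.lz)
    (fun x hx => Γ.mul_mem hU hq x (List.mem_reverse.mp hx)) Γ.hZr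
  -- The bound for the elimination uses one number for the length of the vectors and for `p`.
  have hpK : p ≤ bnum (b * b) + 1 := by
    have h5 := Γ.hbM
    have h0 : 0 < b * b := Nat.mul_pos (by have := Γ.two_le; omega) (by have := Γ.two_le; omega)
    have h6 : b * b * 1 ≤ b * b * (b * b * (b * b * 1)) := Nat.mul_le_mul_left _
      (Nat.mul_pos h0 (Nat.mul_pos h0 one_pos))
    rw [bnum]
    omega
  obtain ⟨⟨L', l', h5, h6, h7, h8, h9⟩, h10⟩ := solve_spec γ (keep := .tl) (rep := brep γ b)
    (κ := LinearMap.snd _ _ _) (Nat.le_succ _) Γ.hb hpK (fun v x hv => ⟨by simpa using hv.2.1, by simp⟩) hL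
    (fun x hx h0 => Prod.ext ((hc x).mp hx).1 h0)
  rw [List.length_append, List.length_reverse, h3] at h7 h10
  have hZl := Γ.hZl
  have e : split.eval (.cons qv (.cons (encList UL) Γ.val)) = encList L' := by
    simp [split, Ctx.val, h1, revApp_eval, h5]
  refine ⟨⟨L', l'.map (LinearMap.snd _ _ _), e, h6, by omega, ?_, fun x => ?_⟩, ?_⟩
  · intro x hx
    obtain ⟨y, hy, rfl⟩ := List.mem_map.mp hx
    exact h8 y hy
  · rw [lspan_map, h9]
    simp only [Submodule.mem_map, hc, lspan_reverse, Γ.hZs]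
    constructor
    · rintro ⟨y, ⟨-, h11, h12⟩, rfl⟩
      exact ⟨h11, h12⟩
    · exact fun h11 => ⟨(0, x), ⟨rfl, h11⟩, rfl⟩
  · have h11 := tsolve_mono (K := bnum (b * b)) (b := b)
      (show UL.length + Γ.ZL.length ≤ UL.length + b ^ 3 by omega)
    have h12 := revApp_cost L₁ (encList Γ.ZL) .nil
    rw [tsplit]
    have h13 : UL.length * (tbmul (b + b) + tbflat (b * b) + 250) =
      UL.length * (tbmul (b + b) + tbflat (b * b) + 200) + UL.length * 50 := by ring
    rw [h3] at h12
    simp [split, Ctx.val, h1, revApp_eval]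
    omega

end splitting
end FactorFqt


/-! ### Refining the blocks until they are singletons -/

namespace FactorFqt
open Fn

section refinement
variable {p m : ℕ} [hp : Fact p.Prime] {F : Type u} [Field F] [Algebra (ZMod p) F]
  {γ : Module.Basis (Fin m) (ZMod p) F} {s : ℕ} {c : F[X]} {g : Fin s → F[X][X]}

variable (γ c g) in
/-- The value is a list of at most `k` nonzero elements spanning the block of `S`. -/
def BlockRel (b k : ℕ) (v : Val) (S : Finset (Fin s)) : Prop :=
  ∃ (L : List Val) (l : List F[X][X]), v = encList L ∧ List.Forall₂ (brep γ b) L l ∧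
    L.length ≤ k ∧ (∀ x ∈ l, x ≠ 0) ∧ lspan (ZMod p) l = blockSub p c g S

variable {f : F[X][X]} (H : IsFactorData f c g)
include H

lemma IsFactorData.blockSub_eq_bot_iff (S : Finset (Fin s)) : blockSub p c g S = ⊥ ↔ S = ∅ := by
  constructor
  · intro h
    by_contra hne
    obtain ⟨i, hi⟩ := Finset.nonempty_iff_ne_empty.mpr hne
    have h1 : comb p c g (Pi.single i 1) ∈ blockSub p c g S :=
      mem_blockSub.mpr ⟨Pi.single i 1, fun j hj => by
        rw [Pi.single_eq_of_ne]
        rintro rfl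
        exact hj hi, rfl⟩
    rw [h, Submodule.mem_bot] at h1
    have h2 := (H.dvd_comb_iff (p := p) (Pi.single i 1) i).mp (h1 ▸ dvd_zero _)
    rw [Pi.single_eq_same] at h2
    exact one_ne_zero h2
  · rintro rfl
    rw [eq_bot_iff]
    intro x hx
    obtain ⟨χ, h1, rfl⟩ := mem_blockSub.mp hx
    rw [show χ = 0 from funext fun i => h1 i (by simp), map_zero]
    exact zero_mem _

/-- As no generator is zero, the list is empty exactly when the block is; the program tests
emptiness by comparing with `nil`. -/
lemma BlockRel.ne_nil_iff {b k : ℕ} {v : Val} {S : Finset (Fin s)} (h : BlockRel γ c g b k v S) :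
    v ≠ .nil ↔ S.Nonempty := by
  obtain ⟨L, l, rfl, h2, h3, h4, h5⟩ := h
  rw [Finset.nonempty_iff_ne_empty, Ne, Ne, not_iff_not, ← H.blockSub_eq_bot_iff (p := p), ← h5]
  cases h2 with
  | nil => simp
  | @cons _ x _ l _ _ =>
    refine iff_of_false (by simp) fun h => h4 x (by simp) ?_
    have := mem_lspan (k := ZMod p) (l := x :: l) (x := x) (by simp)
    rwa [h] at this

variable {b : ℕ} (Γ : Ctx γ f b)

/-- Adding `f' = ∑ logDer c g i` increases all coefficients by one. Splitting by `h`, `h + f'`, `h +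
2 f'` and so on, `p` times, collects all level sets of `χ` on `S`. -/
lemma splitAll_spec {hv : Val} {χ : Fin s → ZMod p} (hχ : brep γ b hv (comb p c g χ)) {k : ℕ}
    {U : Val} {S : Finset (Fin s)} (hU : BlockRel γ c g b k U S) {AL : List Val}
    {SS : List (Finset (Fin s))} (hA : List.Forall₂ (BlockRel γ c g b (k + b ^ 3)) AL SS) :
    (∃ AL', splitAll.eval (.cons hv (.cons U (.cons (encList AL) Γ.val))) = encList AL' ∧
      List.Forall₂ (BlockRel γ c g b (k + b ^ 3)) AL' (pieces χ S p ++ SS)) ∧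
    splitAll.cost (.cons hv (.cons U (.cons (encList AL) Γ.val))) ≤ tsplitAll k b := by
  obtain ⟨UL, ul, rfl, hU2, hU3, hU4, hU5⟩ := hU
  obtain ⟨⟨qv, AL', h1, h2, h3⟩, h4⟩ := for_nat (l := var 9) (a := .pair (var 0) (var 2))
    (s := letIn (call₂ split (.comp .hd (var 0)) (var 3) (drop 5))
      (.pair (call₂ bivFn.add (.comp .hd (var 1)) (var 6) (drop 12))
        (.ite (var 0) (.pair (var 0) (.comp .tl (var 1))) (.comp .tl (var 1)))))
    (x := .cons hv (.cons (encList UL) (.cons (encList AL) Γ.val)))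
    (B := tsplit k b + bivFn.t b + 120)
    (fun i acc => ∃ qv AL', acc = .cons qv (encList AL') ∧
      brep γ b qv (comb p c g (χ + fun _ => (i : ZMod p))) ∧
      List.Forall₂ (BlockRel γ c g b (k + b ^ 3)) AL' (pieces χ S i ++ SS)) (k := p) rfl
    ⟨hv, AL, by simp, by
      rw [show (χ + fun _ => ((0 : ℕ) : ZMod p)) = χ by ext; simp]
      exact hχ, by simpa [pieces] using hA⟩ (by
      rintro i hi _ ⟨qv, AL', rfl, h2, h3⟩
      obtain ⟨⟨L', l', h4, h5, h6, h7, h8⟩, h9⟩ := split_spec Γ h2 hU2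
      have hB : BlockRel γ c g b (k + b ^ 3) (encList L') {j ∈ S | χ j + i = 0} := by
        refine ⟨L', l', rfl, h5, by omega, h7, ?_⟩
        ext x
        rw [h8, hU5]
        exact H.mem_split_iff Γ.hft Γ.hfn _ S x
      have h10 : comb p c g (χ + fun _ => ((i : ℕ) : ZMod p)) + derivative f =
          comb p c g (χ + fun _ => ((i + 1 : ℕ) : ZMod p)) := by
        rw [← H.comb_one (p := p), ← map_add]
        congr 1
        ext j
        simp [add_assoc]
      obtain ⟨h11, h12⟩ := (bivFn_spec γ).add Γ.hb h2 Γ.hd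
      rw [h10] at h11
      have h13 := (tsplit_mono (b := b) hU3)
      obtain ⟨y, hy⟩ : ∃ y, y = Val.cons (encList L') (.cons (.cons qv (encList AL'))
        (.cons .nil (.cons hv (.cons (encList UL) (.cons (encList AL) Γ.val))))) := ⟨_, rfl⟩
      have h14 : eval (call₂ bivFn.add (.comp .hd (var 1)) (var 6) (drop 12)) y =
          bivFn.add.eval (.cons qv (.cons Γ.dv (encField γ))) := by
        simp [hy, Ctx.val]
      have h15 : cost (call₂ bivFn.add (.comp .hd (var 1)) (var 6) (drop 12)) y ≤
          bivFn.t b + 40 := by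
        simp [hy, Ctx.val]
        omega
      have h16 := hB.ne_nil_iff H
      simp only [eval_letIn, cost_letIn, eval_call₂, Fn.eval_comp, eval_var_zero_cons, eval_hd,
        hd_cons, eval_var_succ_cons, eval_drop_succ_cons, eval_drop_zero, h4, cost_call₂, cost_comp,
        cost_var, cost_hd, cost_drop]
      rw [← hy]
      rw [eval_pair, cost_pair, h14]
      by_cases hT : ({j ∈ S | χ j + i = 0} : Finset (Fin s)).Nonempty
      · have hc : eval (var 0) y ≠ .nil := by
          rw [hy]
          simpa using h16.mpr hT
        rw [eval_ite_ne _ _ hc, cost_ite_ne _ _ hc]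
        refine ⟨⟨_, encList L' :: AL', by simp [hy], h11, ?_⟩, ?_⟩
        · rw [pieces, if_pos hT]
          exact .cons hB h3
        · simp [hy] at h15 ⊢
          omega
      · have hc : eval (var 0) y = .nil := by
          rw [hy]
          simpa using not_imp_comm.mp h16.mp hT
        rw [eval_ite_nil _ _ hc, cost_ite_nil _ _ hc]
        refine ⟨⟨_, AL', by simp [hy], h11, ?_⟩, ?_⟩
        · rwa [pieces, if_neg hT]
        · simp [hy] at h15 ⊢
          omega)
  refine ⟨⟨AL', by simp only [splitAll, Fn.eval_comp, h1, eval_tl, tl_cons], h3⟩, ?_⟩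
  have hpb : p ≤ b := by have := Γ.hb; omega
  have h5 : p * (tsplit k b + bivFn.t b + 120 + 9) ≤ b * (tsplit k b + bivFn.t b + 150) :=
    Nat.mul_le_mul hpb (by omega)
  rw [splitAll, cost_comp, cost_tl, tsplitAll]
  simp only [cost_var, cost_pair] at h4
  omega

/-- The elements whose coefficients are constant on `S`. -/
noncomputable def constSub (p : ℕ) [Fact p.Prime] {F : Type u} [Field F] [Algebra (ZMod p) F]
    {s : ℕ} (c : F[X]) (g : Fin s → F[X][X]) (S : Finset (Fin s)) :
    Submodule (ZMod p) F[X][X] :=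
  Submodule.map (comb p c g)
    { carrier := {χ | ∀ i ∈ S, ∀ j ∈ S, χ i = χ j}
      add_mem' := fun ha hb i hi j hj => congrArg₂ (· + ·) (ha i hi j hj) (hb i hi j hj)
      zero_mem' := fun _ _ _ _ => rfl
      smul_mem' := fun r _ ha i hi j hj => congrArg (r * ·) (ha i hi j hj) }

omit H in
lemma mem_constSub {S : Finset (Fin s)} {x : F[X][X]} : x ∈ constSub p c g S ↔
    ∃ χ : Fin s → ZMod p, (∀ i ∈ S, ∀ j ∈ S, χ i = χ j) ∧ comb p c g χ = x := Iff.rfl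

omit H in
lemma constSub_anti {S T : Finset (Fin s)} (h : T ⊆ S) : constSub p c g S ≤ constSub p c g T := by
  rintro x ⟨χ, h1, rfl⟩
  exact ⟨χ, fun i hi j hj => h1 i (h hi) j (h hj), rfl⟩

/-- Replacing each block by its level sets preserves the partition and makes the coefficients of the
current element constant on every block. -/
lemma refineF_spec {hv : Val} {χ : Fin s → ZMod p} (hχ : brep γ b hv (comb p c g χ)) {k : ℕ}
    (hs : s ≤ b) {BL : List Val} {SS : List (Finset (Fin s))}
    (hB : List.Forall₂ (BlockRel γ c g b k) BL SS) (hSS : IsPartition SS) :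
    (∃ BL' SS', refineF.eval (.cons hv (.cons (encList BL) Γ.val)) = encList BL' ∧
      List.Forall₂ (BlockRel γ c g b (k + b ^ 3)) BL' SS' ∧ IsPartition SS' ∧
      ∀ T ∈ SS', comb p c g χ ∈ constSub p c g T ∧ ∃ S ∈ SS, T ⊆ S) ∧
    refineF.cost (.cons hv (.cons (encList BL) Γ.val)) ≤ trefine k b := by
  obtain ⟨⟨AL, SA, SR, h1, h2, h3, h4, h5, h6, -⟩, h7⟩ := for_inv (l := var 1) (a := .nil)
    (s := call₃ splitAll (var 2) (var 1) (var 0) (drop 4))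
    (x := .cons hv (.cons (encList BL) Γ.val)) (B := tsplitAll k b + 35)
    (fun Lr acc => ∃ AL SA SR, acc = encList AL ∧
      List.Forall₂ (BlockRel γ c g b (k + b ^ 3)) AL SA ∧
      List.Forall₂ (BlockRel γ c g b k) Lr SR ∧ (∀ T ∈ SA, T.Nonempty) ∧
      (∀ i, SA.countP (i ∈ ·) + SR.countP (i ∈ ·) = 1) ∧
      (∀ T ∈ SA, comb p c g χ ∈ constSub p c g T ∧ ∃ S ∈ SS, T ⊆ S) ∧ ∀ S ∈ SR, S ∈ SS)
    (L := BL) (by simp) ⟨[], [], SS, by simp, by simp, hB, by simp, by simpa using hSS.2, by simp,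
      by simp⟩ (by
      rintro U Lr _ ⟨AL, SA, SR, rfl, h2, h3, h4, h5, h6, h7⟩
      cases h3 with
      | @cons _ S _ SR hU h3 =>
      obtain ⟨⟨AL', h8, h9⟩, h10⟩ := splitAll_spec H Γ hχ hU h2
      refine ⟨⟨AL', pieces χ S p ++ SA, SR, by simp [h8], h9, h3, ?_, ?_, ?_, ?_⟩, ?_⟩
      · intro T hT
        rcases List.mem_append.mp hT with hT | hT
        · exact (mem_pieces hT).1
        · exact h4 T hT
      · intro i
        rw [← h5 i, List.countP_append, List.countP_cons, countP_pieces _ _ _ le_rfl]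
        simp only [ZMod.val_lt, and_true, decide_eq_true_eq]
        ring
      · intro T hT
        rcases List.mem_append.mp hT with hT | hT
        · obtain ⟨-, h11, h12⟩ := mem_pieces hT
          exact ⟨mem_constSub.mpr ⟨χ, h12, rfl⟩, S, h7 S (by simp), h11⟩
        · exact h6 T hT
      · exact fun T hT => h7 T (by simp [hT])
      · simp
        omega)
  cases h3
  refine ⟨⟨AL, SA, h1, h2, ⟨h4, by simpa using h5⟩, h6⟩, h7.trans ?_⟩
  have h8 : BL.length ≤ b := by
    rw [hB.length_eq]
    exact hSS.length_le.trans hs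
  have h9 : BL.length * (tsplitAll k b + 35 + 9) ≤ b * (tsplitAll k b + 50) :=
    Nat.mul_le_mul h8 (by omega)
  rw [trefine]
  simp only [cost_var, cost_nil]
  omega

/-- The generators span all combinations, so two distinct indices are separated by one of them;
after refining by all of them no block contains two indices. -/
lemma refineAll_spec {NL : List Val} {nl : List F[X][X]}
    (hN : List.Forall₂ (brep γ b) NL nl) (hNl : NL.length ≤ b ^ 3)
    (hNs : lspan (ZMod p) nl = blockSub p c g Finset.univ) 
    (hs : s ≤ b) {BL : List Val} {SS : List (Finset (Fin s))}
    (hB : List.Forall₂ (BlockRel γ c g b (b ^ 3)) BL SS) (hSS : IsPartition SS) :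
    (∃ (BL' : List Val) (idx : List (Fin s)) (k : ℕ), refineAll.eval (.cons (encList NL) (.cons (encList BL) Γ.val)) = encList BL' ∧
      List.Forall₂ (BlockRel γ c g b k) BL' (idx.map ({·})) ∧ idx.Nodup ∧ ∀ i, i ∈ idx) ∧
    refineAll.cost (.cons (encList NL) (.cons (encList BL) Γ.val)) ≤ trefineAll b := by
  have hb3 : b ^ 3 * 1 ≤ b ^ 3 * b ^ 3 :=
    Nat.mul_le_mul_left _ (Nat.pos_of_ne_zero (by have := Γ.two_le; positivity))
  obtain ⟨⟨BL', SS', nd, nr, h1, h2, h3, h4, h5, h6⟩, h7⟩ := for_inv (l := var 0) (a := var 1)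
    (s := call₂ refineF (var 1) (var 0) (drop 4))
    (x := .cons (encList NL) (.cons (encList BL) Γ.val)) (B := trefine (b ^ 3 * b ^ 3) b + 30)
    -- Lists of generators grow by at most `b ^ 3` per refinement, the number of multiples of `f` in
    -- the system. The growth is additive, hence polynomial over at most `b ^ 3` rounds.
    (fun Lr acc => ∃ BL SS nd nr, acc = encList BL ∧
      List.Forall₂ (BlockRel γ c g b ((nd.length + 1) * b ^ 3)) BL SS ∧ IsPartition SS ∧
      List.Forall₂ (brep γ b) Lr nr ∧ nl = nd ++ nr ∧
      ∀ S ∈ SS, ∀ x ∈ nd, x ∈ constSub p c g S)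
    (L := NL) (by simp) ⟨BL, SS, [], nl, by simp, by simpa using hB, hSS, hN, by simp, by simp⟩ (by
      rintro hv Lr _ ⟨BL, SS, nd, nr, rfl, h2, h3, h4, h5, h6⟩
      cases h4 with
      | @cons _ x _ nr hx h4 =>
      have hxm : x ∈ blockSub p c g Finset.univ := by
        rw [← hNs]
        exact mem_lspan (by simp [h5])
      obtain ⟨χ, -, rfl⟩ := mem_blockSub.mp hxm
      obtain ⟨⟨BL', SS', h7, h8, h9, h10⟩, h11⟩ := refineF_spec H Γ hx hs h2 h3
      have hl : nd.length + 1 ≤ b ^ 3 := by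
        have := hN.length_eq
        rw [h5] at this
        simp only [List.length_append, List.length_cons] at this
        omega
      have h12 : trefine ((nd.length + 1) * b ^ 3) b ≤ trefine (b ^ 3 * b ^ 3) b :=
        trefine_mono (Nat.mul_le_mul_right _ hl)
      refine ⟨⟨BL', SS', nd ++ [comb p c g χ], nr, by simp [h7], ?_, h9, h4, by simp [h5], ?_⟩, ?_⟩
      · convert h8 using 2
        simp
        ring
      · intro T hT x hx
        obtain ⟨h13, S, hS, hTS⟩ := h10 T hT
        rcases List.mem_append.mp hx with hx | hx
        · exact constSub_anti hTS (h6 S hS x hx)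
        · rw [List.mem_singleton.mp hx]
          exact h13
      · simp
        omega)
  cases h4
  rw [List.append_nil] at h5
  subst h5
  obtain ⟨idx, rfl, h8, h9⟩ := h3.exists_list (by
    intro S hS i hi j hj
    -- Being constant on `S` passes from the generators to their span, which contains the
    -- combination equal to `1` at `i` and `0` elsewhere.
    have h10 : blockSub p c g Finset.univ ≤ constSub p c g S := by
      rw [← hNs]
      exact lspan_le.mpr (h6 S hS)
    by_contra hij
    obtain ⟨χ, h11, h12⟩ := mem_constSub.mp (h10 (mem_blockSub.mpr
      ⟨Pi.single i 1, fun _ h => absurd (Finset.mem_univ _) h, rfl⟩))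
    have h13 := h11 i hi j hj
    rw [H.comb_injective h12, Pi.single_eq_same, Pi.single_eq_of_ne (Ne.symm hij)] at h13
    exact one_ne_zero h13)
  refine ⟨⟨BL', idx, _, h1, h2, h8, h9⟩, h7.trans ?_⟩
  have h10 : NL.length * (trefine (b ^ 3 * b ^ 3) b + 30 + 9) ≤
      b ^ 3 * (trefine (b ^ 3 * b ^ 3) b + 50) := Nat.mul_le_mul hNl (by omega)
  rw [trefineAll]
  simp only [cost_var]
  omega

end refinement
end FactorFqt


namespace FactorFqt
open Fn

/-! ### The factors -/

/-- A nonzero solution `w` of `e w + f z = 0` in the span of the second argument and the elements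
of the third argument, where `e` is the first argument. -/
def trySolve : Fn :=
  .comp .hd (call₂ (solve .id) (var 6)
    (.pair (.pair (call₃ bflat (call₂ bmul (var 0) (var 1) (drop 9)) (.pair (.pair .nil .nil) .nil)
        (var 5) (drop 9)) (var 1))
      (call₂ revApp (call₂ (mapF (gen bmul (var 1))) (.pair (var 0) (var 5)) (var 2) (drop 9))
        (var 4) .nil)) (drop 9))

/-- The time of `trySolve`. -/
def ttry (b : ℕ) : ℕ :=
  tsolve (bnum (b * b)) (b ^ 3 + b ^ 3 + 1) b +
    (b ^ 3 + 1) * (tbmul (b + b) + tbflat (b * b) + 250) + 300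

section extraction
variable {p m : ℕ} [hp : Fact p.Prime] {F : Type u} [Field F] [Algebra (ZMod p) F]
  {γ : Module.Basis (Fin m) (ZMod p) F} {s : ℕ} {c : F[X]} {g : Fin s → F[X][X]}
  {f : F[X][X]} (H : IsFactorData f c g) {b : ℕ} (Γ : Ctx γ f b)
include H

/-- The solutions have the form `a' ℓ_f X ^ k + w` with `w` of degree `< k`, and they are multiples
of `g_i`. Below the degree of `g_i` there is none; at that degree all are multiples of `outFactor c
g i`. The scalar `a'` is recorded so that it can be divided out later. -/
lemma trySolve_spec {i : Fin s} {a : ZMod p} (ha : a ≠ 0) {ev xv : Val}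
    (he : brep γ b ev (a • logDer c g i)) {k : ℕ} (hk : k ≤ (g i).natDegree)
    (hx : brep γ b xv (C f.leadingCoeff * X ^ k)) {WL : List Val} {wl : List F[X][X]}
    (hW : List.Forall₂ (brep γ b) WL wl) (hWl : WL.length ≤ b ^ 3)
    (hWs : lspan (ZMod p) wl = box p F k b) :
    ((k < (g i).natDegree →
        trySolve.eval (.cons ev (.cons xv (.cons (encList WL) Γ.val))) = .nil) ∧
      (k = (g i).natDegree → ∃ a' : ZMod p, a' ≠ 0 ∧ prep p (brep γ) (bnum (b * b) + 1) b
        (trySolve.eval (.cons ev (.cons xv (.cons (encList WL) Γ.val))))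
        (C a', a' • outFactor c g i))) ∧
    trySolve.cost (.cons ev (.cons xv (.cons (encList WL) Γ.val))) ≤ ttry b := by
  set q := a • logDer c g i with hq
  obtain ⟨⟨L₁, h1, h2, h3⟩, h4⟩ := gen_spec γ (op := bmul) (keep := var 1) Γ.hbM
    (φ := LinearMap.mulLeft (ZMod p) q) (ψ := LinearMap.id) (t := tbmul (b + b)) (u := ev)
    (fun v x hv => Γ.mul_spec he hv) (fun a v x hv => ⟨by simpa using hv, by simp⟩) hW
  obtain ⟨h5, h6⟩ := Γ.mul_spec he hx
  -- The single coordinate `1` behind those of the product marks the coefficient of the leading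
  -- term.
  obtain ⟨h7, h8⟩ := (bflat_spec γ).eval Γ.hbM h5
    (ListRep.cons (n := 0) (a := encNat 1) (x := (1 : ZMod p)) (r := srep p) (v := .nil) (y := 0)
      (by rw [srep, ZMod.val_one]) (.nil 0))
  have hmono : ∀ v x, prep p (brep γ) (bnum (b * b)) b v x →
      prep p (brep γ) (bnum (b * b) + 1) b v x :=
    fun v x hv => ⟨hv.1.mono (Nat.le_succ _) fun _ _ h => h, hv.2⟩
  obtain ⟨y, hy⟩ : ∃ y, y = Val.cons (bflat.eval (.cons (bmul.eval (.cons ev (.cons xv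
      (encField γ)))) (.cons (.cons (encNat 1) .nil) (.cons (encNat (b * b)) (encField γ))))) xv :=
    ⟨_, rfl⟩
  have hL : List.Forall₂ (prep p (brep γ) (bnum (b * b) + 1) b) (y :: (L₁.reverse ++ Γ.ZL))
      ((bcoord γ (b * b) (LinearMap.mulLeft (ZMod p) q (C f.leadingCoeff * X ^ k)) +
          X ^ bnum (b * b), C f.leadingCoeff * X ^ k) ::
        (wl.reverse.map ((bcoord γ (b * b) ∘ₗ LinearMap.mulLeft (ZMod p) q).prod LinearMap.id) ++
        Γ.lz.map ((bcoord γ (b * b) ∘ₗ LinearMap.mulLeft (ZMod p) f).prod 0))) := by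
    refine .cons ?_ ((List.rel_append ?_ Γ.hZ).imp hmono)
    · rw [hy]
      exact ⟨by simpa using h7, hx, by simp⟩
    · rw [List.map_reverse]
      exact List.rel_reverse h2
  have hc := comap_solutions_cons γ (φ := LinearMap.mulLeft (ZMod p) q)
    (ψ := LinearMap.mulLeft (ZMod p) f) Γ.hbM (x₀ := C f.leadingCoeff * X ^ k) (l := wl.reverse)
    (lz := Γ.lz) ⟨_, h5⟩ (fun x hx => Γ.mul_mem hW he x (List.mem_reverse.mp hx)) Γ.hZr
  simp only [lspan_reverse, hWs, Γ.hZs] at hc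
  have hdvd : ∀ x : F[X][X], (∃ z ∈ box p F b b, q * x + f * z = 0) → g i ∣ x := by
    rintro x ⟨z, -, hz⟩
    rw [← H.dvd_logDer_mul]
    have h9 : f ∣ q * x := ⟨-z, by rw [eq_neg_of_add_eq_zero_left hz]; ring⟩
    have h10 := dvd_smul_of_dvd a⁻¹ h9
    rwa [hq, smul_mul_assoc, smul_smul, inv_mul_cancel₀ ha, one_smul] at h10
  have hpK : p ≤ bnum (b * b) + 1 := by
    have h5 := Γ.hbM
    have h0 : 0 < b * b := Nat.mul_pos (by have := Γ.two_le; omega) (by have := Γ.two_le; omega)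
    have h6 : b * b * 1 ≤ b * b * (b * b * (b * b * 1)) := Nat.mul_le_mul_left _
      (Nat.mul_pos h0 (Nat.mul_pos h0 one_pos))
    rw [bnum]
    omega
  obtain ⟨⟨L', l', h9, h10, h11, h12, h13⟩, h14⟩ := solve_spec γ (keep := .id)
    (rep := prep p (brep γ) (bnum (b * b) + 1) b) (κ := LinearMap.id) le_rfl Γ.hb hpK
    (fun v x hv => ⟨hv, by simp⟩) hL (by
      intro x hx h0
      obtain ⟨a', ha', w, hw, h15, -⟩ := (hc x).mp hx
      rw [h0] at h15
      have h16 := IsFactorData.coeff_top (f := f) a' hw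
      rw [← h15, coeff_zero, eq_comm, smul_eq_zero] at h16
      have h17 := h16.resolve_right (leadingCoeff_ne_zero.mpr H.f_ne_zero)
      exact Prod.ext (by rw [ha', h17, C_0]; rfl) h0)
  have e : trySolve.eval (.cons ev (.cons xv (.cons (encList WL) Γ.val))) = (encList L').hd := by
    rw [← h9, hy]
    simp [trySolve, Ctx.val, h1, revApp_eval, encNat_succ]
  have hsol : ∀ x ∈ l', ∃ a' : ZMod p, x.1 = C a' ∧ ∃ w ∈ box p F k b,
      x.2 = a' • (C f.leadingCoeff * X ^ k) + w ∧ g i ∣ x.2 := by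
    intro x hx
    have h15 := mem_lspan (k := ZMod p) hx
    rw [h13] at h15
    obtain ⟨a', h16, w, hw, h17, h18⟩ := (hc x).mp h15
    exact ⟨a', h16, w, hw, h17, hdvd _ h18⟩
  refine ⟨⟨fun hlt => ?_, ?_⟩, ?_⟩
  · rw [e]
    cases l' with
    | nil =>
      rw [List.map_nil, List.forall₂_nil_right_iff] at h10
      rw [h10]
      rfl
    | cons x l' =>
      exfalso
      obtain ⟨a', h16, w, hw, h17, h18⟩ := hsol x (by simp)
      rw [h17] at h18
      obtain ⟨h19, h20⟩ := H.eq_zero_of_dvd_top hlt a' hw h18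
      exact h12 x (by simp) (by rw [h17, h19, h20, zero_smul, add_zero])
  · rintro rfl
    rw [e]
    cases l' with
    | nil =>
      exfalso
      obtain ⟨w, hw, z, hz, h15, h16⟩ := H.exists_top (i := i) Γ.hft Γ.hfn a
      have h17 : ((C 1, outFactor c g i) : (ZMod p)[X] × F[X][X]) ∈ lspan (ZMod p)
          ([] : List ((ZMod p)[X] × F[X][X])) := by
        rw [h13, hc]
        exact ⟨1, rfl, w, hw, by rw [one_smul, h15], z, hz, h16⟩
      rw [lspan_nil, Submodule.mem_bot] at h17
      exact H.outFactor_ne_zero i (congrArg Prod.snd h17)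
    | cons x l' =>
      obtain ⟨a', h16, w, hw, h17, h18⟩ := hsol x (by simp)
      have h19 := h17
      rw [H.eq_smul_of_dvd_top a' hw (h17 ▸ h18)] at h19
      cases h10 with
      | @cons v _ L' _ hv _ =>
      refine ⟨a', ?_, ?_⟩
      · rintro rfl
        rw [zero_smul] at h19
        exact h12 x (by simp) h19
      · rw [← h16, ← h19]
        exact hv
  · have hZl := Γ.hZl
    simp only [List.length_cons, List.length_append, List.length_reverse, h3] at h14
    have h15 := tsolve_mono (K := bnum (b * b)) (b := b)
      (show WL.length + Γ.ZL.length + 1 ≤ b ^ 3 + b ^ 3 + 1 by omega)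
    have h16 := revApp_cost L₁ (encList Γ.ZL) .nil
    rw [h3] at h16
    have h17 : (b ^ 3 + 1) * (tbmul (b + b) + tbflat (b * b) + 250) =
      b ^ 3 * (tbmul (b + b) + tbflat (b * b) + 200) + b ^ 3 * 50 +
        (tbmul (b + b) + tbflat (b * b) + 250) := by ring
    have h18 : WL.length * (tbmul (b + b) + tbflat (b * b) + 200) ≤
      b ^ 3 * (tbmul (b + b) + tbflat (b * b) + 200) := Nat.mul_le_mul_right _ hWl
    have e1 : encNat 1 = .cons .nil .nil := rfl
    rw [hy] at h14
    rw [e1] at h14 h8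
    rw [ttry]
    simp [trySolve, Ctx.val, h1, revApp_eval] at h14 ⊢
    omega

end extraction
end FactorFqt


/-! ### From a singleton block to the normalized factor -/

namespace FactorFqt
open Fn

/-- The factor which belongs to a block with one element, given as second argument. -/
def facF : Fn :=
  letIn (.comp .tl (.comp .tl (for_ (var 7)
      (.pair .nil (.pair (.pair (for_ (var 7) .nil (var 1)) .nil) .nil))
      (.ite (.comp .tl (.comp .tl (var 0))) (var 0)
        (.pair (.pair .nil (.comp .hd (var 0)))
          (.pair (.pair .nil (.comp .hd (.comp .tl (var 0))))
            (call₃ trySolve (.comp .hd (var 3)) (.comp .hd (.comp .tl (var 0)))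
              (call₂ monos (.comp .hd (var 0)) (var 8) .nil) (drop 4))))))))
    (call₁ bnorm (for_ (.comp .tl (.comp .tl (var 9))) (.comp .tl (var 0))
      (call₂ bivFn.scale (.comp .hd (.comp .hd (var 2))) (var 0) (drop 11))) (drop 9))

/-- The time of `facF`. -/
def tfac (b : ℕ) : ℕ :=
  b * (ttry b + tmonos b (b * b) + 200) + b * (bivFn.t b + 100) + b * 50 + tbnorm b + 300

lemma encPoly_rep {R : Type u} [CommRing R] {r : Val → R → Prop} {enc : R → Val}
    {x : R[X]} (h : ∀ i, r (enc (x.coeff i)) (x.coeff i)) {b : ℕ} (hb : x.natDegree < b) :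
    ListRep r b (encPoly enc x) x :=
  ⟨_, rfl, by simpa using hb, .of_coeff (fun i hi => by simpa using h i)
    fun i hi => coeff_eq_zero_of_natDegree_lt (by simpa using hi)⟩

lemma foldV_last {R : Type u} [Semiring R] (enc : R → Val) (x : R[X]) (a : Val) :
    foldV (fun _ z => z) (encPoly enc x) a = enc x.leadingCoeff := by
  rw [encPoly, List.range_succ, List.map_append, foldV_append]
  simp

section output
variable {p m : ℕ} [hp : Fact p.Prime] {F : Type u} [Field F] [Algebra (ZMod p) F]
  {γ : Module.Basis (Fin m) (ZMod p) F} 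

lemma brep_encBiv {f : F[X][X]} {b : ℕ} (hn : f.natDegree < b) (ht : tdeg f < b) :
    brep γ b (encBiv γ f) f :=
  encPoly_rep (fun i => encPoly_rep (fun _ => frep_encScalar γ b _)
    ((tdeg_le_iff.mp le_rfl i).trans_lt ht)) hn

variable {s : ℕ} {c : F[X]} {g : Fin s → F[X][X]}
  {f : F[X][X]} (H : IsFactorData f c g) {b : ℕ} (Γ : Ctx γ f b)

include H in
-- The space of a singleton block is a line, so the first listed generator is a nonzero multiple of
-- `logDer c g i`.
lemma BlockRel.exists_smul {k : ℕ} {v : Val} {i : Fin s} (h : BlockRel γ c g b k v {i}) :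
    ∃ a : ZMod p, a ≠ 0 ∧ brep γ b v.hd (a • logDer c g i) := by
  have h0 := (h.ne_nil_iff H).mpr (by simp)
  obtain ⟨L, l, rfl, h2, h3, h4, h5⟩ := h
  cases h2 with
  | nil => simp at h0
  | @cons a x L l h h2 =>
    have hx : x ∈ blockSub p c g {i} := h5 ▸ mem_lspan (by simp)
    obtain ⟨χ, h6, rfl⟩ := mem_blockSub.mp hx
    have h7 : comb p c g χ = χ i • logDer c g i := by
      rw [comb_apply]
      refine Finset.sum_eq_single i (fun j _ hj => ?_) (by simp)
      rw [h6 j (by simpa using hj), zero_smul]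
    refine ⟨χ i, fun h8 => h4 (comb p c g χ) (by simp) (by rw [h7, h8, zero_smul]), ?_⟩
    rw [← h7]
    simpa using h

/-- Multiplying `p - 2` more times by the recorded scalar `a` divides by it, since `a ^ (p - 1) =
1`. -/
lemma scale_spec {res : Val} {a : ZMod p} (ha : a ≠ 0) {x : F[X][X]} (hb : p + m ≤ b) {n : ℕ}
    (h : prep p (brep γ) n b res (C a, a • x)) {a₁ a₂ a₃ a₄ a₅ a₆ a₇ a₈ : Val} :
    (call₁ bnorm (for_ (.comp .tl (.comp .tl (var 9))) (.comp .tl (var 0))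
      (call₂ bivFn.scale (.comp .hd (.comp .hd (var 2))) (var 0) (drop 11))) (drop 9)).eval
        (.cons res (.cons a₁ (.cons a₂ (.cons a₃ (.cons a₄ (.cons a₅ (.cons a₆ (.cons a₇
          (.cons a₈ (encField γ)))))))))) = encBiv γ x ∧
    (call₁ bnorm (for_ (.comp .tl (.comp .tl (var 9))) (.comp .tl (var 0))
      (call₂ bivFn.scale (.comp .hd (.comp .hd (var 2))) (var 0) (drop 11))) (drop 9)).cost
        (.cons res (.cons a₁ (.cons a₂ (.cons a₃ (.cons a₄ (.cons a₅ (.cons a₆ (.cons a₇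
          (.cons a₈ (encField γ)))))))))) ≤ b * (bivFn.t b + 100) + tbnorm b + 150 := by
  have hE : ∀ k, (var k).eval (encField γ) = (var k).eval (.cons (encNat p) (encField γ).tl) :=
    fun k => rfl
  have h1 : res.hd.hd = encNat a.val := by
    have := h.1.hd srep_zero
    rwa [coeff_C_zero] at this
  obtain ⟨h2, h3⟩ := for_nat (l := .comp .tl (.comp .tl (var 9))) (a := .comp .tl (var 0))
    (s := call₂ bivFn.scale (.comp .hd (.comp .hd (var 2))) (var 0) (drop 11))
    (x := .cons res (.cons a₁ (.cons a₂ (.cons a₃ (.cons a₄ (.cons a₅ (.cons a₆ (.cons a₇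
          (.cons a₈ (encField γ)))))))))) (B := bivFn.t b + 50)
    (fun i acc => brep γ b acc (a ^ (i + 1) • x)) (k := p - 1 - 1)
    (by simp [hE, tl_encNat]) (by simpa using h.2.1) (by
      intro i hi acc hacc
      obtain ⟨h2, h3⟩ := (bivFn_spec γ).scale a hb hacc
      refine ⟨?_, ?_⟩
      · rw [smul_smul, ← pow_succ'] at h2
        simpa [h1] using h2
      · simp [h1]
        omega)
  have hp2 := hp.out.two_le
  rw [show p - 1 - 1 + 1 = p - 1 by omega, ZMod.pow_card_sub_one_eq_one ha, one_smul] at h2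
  obtain ⟨h4, h5⟩ := bnorm_spec γ b _ _ hb h2
  refine ⟨by simpa using h4, ?_⟩
  have h6 : (p - 1 - 1) * (bivFn.t b + 50 + 9) ≤ b * (bivFn.t b + 100) :=
    Nat.mul_le_mul (by omega) (by omega)
  rw [cost_call₁]
  simp [-cost_for, -eval_for] at h3 h5 ⊢
  omega

include H in
-- The degrees `0, 1, …, n` are tried in turn, one per coefficient of `f`; this suffices because
-- `g_i` has degree at most `n`. The leading coefficient `ℓ_f` is the last entry of the list for
-- `f`.
lemma facF_spec {k : ℕ} {a U : Val} {i : Fin s} (h : BlockRel γ c g b k U {i}) :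
    facF.eval (.cons a (.cons U Γ.val)) = encBiv γ (outFactor c g i) ∧
    facF.cost (.cons a (.cons U Γ.val)) ≤ tfac b := by
  obtain ⟨a₀, ha₀, hU⟩ := h.exists_smul H
  have hd : (g i).natDegree ≤ f.natDegree :=
    natDegree_le_of_dvd (H.dvd i) H.f_ne_zero
  obtain ⟨L, hL⟩ := exists_encList Γ.fv
  have hLn : L.length = f.natDegree + 1 := by
    have := encList_injective (hL.symm.trans Γ.hfv)
    rw [this]
    simp
  have hft := Γ.hft
  have hfn := Γ.hfn
  have hl : (for_ (var 7) .nil (var 1)).eval (.cons a (.cons U Γ.val)) =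
      encPoly (encScalar γ) f.leadingCoeff := by
    simp only [eval_for, Ctx.val, eval_var_succ_cons, eval_var_zero_cons, Γ.hfv]
    exact foldV_last _ _ _
  have hlc : ((for_ (var 7) .nil (var 1)).cost (.cons a (.cons U Γ.val))) ≤ b * 50 + 50 := by
    obtain ⟨-, h⟩ := for_inv (l := var 7) (a := .nil) (s := var 1)
      (x := .cons a (.cons U Γ.val)) (B := 3) (L := L) (fun _ _ => True)
      (by simp [Ctx.val, hL]) trivial (fun _ _ _ _ => ⟨trivial, by simp⟩)
    refine h.trans ?_
    simp
    omega
  have hlr : liftRep (frep γ) b (encPoly (encScalar γ) f.leadingCoeff) f.leadingCoeff :=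
    encPoly_rep (fun _ => frep_encScalar γ b _) ((tdeg_le_iff.mp le_rfl _).trans_lt hft)
  obtain ⟨⟨j, h1, h2⟩, h3⟩ := for_inv (l := var 7)
    (a := .pair .nil (.pair (.pair (for_ (var 7) .nil (var 1)) .nil) .nil))
    (s := .ite (.comp .tl (.comp .tl (var 0))) (var 0)
        (.pair (.pair .nil (.comp .hd (var 0)))
          (.pair (.pair .nil (.comp .hd (.comp .tl (var 0))))
            (call₃ trySolve (.comp .hd (var 3)) (.comp .hd (.comp .tl (var 0)))
              (call₂ monos (.comp .hd (var 0)) (var 8) .nil) (drop 4)))))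
    (x := .cons a (.cons U Γ.val)) (B := ttry b + tmonos b (b * b) + 100) (L := L)
    -- Either nothing was found and the next degree `j` does not exceed that of `g_i`, or the result
    -- is already stored. In the end `j = n + 1` excludes the first case.
    (fun Lr acc => ∃ j, j + Lr.length = f.natDegree + 1 ∧
      ((j ≤ (g i).natDegree ∧ ∃ xv, acc = .cons (encNat j) (.cons xv .nil) ∧
        ListRep (liftRep (frep γ) b) (j + 1) xv (C f.leadingCoeff * X ^ j)) ∨
      ∃ a' : ZMod p, a' ≠ 0 ∧ prep p (brep γ) (bnum (b * b) + 1) b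
        acc.tl.tl (C a', a' • outFactor c g i)))
    (by simp [Ctx.val, hL])
    ⟨0, by simpa using hLn, .inl ⟨Nat.zero_le _, _, by rw [eval_pair, eval_pair, eval_pair, hl]; rfl,
      by simpa using ListRep.cons hlr (.nil 0)⟩⟩ (by
      rintro z Lr acc ⟨j, h1, h2⟩
      rw [List.length_cons] at h1
      rcases h2 with ⟨h2, xv, rfl, h3⟩ | ⟨a', h2, h4⟩
      · have hjb : j ≤ b := by omega
        obtain ⟨⟨WL, wl, h5, h6, h7, h8⟩, h9⟩ := monos_spec (p := p)
          ((fieldFn_spec γ).lift.zero b) Γ.hT j .nil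
        have h10 : tmonos j Γ.TL.length ≤ tmonos b (b * b) := by
          have := Γ.hTl
          unfold tmonos
          gcongr
        obtain ⟨⟨h11, h12⟩, h13⟩ := trySolve_spec H Γ ha₀ hU h2
          (h3.mono (by omega) fun _ _ h => h) (h6.imp fun _ _ h => h.mono hjb fun _ _ h => h)
          (by
            rw [h7, show b ^ 3 = b * (b * b) by ring]
            exact Nat.mul_le_mul hjb Γ.hTl) (by rw [h8, Γ.hTs]; rfl)
        have hc : eval (.comp .tl (.comp .tl (var 0)))
            (.cons (.cons (encNat j) (.cons xv .nil)) (.cons z (.cons a (.cons U Γ.val)))) =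
            .nil := by simp
        rw [eval_ite_nil _ _ hc, cost_ite_nil _ _ hc]
        refine ⟨⟨j + 1, by omega, ?_⟩, ?_⟩
        · have e : eval (call₃ trySolve (.comp .hd (var 3)) (.comp .hd (.comp .tl (var 0)))
            (call₂ monos (.comp .hd (var 0)) (var 8) .nil) (drop 4)) 
            (.cons (.cons (encNat j) (.cons xv .nil)) (.cons z (.cons a (.cons U Γ.val)))) =
            trySolve.eval (.cons U.hd (.cons xv (.cons (encList WL) Γ.val))) := by
            rw [← h5]
            simp [Ctx.val]
          rcases h2.lt_or_eq with h2 | h2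
          · refine .inl ⟨h2, .cons .nil xv, ?_, ?_⟩
            swap
            · have := h3.shift ((fieldFn_spec γ).lift.zero b)
              convert this using 1
              ring
            · simp only [eval_pair, e, h11 h2]
              simp [encNat_succ]
          · obtain ⟨a', h14, h15⟩ := h12 h2
            refine .inr ⟨a', h14, ?_⟩
            simp only [eval_pair, tl_cons, e]
            exact h15
        · rw [← h5] at h13
          simp [Ctx.val] at h9 h13 ⊢
          omega
      · have hc : eval (.comp .tl (.comp .tl (var 0)))
            (.cons acc (.cons z (.cons a (.cons U Γ.val)))) ≠ .nil := by simpa using h4.2.2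
        rw [eval_ite_ne _ _ hc, cost_ite_ne _ _ hc]
        exact ⟨⟨j + 1, by omega, .inr ⟨a', h2, by simpa using h4⟩⟩,
          by simp⟩)
  rw [List.length_nil, add_zero] at h1
  rcases h2 with ⟨h2, -⟩ | ⟨a', h2, h4⟩
  · omega
  obtain ⟨h5, h6⟩ := scale_spec h2 Γ.hb h4 (a₁ := a) (a₂ := U) (a₃ := Γ.dv) (a₄ := encList Γ.ZL)
    (a₅ := encNat (b * b)) (a₆ := encNat (bnum (b * b))) (a₇ := encList Γ.TL) (a₈ := Γ.fv)
  rw [facF, eval_letIn, cost_letIn]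
  refine ⟨h5, ?_⟩
  have h7 : L.length * (ttry b + tmonos b (b * b) + 100 + 9) ≤
    b * (ttry b + tmonos b (b * b) + 200) := Nat.mul_le_mul (by omega) (by omega)
  refine (Nat.add_le_add_left h6 _).trans ?_
  rw [tfac]
  simp only [cost_comp, cost_tl, cost_var, cost_pair, cost_nil] at h3 ⊢
  omega

end output
end FactorFqt


namespace FactorFqt
open Fn

/-! ### The size bound -/

/-- Adds the length of a list to a unary number. -/
def count (l a : Fn) : Fn := for_ l a (.pair .nil (var 0))

lemma count_spec {l a : Fn} {x : Val} {L : List Val} {k : ℕ} (hl : l.eval x = encList L)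
    (ha : a.eval x = encNat k) :
    (count l a).eval x = encNat (L.length + k) ∧
      (count l a).cost x ≤ l.cost x + a.cost x + L.length * 20 + 14 := by
  obtain ⟨⟨j, h1, h2⟩, h3⟩ := for_inv (l := l) (a := a) (s := .pair .nil (var 0)) (x := x) (B := 11)
    (fun Lr acc => ∃ j, j + Lr.length = L.length ∧ acc = encNat (j + k)) hl
    ⟨0, by simp, by simpa using ha⟩ (by
      rintro z Lr _ ⟨j, h1, rfl⟩
      rw [List.length_cons] at h1
      exact ⟨⟨j + 1, by omega, by simp [show j + 1 + k = j + k + 1 by omega, encNat_succ]⟩,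
        by simp⟩)
  rw [List.length_nil, add_zero] at h1
  subst h1
  exact ⟨h2, by simpa [count, add_assoc] using h3⟩

/-- The product of the unary numbers with indices `i` and `j`. -/
def umul (i j : ℕ) : Fn := for_ (var i) .nil (count (var (j + 2)) (var 0))

lemma umul_spec {i j : ℕ} {x : Val} {k l : ℕ} (hi : (var i).eval x = encNat k)
    (hj : (var j).eval x = encNat l) :
    (umul i j).eval x = encNat (k * l) ∧
      (umul i j).cost x ≤ k * (l * 20 + j + 40) + i + 20 := by
  obtain ⟨h1, h2⟩ := for_nat (l := var i) (a := .nil) (s := count (var (j + 2)) (var 0))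
    (x := x) (B := l * 20 + j + 20) (fun r acc => acc = encNat (r * l)) (k := k) hi (by simp) (by
      rintro r hr _ rfl
      obtain ⟨h1, h2⟩ := count_spec (l := var (j + 2)) (a := var 0)
        (x := .cons (encNat (r * l)) (.cons .nil x)) (L := List.replicate l .nil) (k := r * l)
        (by rw [eval_var_succ_cons, eval_var_succ_cons]; exact hj) (by simp)
      rw [List.length_replicate] at h1 h2
      refine ⟨by rw [h1]; congr 1; ring, h2.trans ?_⟩
      simp
      omega)
  refine ⟨h1, h2.trans ?_⟩
  have : k * (l * 20 + j + 20 + 9) ≤ k * (l * 20 + j + 40) := Nat.mul_le_mul_left _ (by omega)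
  simp
  omega

/-- A bound for the size of the polynomial given as first argument. -/
def sizeF : Fn :=
  for_ (var 0) (count (drop 2) (var 1)) (count (var 1) (.pair .nil (var 0)))

section size
variable {p m : ℕ} [hp : Fact p.Prime] {F : Type u} [Field F] [Algebra (ZMod p) F]
  (γ : Module.Basis (Fin m) (ZMod p) F)

/-- The bound is `p + m` plus, for each coefficient of `f`, its degree plus two: one for its number
of entries and one for itself. It can be computed by walking once over the input. -/
lemma sizeF_spec (f : F[X][X]) : ∃ b, p + m ≤ b ∧ f.natDegree < b ∧ tdeg f < b ∧
    b ≤ p + m + (f.natDegree + 1) * (tdeg f + 2) ∧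
    sizeF.eval (.cons (encBiv γ f) (encField γ)) = encNat b ∧
    sizeF.cost (.cons (encBiv γ f) (encField γ)) ≤ b * (b * 20 + 100) + 100 := by
  obtain ⟨cs, hcs⟩ : ∃ cs, cs = (List.range (f.natDegree + 1)).map f.coeff := ⟨_, rfl⟩
  obtain ⟨b, hb⟩ : ∃ b, b = p + m + (cs.map fun c => c.natDegree + 2).sum := ⟨_, rfl⟩
  have hle : ∀ c ∈ cs, c.natDegree + 2 ≤ (cs.map fun c => c.natDegree + 2).sum := fun c hc =>
    List.single_le_sum (fun _ _ => Nat.zero_le _) _ (List.mem_map_of_mem hc)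
  have hlen : cs.length = f.natDegree + 1 := by simp [hcs]
  have hsum : (cs.map fun c => c.natDegree + 2).sum ≤ (f.natDegree + 1) * (tdeg f + 2) := by
    have := List.sum_le_card_nsmul (cs.map fun c => c.natDegree + 2) (tdeg f + 2) (by
      simp only [hcs, List.map_map, List.mem_map]
      rintro _ ⟨i, -, rfl⟩
      exact Nat.add_le_add_right (tdeg_le_iff.mp le_rfl i) 2)
    simpa [hlen] using this
  have hsum' : cs.length ≤ (cs.map fun c => c.natDegree + 2).sum := by
    have := List.length_le_sum_of_one_le (cs.map fun c => c.natDegree + 2) (by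
      simp only [List.mem_map]
      rintro _ ⟨i, -, rfl⟩
      omega)
    simpa using this
  have hp1 := hp.out.two_le
  refine ⟨b, by omega, by omega, ?_, by omega, ?_⟩
  · have : tdeg f ≤ b - 1 := tdeg_le_iff.mpr fun i => by
      by_cases hi : i < f.natDegree + 1
      · have := hle (f.coeff i) (by
          rw [hcs]
          exact List.mem_map_of_mem (List.mem_range.mpr hi))
        omega
      · rw [coeff_eq_zero_of_natDegree_lt (by omega)]
        simp
    omega
  · have hE : encField γ = .cons (encNat p) (encList (List.ofFn fun i =>
      encList (List.ofFn fun j => encScalar γ (γ i * γ j)))) := rfl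
    obtain ⟨h1, h2⟩ := count_spec (l := drop 2) (a := var 1)
      (x := .cons (encBiv γ f) (encField γ)) (L := List.ofFn fun i =>
        encList (List.ofFn fun j => encScalar γ (γ i * γ j))) (k := p) (by simp [hE]) (by simp [hE])
    rw [List.length_ofFn] at h1 h2
    obtain ⟨⟨cr, k, h3, h4, h5, -⟩, h6⟩ := for_inv (l := var 0) (a := count (drop 2) (var 1))
      (s := count (var 1) (.pair .nil (var 0)))
      (x := .cons (encBiv γ f) (encField γ)) (L := cs.map (encPoly (encScalar γ)))
      (B := b * 20 + 50)
      (fun Lr acc => ∃ cr k, Lr = cr.map (encPoly (encScalar γ)) ∧ acc = encNat k ∧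
        k + (cr.map fun c => c.natDegree + 2).sum = b ∧ ∀ c ∈ cr, c ∈ cs)
      (by rw [hcs, List.map_map]; rfl) ⟨cs, _, rfl, h1, by omega, fun _ h => h⟩ (by
        rintro z Lr _ ⟨cr, k, h3, rfl, h4, h5⟩
        cases cr with
        | nil => simp at h3
        | cons c cr =>
        simp only [List.map_cons, List.cons.injEq, List.sum_cons] at h3 h4
        obtain ⟨rfl, rfl⟩ := h3
        obtain ⟨h6, h7⟩ := count_spec (l := var 1) (a := .pair .nil (var 0)) (k := k + 1)
          (x := .cons (encNat k) (.cons (encPoly (encScalar γ) c)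
            (.cons (encBiv γ f) (encField γ))))
          (L := (List.range (c.natDegree + 1)).map fun i => encScalar γ (c.coeff i))
          (by simp [encPoly]) (by simp [encNat_succ])
        rw [List.length_map, List.length_range] at h6 h7
        refine ⟨⟨cr, _, rfl, h6, by omega, fun c hc => h5 c (by simp [hc])⟩, h7.trans ?_⟩
        simp
        omega)
    have h7 : cr = [] := by simpa using h3.symm
    subst h7
    have h8 : k = b := by simpa using h5
    refine ⟨by rw [sizeF, h4, h8], h6.trans ?_⟩
    have h9 : cs.length * (b * 20 + 50 + 9) + b * 30 ≤ b * (b * 20 + 100) := by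
      have : cs.length * (b * 20 + 59) ≤ b * (b * 20 + 59) := Nat.mul_le_mul_right _ (by omega)
      nlinarith
    simp only [cost_var, cost_drop, List.length_map] at h2 ⊢
    omega

end size

/-! ### The program -/

/-- The polynomials in `t` of bounded degree. -/
def basisF : Fn :=
  call₂ monos (var 3) (call₂ monos (count (drop 6) .nil) (.pair (.pair .nil .nil) .nil) .nil) .nil

/-- The environment of the main loops. -/
def setup : Fn :=
  letIn sizeF <| letIn (umul 0 0) <| letIn (umul 0 0) <| letIn (umul 1 0) <| letIn basisF <|
  letIn (call₂ (mapF (gen bmul .nil)) (.pair (var 5) (var 3)) (call₂ monos (var 4) (var 0) .nil)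
    (drop 6)) <|
  .pair (call₁ bderiv (var 6) (drop 7))
    (.pair (var 0) (.pair (var 4) (.pair (var 2) (.pair (var 1) (drop 6)))))

/-- The time of `setup`. -/
def tsetup (b : ℕ) : ℕ :=
  b * (b * 20 + 100) + b * (b * 20 + 40) + b * b * (b * b * 20 + 40) +
    b * b * (b * b * (b * b) * 20 + 40) + tmonos b 1 + 2 * tmonos b (b * b) + b * 20 +
    b ^ 3 * (tbmul (b + b) + tbflat (b * b) + 200) + tbderiv b + 600

/-- The linear combinations of the logarithmic derivatives of the factors, multiplied by `f`. -/
def spaceF : Fn :=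
  call₂ (solve .tl) (var 3)
    (call₂ (mapF (gen (call₂ nied (var 1) (var 0) (drop 2)) (var 1))) (.pair (var 5) (var 2))
      (call₂ monos (count (.comp .tl (var 5)) .nil) (var 4) .nil) (drop 6)) (drop 6)

/-- The time of `spaceF`. -/
def tspace (b : ℕ) : ℕ :=
  tsolve (bnum (b * b)) (b ^ 3) b + b ^ 3 * (tnied (b * b) b + tbflat (b * b) + 250) +
    tmonos b (b * b) + b * 20 + 300

/-- The factorization algorithm. -/
def mainF : Fn :=
  .comp (letIn spaceF <| letIn (call₂ refineAll (var 0) (.ite (var 0) (.pair (var 0) .nil) .nil)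
      (drop 1)) <| call₂ (mapF facF) .nil (var 0) (drop 2))
    (.comp setup (.pair .tl .hd))

/-- The time of `mainF`. -/
def tmain (b : ℕ) : ℕ :=
  tsetup b + tspace b + trefineAll b + b * (tfac b + 80) + 300

lemma ModFn.lift_t_mono {P : ModFn} (h : Monotone P.t) : Monotone P.lift.t := by
  intro a b hab
  have := h hab
  simp only [ModFn.lift]
  gcongr

lemma fieldFn_t_mono : Monotone fieldFn.t := by
  intro a b hab
  have h1 := tadd_mono hab
  have h2 := tmul_mono hab
  simp only [fieldFn]
  gcongr

lemma bivFn_t_mono : Monotone bivFn.t :=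
  ModFn.lift_t_mono (ModFn.lift_t_mono fieldFn_t_mono)

lemma tbderiv_mono : Monotone tbderiv := by
  intro a b hab
  have := ModFn.lift_t_mono fieldFn_t_mono hab
  unfold tbderiv
  gcongr

lemma tpmul_mono {t t' : ℕ → ℕ} (h : Monotone t) (h' : Monotone t') : Monotone (tpmul t t') := by
  intro a b hab
  have h1 := h hab
  have h2 := h' hab
  unfold tpmul
  gcongr

lemma tbmul_mono : Monotone tbmul := by
  refine tpmul_mono (ModFn.lift_t_mono fieldFn_t_mono) (tpmul_mono fieldFn_t_mono ?_)
  intro a b hab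
  have h1 := fieldFn_t_mono hab
  unfold tfmul tlin
  gcongr

section main
variable {p m : ℕ} [hp : Fact p.Prime] {F : Type u} [Field F] [Algebra (ZMod p) F]
  (γ : Module.Basis (Fin m) (ZMod p) F)

/-- The inner call turns the coordinate list of `1` into the coordinate vectors of the basis of
`𝔽_q`; the outer one multiplies these by the powers of `t`. -/
lemma basisF_spec {b : ℕ} (hb : p + m ≤ b) (a₀ a₁ a₂ a₄ : Val) :
    (∃ TL lt, basisF.eval (.cons a₀ (.cons a₁ (.cons a₂ (.cons (encNat b)
        (.cons a₄ (encField γ)))))) = encList TL ∧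
      List.Forall₂ (liftRep (frep γ) b) TL lt ∧ TL.length ≤ b * b ∧
      lspan (ZMod p) lt = polySub ⊤ b) ∧
    basisF.cost (.cons a₀ (.cons a₁ (.cons a₂ (.cons (encNat b)
        (.cons a₄ (encField γ)))))) ≤ tmonos b 1 + tmonos b (b * b) + b * 20 + 100 := by
  have hE : encField γ = .cons (encNat p) (encList (List.ofFn fun i =>
    encList (List.ofFn fun j => encScalar γ (γ i * γ j)))) := rfl
  obtain ⟨h1, h2⟩ := count_spec (l := drop 6) (a := .nil)
    (x := .cons a₀ (.cons a₁ (.cons a₂ (.cons (encNat b) (.cons a₄ (encField γ))))))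
    (L := List.ofFn fun i => encList (List.ofFn fun j => encScalar γ (γ i * γ j))) (k := 0)
    (by simp [hE]) (by simp)
  rw [List.length_ofFn, add_zero] at h1
  rw [List.length_ofFn] at h2
  obtain ⟨⟨L, l, h3, h4, h5, h6⟩, h7⟩ := monos_spec (p := p) srep_zero
    (L := [encNat 1]) (l := [(1 : ZMod p)]) (.cons (by rw [srep, ZMod.val_one]) .nil) m .nil
  have h8 : lspan (ZMod p) (l.map (ofCoord γ)) = ⊤ := by
    rw [lspan_map, h6, eq_top_iff]
    intro x _
    refine ⟨coordPoly γ x, fun i => ⟨by simp, fun hi => ?_⟩, ofCoord_coordPoly γ x⟩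
    rw [coordPoly_coeff, dif_neg (by omega)]
  obtain ⟨⟨TL, lt, h9, h10, h11, h12⟩, h13⟩ := monos_spec (p := p) ((fieldFn_spec γ).zero b)
    (L := L) (l := l.map (ofCoord γ))
    (by
      rw [List.forall₂_map_right_iff]
      exact h4.imp fun v y h => ⟨y, h, rfl⟩) b .nil
  rw [h8] at h12
  have h14 : L.length ≤ b * b := by
    rw [h5]
    simp only [List.length_singleton, mul_one]
    exact (by omega : m ≤ b).trans (Nat.le_mul_self b)
  have h15 : tmonos b L.length ≤ tmonos b (b * b) := by
    unfold tmonos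
    gcongr
  have h16 : tmonos m [encNat 1].length ≤ tmonos b 1 := by
    have : m ≤ b := by omega
    rw [List.length_singleton]
    unfold tmonos
    gcongr
  have e1 : encNat 1 = .cons .nil .nil := rfl
  rw [e1] at h3 h7 h16
  refine ⟨⟨TL, lt, ?_, h10, ?_, h12⟩, ?_⟩
  · rw [← h9, ← h3]
    simp [basisF, h1]
  · rw [h11, h5]
    exact Nat.mul_le_mul_left _ (by simp; omega)
  · have h17 : m * 20 ≤ b * 20 := by omega
    rw [← h3] at h13
    simp [basisF, h1] at h2 h7 h13 h16 ⊢
    omega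

/-- What the later loops share is computed once: the derivative, the generators from the multiples
of `f`, the polynomials in `t`, and in unary the size `b * b` of the products and the number `bnum
(b * b)` of equations. -/
lemma setup_spec (f : F[X][X]) : ∃ (b : ℕ) (Γ : Ctx γ f b),
    b ≤ p + m + (f.natDegree + 1) * (tdeg f + 2) ∧
    setup.eval (.cons (encBiv γ f) (encField γ)) = Γ.val ∧
    setup.cost (.cons (encBiv γ f) (encField γ)) ≤ tsetup b := by
  obtain ⟨b, hb, hfn, hft, hbl, h1, h2⟩ := sizeF_spec γ f
  have hb2 : 2 ≤ b := by have := hp.out.two_le; omega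
  have hbb : b ≤ b * b := Nat.le_mul_self b
  have hbb' : b + b ≤ b * b := by
    have := Nat.mul_le_mul_right b hb2
    omega
  obtain ⟨h3, h4⟩ := umul_spec (i := 0) (j := 0) (x := .cons (encNat b) (.cons (encBiv γ f)
    (encField γ))) (k := b) (l := b) (by simp) (by simp)
  obtain ⟨h5, h6⟩ := umul_spec (i := 0) (j := 0) (x := .cons (encNat (b * b)) (.cons (encNat b)
    (.cons (encBiv γ f) (encField γ)))) (k := b * b) (l := b * b) (by simp) (by simp)
  obtain ⟨h7, h8⟩ := umul_spec (i := 1) (j := 0) (x := .cons (encNat (b * b * (b * b)))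
    (.cons (encNat (b * b)) (.cons (encNat b) (.cons (encBiv γ f) (encField γ)))))
    (k := b * b) (l := b * b * (b * b)) (by simp) (by simp)
  have hK : b * b * (b * b * (b * b)) = bnum (b * b) := by rw [bnum, mul_one]
  obtain ⟨⟨TL, lt, h9, h10, h11, h12⟩, h13⟩ := basisF_spec γ hb (encNat (bnum (b * b)))
    (encNat (b * b * (b * b))) (encNat (b * b)) (encBiv γ f)
  obtain ⟨⟨XL, xl, h14, h15, h16, h17⟩, h18⟩ := monos_spec (p := p)
    ((fieldFn_spec γ).lift.zero b) h10 b .nil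
  have hf : brep γ b (encBiv γ f) f := brep_encBiv hfn hft
  have hmul : ∀ v x, brep γ b v x →
      brep γ (b * b) (bmul.eval (.cons (encBiv γ f) (.cons v (encField γ))))
        (LinearMap.mulLeft (ZMod p) f x) ∧
      bmul.cost (.cons (encBiv γ f) (.cons v (encField γ))) ≤ tbmul (b + b) := by
    intro v x hv
    obtain ⟨h19, h20⟩ := bmul_spec γ hb hb hf hv
    exact ⟨(bivFn_spec γ).mono hbb' h19, h20⟩
  obtain ⟨⟨ZL, h19, h20, h21⟩, h22⟩ := gen_spec γ (op := bmul) (keep := .nil) (hb.trans hbb)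
    (φ := LinearMap.mulLeft (ZMod p) f) (ψ := 0) (t := tbmul (b + b)) (u := encBiv γ f)
    hmul (fun a v x _ => ⟨(bivFn_spec γ).zero b, by simp⟩) h15
  obtain ⟨h23, h24⟩ := bderiv_spec γ hb hf
  have h25 : XL.length ≤ b ^ 3 := by
    rw [h16, show b ^ 3 = b * (b * b) by ring]
    exact Nat.mul_le_mul_left _ h11
  refine ⟨b, ⟨_, ZL, TL, encBiv γ f, xl, lt, hb, hb2, h23, h20, ?_, by rw [h17, h12]; rfl,
    h21.trans_le h25, h10, h12, h11, hf, rfl, hft, hfn⟩, hbl, ?_, ?_⟩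
  · clear h14 h16 h17 h18 h19 h20 h21 h22 h25
    induction h15 with
    | nil => simp
    | cons h _ ih =>
      intro x hx
      rcases List.mem_cons.mp hx with rfl | hx
      · exact ⟨_, (hmul _ _ h).1⟩
      · exact ih x hx
  · simp [setup, h1, h3, h5, h7, hK, h9, h14, h19, Ctx.val]
  · have h26 : XL.length * (tbmul (b + b) + tbflat (b * b) + 200) ≤
      b ^ 3 * (tbmul (b + b) + tbflat (b * b) + 200) := Nat.mul_le_mul_right _ h25
    have h27 : tmonos b TL.length ≤ tmonos b (b * b) := by
      unfold tmonos
      gcongr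
    rw [tsetup]
    simp only [setup, cost_letIn, h1, h3, h5, h7, hK, h9]
    simp [h14, h19]
    simp only [add_zero] at h4 h6 h8
    omega

variable {γ} {s : ℕ} {c : F[X]} {g : Fin s → F[X][X]} {f : F[X][X]}
  (hf : (toK f).Separable) (H : IsFactorData f c g) {b : ℕ} (Γ : Ctx γ f b)
include hf H

/-- The kernel of Niederreiter's operator on the box of degree `< n` in `X` and `< b` in `t`. The
box loses nothing, as the `logDer c g i` have `t`-degree at most that of `f`, and `p * b ≤ b * b`
bounds the size of the values. -/
lemma spaceF_spec : BlockRel γ c g b (b ^ 3) (spaceF.eval Γ.val) Finset.univ ∧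
    spaceF.cost Γ.val ≤ tspace b := by
  have hft := Γ.hft
  have hfn := Γ.hfn
  have hb := Γ.hb
  have hfv : Γ.fv.tl = encList (((List.range (f.natDegree + 1)).map fun k =>
      encPoly (encScalar γ) (f.coeff k)).tail) := by
    rw [Γ.hfv, encBiv, encPoly, tl_encList]
  obtain ⟨h1, h2⟩ := count_spec (l := .comp .tl (var 5)) (a := .nil) (x := Γ.val) (k := 0)
    (L := ((List.range (f.natDegree + 1)).map fun k =>
      encPoly (encScalar γ) (f.coeff k)).tail) (by simpa [Ctx.val] using hfv) (by simp)
  simp only [List.length_tail, List.length_map, List.length_range, Nat.add_sub_cancel,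
    add_zero] at h1 h2
  obtain ⟨⟨XL, xl, h3, h4, h5, h6⟩, h7⟩ := monos_spec (p := p)
    ((fieldFn_spec γ).lift.zero b) Γ.hT f.natDegree .nil
  rw [Γ.hTs] at h6
  have hpb : p * b ≤ b * b := Nat.mul_le_mul_right _ (by omega)
  have hX : List.Forall₂ (brep γ b) XL xl :=
    h4.imp fun _ _ h => ListRep.mono h hfn.le fun _ _ h => h
  have htn : tnied (p * b) b ≤ tnied (b * b) b := by
    have h1 := bivFn_t_mono hpb
    have h2 := tbderiv_mono hpb
    have h3 := tbmul_mono hpb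
    unfold tnied
    gcongr
  have hop : ∀ v x, brep γ b v x →
      brep γ (b * b) ((call₂ nied (var 1) (var 0) (drop 2)).eval
        (.cons Γ.fv (.cons v (encField γ)))) (niedL (p := p) f x) ∧
      (call₂ nied (var 1) (var 0) (drop 2)).cost (.cons Γ.fv (.cons v (encField γ))) ≤
        tnied (b * b) b + 20 := by
    intro v x hv
    obtain ⟨h8, h9⟩ := nied_spec γ hb Γ.hf hv
    refine ⟨(bivFn_spec γ).mono hpb (by simpa using h8), ?_⟩
    simp
    omega
  obtain ⟨⟨NL, h8, h9, h10⟩, h11⟩ := gen_spec γ (op := call₂ nied (var 1) (var 0) (drop 2))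
    (keep := var 1) Γ.hbM (φ := niedL (p := p) f) (ψ := LinearMap.id) (t := tnied (b * b) b + 20)
    (u := Γ.fv) hop (fun a v x hv => ⟨by simpa using hv, by simp⟩) hX
  have hrep : ∀ x ∈ xl, niedL (p := p) f x ∈ repSub γ Γ.hbM := by
    clear h3 h4 h5 h6 h7 h8 h9 h10 h11
    induction hX with
    | nil => simp
    | cons h _ ih =>
      intro x hx
      rcases List.mem_cons.mp hx with rfl | hx
      · exact ⟨_, (hop _ _ h).1⟩
      · exact ih x hx
  have hc := comap_solutions γ (φ := niedL (p := p) f) (ψ := 0) (lz := []) Γ.hbM hrep (by simp)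
  simp only [List.map_nil, List.append_nil, lspan_nil, Submodule.mem_bot, LinearMap.zero_apply,
    add_zero, exists_eq_left, h6] at hc
  have hbK : b ≤ bnum (b * b) := by
    have h0 : 0 < b * b := Nat.mul_pos (by have := Γ.two_le; omega) (by have := Γ.two_le; omega)
    have h1 := Nat.le_mul_self b
    have h2 : b * b * 1 ≤ b * b * (b * b * (b * b * 1)) := Nat.mul_le_mul_left _
      (Nat.mul_pos h0 (Nat.mul_pos h0 one_pos))
    rw [bnum]
    omega
  obtain ⟨⟨L', l', h12, h13, h14, h15, h16⟩, h17⟩ := solve_spec γ (keep := .tl)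
    (rep := brep γ b) (κ := LinearMap.snd (ZMod p) (ZMod p)[X] F[X][X]) (Nat.le_succ _) hb
    (show p ≤ bnum (b * b) + 1 by omega) (fun v x hv => ⟨hv.2.1, by simp⟩) h9 (by
      intro x hx h0
      exact Prod.ext ((hc x).mp hx).1 h0)
  have h18 : XL.length ≤ b ^ 3 := by
    rw [h5, show b ^ 3 = b * (b * b) by ring]
    exact Nat.mul_le_mul hfn.le Γ.hTl
  refine ⟨⟨L', _, ?_, h13, by omega, ?_, ?_⟩, ?_⟩
  · rw [← h12, ← h8, ← h3, ← h1]
    simp [spaceF, Ctx.val]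
  · intro x hx
    obtain ⟨y, hy, rfl⟩ := List.mem_map.mp hx
    exact h15 y hy
  · ext x
    rw [lspan_map, h16, ← H.mem_ker_iff hf hft]
    simp only [Submodule.mem_map, Submodule.mem_comap] at hc ⊢
    constructor
    · rintro ⟨y, hy, rfl⟩
      exact ((hc y).mp hy).2
    · exact fun h => ⟨(0, x), (hc (0, x)).mpr ⟨rfl, h⟩, rfl⟩
  · have h19 : tsolve (bnum (b * b)) NL.length b ≤ tsolve (bnum (b * b)) (b ^ 3) b :=
      tsolve_mono (by omega)
    have h20 : XL.length * (tnied (b * b) b + 20 + tbflat (b * b) + 200) ≤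
      b ^ 3 * (tnied (b * b) b + tbflat (b * b) + 250) := Nat.mul_le_mul h18 (by omega)
    have h21 : tmonos f.natDegree Γ.TL.length ≤ tmonos b (b * b) := by
      have := Γ.hTl
      unfold tmonos
      gcongr
    rw [← h8, ← h3] at h17
    rw [← h3] at h11
    rw [tspace]
    simp only [Ctx.val] at h1 h2
    simp [spaceF, Ctx.val, h1] at h2 h7 h11 h17 ⊢
    omega

end main
end FactorFqt


/-! ### The complete algorithm and its polynomial running time -/

namespace FactorFqt
open Fn

section main
variable {p m : ℕ} [hp : Fact p.Prime] {F : Type u} [Field F] [Algebra (ZMod p) F]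
  (γ : Module.Basis (Fin m) (ZMod p) F)

lemma IsFactorData.card_le {s : ℕ} {c : F[X]} {g : Fin s → F[X][X]} {f : F[X][X]}
    (H : IsFactorData f c g) : s ≤ f.natDegree := by
  rw [← H.natDegree_prod, Polynomial.natDegree_prod _ _ fun i _ => (H.irreducible i).ne_zero]
  have h := Finset.sum_le_sum fun i (_ : i ∈ Finset.univ) => Nat.succ_le_of_lt (H.pos i)
  simpa only [Nat.succ_eq_add_one, zero_add, Finset.sum_const, Finset.card_univ, Fintype.card_fin,
    smul_eq_mul, mul_one] using h

lemma mainF_spec {f : F[X][X]} (hf : (toK f).Separable) :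
    ∃ (b : ℕ) (hs : List F[X][X]), b ≤ p + m + (f.natDegree + 1) * (tdeg f + 2) ∧
      mainF.eval (encInput γ f) = encList (hs.map (encBiv γ)) ∧
      mainF.cost (encInput γ f) ≤ tmain b ∧ IsFactorization f hs := by
  obtain ⟨s, c, g, H⟩ := exists_isFactorData hf
  obtain ⟨b, Γ, hb, h1, h2⟩ := setup_spec γ f
  obtain ⟨h3, h4⟩ := spaceF_spec hf H Γ
  have h0 := h3.ne_nil_iff H
  obtain ⟨NL, nl, h5, h6, h7, h8, h9⟩ := id h3
  have hs : s ≤ b := H.card_le.trans Γ.hfn.le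
  -- Refinement starts from one block containing everything. If `f` has no factor of positive
  -- degree, the kernel is zero and the list of blocks must be empty.
  obtain ⟨BL, SS, e, hc, hB, hSS⟩ : ∃ (BL : List Val) (SS : List (Finset (Fin s))),
      (Fn.ite (var 0) (.pair (var 0) .nil) .nil).eval (.cons (encList NL) Γ.val) = encList BL ∧
      (Fn.ite (var 0) (.pair (var 0) .nil) .nil).cost (.cons (encList NL) Γ.val) ≤ 20 ∧
      List.Forall₂ (BlockRel γ c g b (b ^ 3)) BL SS ∧ IsPartition SS := by
    by_cases hne : (Finset.univ : Finset (Fin s)).Nonempty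
    · have hc : (var 0).eval (.cons (encList NL) Γ.val) ≠ .nil := h5 ▸ h0.mpr hne
      refine ⟨[encList NL], [Finset.univ], ?_, ?_, .cons (h5 ▸ h3) .nil, ?_, ?_⟩
      · rw [eval_ite_ne _ _ hc]
        simp
      · rw [cost_ite_ne _ _ hc]
        simp
      · simpa using hne
      · simp
    · have hc : (var 0).eval (.cons (encList NL) Γ.val) = .nil :=
        not_not.mp (h5 ▸ mt h0.mp hne)
      refine ⟨[], [], ?_, ?_, .nil, ?_, ?_⟩
      · rw [eval_ite_nil _ _ hc]
        simp
      · rw [cost_ite_nil _ _ hc]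
        simp
      · simp
      · intro i
        exact absurd ⟨i, Finset.mem_univ i⟩ hne
  obtain ⟨⟨BL', idx, k, h10, h11, h12, h13⟩, h14⟩ := refineAll_spec H Γ h6 h7 h9 hs hB hSS
  rw [List.forall₂_map_right_iff] at h11
  have hlen : BL'.length ≤ b := by
    rw [h11.length_eq]
    have := h12.length_le_card
    rw [Fintype.card_fin] at this
    omega
  obtain ⟨h15, h16⟩ := mapF_spec (f := facF) (a := .nil) (E := Γ.val) (B := tfac b) BL' (by
    clear h10 h12 h13 h14 hlen
    induction h11 with
    | nil => simp
    | cons h _ ih =>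
      intro v hv
      rcases List.mem_cons.mp hv with rfl | hv
      · exact (facF_spec H Γ h).2
      · exact ih v hv)
  have h17 : (BL'.map fun x => facF.eval (.cons .nil (.cons x Γ.val))) =
      (idx.map (outFactor c g)).map (encBiv γ) := by
    clear h10 h12 h13 h14 h15 h16 hlen
    induction h11 with
    | nil => simp
    | cons h _ ih =>
      rw [List.map_cons, ih, (facF_spec H Γ h).1]
      simp
  have h18 : BL'.length * (tfac b + 80) ≤ b * (tfac b + 80) := Nat.mul_le_mul_right _ hlen
  refine ⟨b, idx.map (outFactor c g), hb, ?_, ?_, H.isFactorization h12 h13⟩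
  · rw [← h17, ← h15, ← h10, ← e]
    simp only [mainF, Fn.eval_comp, encInput, eval_pair, eval_tl, eval_hd, tl_cons, hd_cons, h1,
      eval_letIn, eval_call₂, h5, eval_var_zero_cons, eval_drop_succ_cons, eval_drop_zero, eval_nil]
  · rw [tmain]
    simp only [mainF, cost_comp, Fn.eval_comp, encInput, eval_pair, eval_tl, eval_hd, tl_cons,
      hd_cons, h1, cost_letIn, cost_call₂, eval_call₂, h5, eval_var_zero_cons, eval_drop_succ_cons,
      eval_drop_zero, eval_nil, e, h10, cost_pair, cost_tl, cost_hd, cost_var, cost_drop, cost_nil]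
    omega

end main

/-! ### The time is polynomial -/

namespace IsPoly

attribute [fun_prop] IsPoly id const add mul comp pow

lemma lift {P : ModFn} (h : IsPoly P.t) : IsPoly P.lift.t :=
  (id.mul (h.add (const 100))).add (const 100)

lemma tpmul {t t' : ℕ → ℕ} (h : IsPoly t) (h' : IsPoly t') : IsPoly (tpmul t t') := by
  unfold FactorFqt.tpmul
  fun_prop

lemma tflat {t : ℕ → ℕ} (h : IsPoly t) : IsPoly (tflat t) := by
  unfold FactorFqt.tflat
  fun_prop

lemma tpnorm {P : ModFn} {t : ℕ → ℕ} (h : IsPoly P.t) (h' : IsPoly t) :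
    IsPoly (tpnorm P t) := by
  unfold FactorFqt.tpnorm
  fun_prop

@[fun_prop]
lemma tadd : IsPoly tadd := by
  unfold FactorFqt.tadd tsucc
  fun_prop

@[fun_prop]
lemma tmul : IsPoly tmul := by
  unfold FactorFqt.tmul
  fun_prop

lemma fieldFn_t : IsPoly fieldFn.t := by
  unfold fieldFn
  fun_prop

lemma bivFn_t : IsPoly bivFn.t := fieldFn_t.lift.lift

@[fun_prop]
lemma tbmul : IsPoly tbmul := by
  refine tpmul fieldFn_t.lift (tpmul fieldFn_t ?_)
  have h := fieldFn_t
  unfold tfmul tlin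
  generalize fieldFn.t = t at h ⊢
  fun_prop

@[fun_prop]
lemma tbderiv : IsPoly tbderiv := by
  have h := fieldFn_t.lift
  unfold FactorFqt.tbderiv
  generalize fieldFn.lift.t = t at h ⊢
  fun_prop

@[fun_prop]
lemma tbflat : IsPoly tbflat := tflat (tflat (tflat (const 20)))

@[fun_prop]
lemma tbnorm : IsPoly tbnorm := by
  refine tpnorm fieldFn_t.lift (tpnorm fieldFn_t ?_)
  unfold tfnorm
  fun_prop

@[fun_prop]
lemma bnum : IsPoly bnum := by
  unfold FactorFqt.bnum
  fun_prop

variable {K L B : ℕ → ℕ} (hK : IsPoly K) (hL : IsPoly L) (hB : IsPoly B)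
include hK hB

@[fun_prop]
lemma tmonos : IsPoly fun x => tmonos (K x) (B x) := by
  unfold FactorFqt.tmonos
  fun_prop

@[fun_prop]
lemma tnied : IsPoly fun x => tnied (K x) (B x) := by
  unfold FactorFqt.tnied
  have h := bivFn_t
  generalize bivFn.t = t at h ⊢
  fun_prop

include hL in
@[fun_prop]
lemma tsolve : IsPoly fun x => tsolve (K x) (L x) (B x) := by
  unfold FactorFqt.tsolve tcut telim
  have h := bivFn_t
  generalize bivFn.t = t at h ⊢
  fun_prop

@[fun_prop]
lemma trefine : IsPoly fun x => trefine (K x) (B x) := by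
  unfold FactorFqt.trefine tsplitAll tsplit
  have h := bivFn_t
  generalize bivFn.t = t at h ⊢
  fun_prop

omit hK hB

@[fun_prop]
lemma trefineAll : IsPoly trefineAll := by
  unfold FactorFqt.trefineAll
  fun_prop

@[fun_prop]
lemma tfac : IsPoly tfac := by
  unfold FactorFqt.tfac ttry
  have h := bivFn_t
  generalize bivFn.t = t at h ⊢
  fun_prop

lemma tmain : IsPoly tmain := by
  unfold FactorFqt.tmain tsetup tspace
  fun_prop

end IsPoly

theorem exists_factorsInPolyTime : ∃ c : Prog, FactorsInPolyTime.{u} c := by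
  obtain ⟨c, hc⟩ := exists_implements mainF 0
  obtain ⟨C, hC⟩ := IsPoly.tmain
  -- The size satisfies `b ≤ p + m + (n + 1) (deg_t f + 2)`, the time is at most `(b + 2) ^ C`, and
  -- each parameter is at most the sum of all.
  refine ⟨c, (X + (X + 1) * (X + 2) + 2) ^ C, fun p m _ F _ _ γ f hf => ?_⟩
  obtain ⟨b, hs, h1, h2, h3, h4⟩ := mainF_spec γ hf
  obtain ⟨T, s', h5, h6, h7, -⟩ := hc (initStore (encInput γ f))
  have e : initStore (encInput γ f) 0 = encInput γ f := by simp [initStore]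
  rw [e] at h6 h7
  refine ⟨T, hs, ⟨s', h5, h7.trans h2⟩, ?_, h4⟩
  rw [tdeg_eq_degT] at h1
  refine (h6.trans (h3.trans (hC b))).trans ?_
  simp only [eval_pow, eval_add, eval_mul, eval_X, eval_one, eval_ofNat]
  refine Nat.pow_le_pow_left (Nat.add_le_add_right (h1.trans (Nat.add_le_add ?_
    (Nat.mul_le_mul ?_ ?_))) 2) C
  all_goals omega

end FactorFqt


namespace FactorFqt

/-! ### Divisibility and resultants -/

/-- A constant in the ideal generated by a constant `a` and a monic polynomial of positive degree
is divisible by `a`. -/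
lemma dvd_of_C_eq_add {R : Type*} [CommRing R] {q P Q : R[X]} (hq : q.Monic)
    (h0 : 0 < q.natDegree) {a x : R} (h : C x = q * P + C a * Q) : a ∣ x := by
  nontriviality R
  have h1 : C x %ₘ q = C x := (modByMonic_eq_self_iff hq).mpr
    (degree_C_le.trans_lt (by rwa [← natDegree_pos_iff_degree_pos]))
  have h2 : C x %ₘ q = C a * (Q %ₘ q) := by
    rw [h, add_modByMonic, (modByMonic_eq_zero_iff_dvd hq).mpr ⟨P, rfl⟩, zero_add, C_mul',
      smul_modByMonic, C_mul']
  refine ⟨(Q %ₘ q).coeff 0, ?_⟩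
  rw [← coeff_C_mul, ← h2, h1, coeff_C_zero]

section resultant
variable {F : Type u} [Field F]

/-- In the Leibniz expansion of the Sylvester determinant, every product has `m` entries from
coefficients of `g` and `n` from coefficients of `f`. -/
lemma natDegree_resultant_le {f g : F[X][X]} {a b m n : ℕ} (hf : tdeg f ≤ a) (hg : tdeg g ≤ b) :
    (resultant f g m n).natDegree ≤ m * b + n * a := by
  rw [resultant, Matrix.det_apply]
  refine natDegree_sum_le_of_forall_le _ _ fun σ _ => ?_
  have h1 : ∀ j : Fin (m + n), (sylvester f g m n (σ j) j).natDegree ≤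
      Fin.addCases (fun _ => b) (fun _ => a) j := by
    intro j
    induction j using Fin.addCases with
    | left j =>
      simp only [sylvester, Matrix.of_apply, Fin.addCases_left]
      split_ifs
      · exact tdeg_le_iff.mp hg _
      · simp
    | right j =>
      simp only [sylvester, Matrix.of_apply, Fin.addCases_right]
      split_ifs
      · exact tdeg_le_iff.mp hf _
      · simp
  have h2 := (natDegree_prod_le Finset.univ fun j => sylvester f g m n (σ j) j).trans
    (Finset.sum_le_sum fun j _ => h1 j)
  rw [Fin.sum_univ_add] at h2
  simp only [Fin.addCases_left, Fin.addCases_right, Finset.sum_const, Finset.card_univ,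
    Fintype.card_fin, smul_eq_mul] at h2
  refine le_trans ?_ h2
  rcases Int.units_eq_one_or (Equiv.Perm.sign σ) with h | h <;> simp [h]

/-- The excess of the formal degree `n` over that of `h` contributes only a power of the leading
coefficient of `g`, which cancels; then a vanishing resultant means a common factor over `K`. -/
lemma dvd_of_resultant_eq_zero {g h : F[X][X]} (hg : Irreducible (toK g)) {n : ℕ}
    (hn : h.natDegree ≤ n) (h0 : resultant g h g.natDegree n = 0) : toK g ∣ toK h := by
  obtain ⟨k, rfl⟩ := Nat.exists_eq_add_of_le hn
  rw [resultant_add_right_deg _ _ _ _ _ le_rfl, coeff_natDegree] at h0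
  have hg0 : g ≠ 0 := by
    rintro rfl
    exact hg.ne_zero (by simp [toK])
  have h1 := (mul_eq_zero.mp h0).resolve_left (pow_ne_zero _ (leadingCoeff_ne_zero.mpr hg0))
  have h2 : resultant (toK g) (toK h) = 0 := by
    rw [natDegree_toK, natDegree_toK, toK, toK, resultant_map_map, h1, map_zero]
  exact not_not.mp fun h3 => (resultant_eq_zero_iff.mp h2).2 (hg.coprime_iff_not_dvd.mpr h3)

end resultant

/-! ### Local factors -/

lemma mul_pow_logDeriv {R : Type*} [CommRing R] {f q x : R[X]} (h : q * x = f * derivative q)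
    (n : ℕ) : q ^ n * (n * x) = f * derivative (q ^ n) := by
  cases n with
  | zero => simp
  | succ n =>
    rw [derivative_pow_succ]
    simp only [map_add, C_1, map_natCast]
    push_cast
    linear_combination ((n : R[X]) + 1) * q ^ n * h

/-- Additivity of the logarithmic derivative in a form free of division, where `x i` stands for `f
q_i' / q_i`. -/
lemma prod_mul_sum_logDeriv {R ι : Type*} [CommRing R] {f : R[X]} {q x : ι → R[X]}
    (h : ∀ i, q i * x i = f * derivative (q i)) (w : ι → ℕ) (S : Finset ι) :
    (∏ i ∈ S, q i ^ w i) * ∑ i ∈ S, (w i : R[X]) * x i =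
      f * derivative (∏ i ∈ S, q i ^ w i) := by
  classical
  induction S using Finset.induction_on with
  | empty => simp
  | insert a S ha ih =>
    rw [Finset.prod_insert ha, Finset.sum_insert ha, derivative_mul]
    linear_combination (∏ i ∈ S, q i ^ w i) * mul_pow_logDeriv (h a) (w a) + q a ^ w a * ih

section loc
variable {F : Type u} [Field F] {R : Type*} [CommRing R] [Algebra F[X] R]

/-- `f = ℓ_f f₁ ⋯ f_r` in `R[X]` with monic irreducible `f_i`. -/
structure IsLocalData (f : F[X][X]) {r : ℕ} (fl : Fin r → R[X]) : Prop where
  monic : ∀ j, (fl j).Monic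
  irreducible : ∀ j, Irreducible (fl j)
  eq : f.map (algebraMap F[X] R) = C (algebraMap F[X] R f.leadingCoeff) * ∏ j, fl j

/-- The cofactor of the local factor `f_j`. -/
noncomputable def locCofactor (f : F[X][X]) {r : ℕ} (fl : Fin r → R[X]) (j : Fin r) : R[X] :=
  C (algebraMap F[X] R f.leadingCoeff) * ∏ k ∈ Finset.univ.erase j, fl k

/-- The logarithmic derivative of the local factor `f_j`, multiplied by `f`. -/
noncomputable def locLogDer (f : F[X][X]) {r : ℕ} (fl : Fin r → R[X]) (j : Fin r) : R[X] :=
  locCofactor f fl j * derivative (fl j)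

/-- Linear combination of the logarithmic derivatives of the local factors. -/
noncomputable def locComb {p : ℕ} [Fact p.Prime] [Algebra (ZMod p) F] (f : F[X][X]) {r : ℕ}
    (fl : Fin r → R[X]) (w : Fin r → ZMod p) : R[X] :=
  ∑ j, C (algebraMap F[X] R (algebraMap (ZMod p) F[X] (w j))) * locLogDer f fl j

lemma dvd_locLogDer {f : F[X][X]} {r : ℕ} {fl : Fin r → R[X]} {j k : Fin r} (h : j ≠ k) :
    fl j ∣ locLogDer f fl k :=
  ((Finset.dvd_prod_of_mem fl (Finset.mem_erase.mpr ⟨h, Finset.mem_univ j⟩)).mul_left _).mul_right _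

lemma dvd_locComb_sub (f : F[X][X]) {r : ℕ} (fl : Fin r → R[X]) {p : ℕ} [Fact p.Prime] [Algebra (ZMod p) F] (w : Fin r → ZMod p)
    (j : Fin r) : fl j ∣ locComb f fl w -
      C (algebraMap F[X] R (algebraMap (ZMod p) F[X] (w j))) * locLogDer f fl j := by
  rw [locComb, ← Finset.add_sum_erase _ _ (Finset.mem_univ j), add_sub_cancel_left]
  exact Finset.dvd_sum fun k hk => (dvd_locLogDer (Finset.ne_of_mem_erase hk).symm).mul_left _

namespace IsLocalData
variable {f : F[X][X]} {r : ℕ} {fl : Fin r → R[X]} (D : IsLocalData f fl)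
include D

lemma locCofactor_mul (j : Fin r) : locCofactor f fl j * fl j = f.map (algebraMap F[X] R) := by
  rw [D.eq, locCofactor, mul_assoc, Finset.prod_erase_mul _ _ (Finset.mem_univ j)]

lemma mul_locLogDer (j : Fin r) :
    fl j * locLogDer f fl j = f.map (algebraMap F[X] R) * derivative (fl j) := by
  rw [← D.locCofactor_mul j, locLogDer]
  ring

lemma dvd_derivative_sub (j : Fin r) :
    fl j ∣ derivative (f.map (algebraMap F[X] R)) - locLogDer f fl j := by
  rw [← D.locCofactor_mul j, derivative_mul, locLogDer, add_sub_cancel_right]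
  exact dvd_mul_left _ _

lemma natDegree_pos (j : Fin r) : 0 < (fl j).natDegree :=
  (D.monic j).natDegree_pos_of_not_isUnit (D.irreducible j).not_isUnit

variable [IsDomain R] [FaithfulSMul F[X] R]

lemma degree_locLogDer (hf : f ≠ 0) (j : Fin r) : (locLogDer f fl j).degree < f.natDegree := by
  have hi := FaithfulSMul.algebraMap_injective F[X] R
  have h1 := D.locCofactor_mul j
  have h0 : f.map (algebraMap F[X] R) ≠ 0 := (Polynomial.map_ne_zero_iff hi).mpr hf
  have h2 := congrArg degree h1
  rw [degree_map_eq_of_injective hi, degree_mul, degree_eq_natDegree hf] at h2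
  have h3 : locCofactor f fl j ≠ 0 := left_ne_zero_of_mul (h1 ▸ h0)
  rw [← h2, locLogDer, degree_mul, degree_eq_natDegree h3]
  exact WithBot.add_lt_add_left (by simp) (degree_derivative_lt (D.monic j).ne_zero)

end IsLocalData
end loc
end FactorFqt


/-! ### Local and global factors, with `R` and `L` in the roles of `𝓞_v` and `K_v` -/

namespace FactorFqt

section loc
variable {F : Type u} [Field F] {R L : Type*} [CommRing R] [Algebra F[X] R] [Field L]
  [Algebra R L] [Algebra F[X] L] [Algebra (RatFunc F) L] [IsScalarTower F[X] R L]
  [IsScalarTower F[X] (RatFunc F) L]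

variable (R L) in
omit [Algebra (RatFunc F) L] [IsScalarTower F[X] (RatFunc F) L] in
lemma map_map_algebraMap (x : F[X][X]) :
    (x.map (algebraMap F[X] R)).map (algebraMap R L) = x.map (algebraMap F[X] L) := by
  rw [Polynomial.map_map, ← IsScalarTower.algebraMap_eq]

variable (L) in
lemma map_toK (x : F[X][X]) : (toK x).map (algebraMap (RatFunc F) L) =
    x.map (algebraMap F[X] L) := by
  rw [toK, Polynomial.map_map, ← IsScalarTower.algebraMap_eq]

namespace IsLocalData
variable [IsDomain R] [FaithfulSMul F[X] R] [IsIntegrallyClosed R] [IsFractionRing R L]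
  {f : F[X][X]} {r : ℕ} {fl : Fin r → R[X]} (D : IsLocalData f fl)
  {s : ℕ} {c : F[X]} {g : Fin s → F[X][X]} (H : IsFactorData f c g)
include D

omit [Algebra F[X] L] [Algebra (RatFunc F) L] [IsScalarTower F[X] R L]
  [IsScalarTower F[X] (RatFunc F) L] [IsDomain R] [FaithfulSMul F[X] R] in
variable (L) in
lemma prime_map (j : Fin r) : Prime ((fl j).map (algebraMap R L)) :=
  ((D.monic j).irreducible_iff_irreducible_map_fraction_map.mp (D.irreducible j)).prime

omit [Algebra F[X] L] [Algebra (RatFunc F) L] [IsScalarTower F[X] R L]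
  [IsScalarTower F[X] (RatFunc F) L] [IsDomain R] [FaithfulSMul F[X] R] [IsIntegrallyClosed R] in
variable (L) in
lemma dvd_iff_map {j : Fin r} {x : R[X]} :
    fl j ∣ x ↔ (fl j).map (algebraMap R L) ∣ x.map (algebraMap R L) :=
  (map_dvd_map _ (IsFractionRing.injective R L) (D.monic j)).symm

omit [Algebra (RatFunc F) L] [IsScalarTower F[X] (RatFunc F) L] [IsDomain R]
  [FaithfulSMul F[X] R] [IsIntegrallyClosed R] [IsFractionRing R L] in
variable (L) in
lemma prod_map_dvd : ∏ j, (fl j).map (algebraMap R L) ∣ f.map (algebraMap F[X] L) := by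
  rw [← map_map_algebraMap R L, D.eq, Polynomial.map_mul, Polynomial.map_prod]
  exact dvd_mul_left _ _

omit [IsDomain R] [FaithfulSMul F[X] R] [IsIntegrallyClosed R] [IsFractionRing R L] in
variable (L) in
lemma isCoprime (hf : (toK f).Separable) {j k : Fin r} (h : j ≠ k) :
    IsCoprime ((fl j).map (algebraMap R L)) ((fl k).map (algebraMap R L)) := by
  refine Separable.isCoprime (Separable.of_dvd (hf.map (f := algebraMap (RatFunc F) L)) ?_)
  rw [map_toK, ← Finset.prod_pair (f := fun j => (fl j).map (algebraMap R L)) h]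
  exact (Finset.prod_dvd_prod_of_subset _ _ _ (Finset.subset_univ _)).trans (D.prod_map_dvd L)

include H

omit [Algebra (RatFunc F) L] [IsScalarTower F[X] (RatFunc F) L] [IsDomain R] in
variable (L) in
include L in
-- Over the field `L` the local factor is prime by Gauss' lemma and divides `c ∏ g_i`; as it is
-- monic, divisibility descends to `R`.
lemma exists_dvd (j : Fin r) : ∃ i, fl j ∣ (g i).map (algebraMap F[X] R) := by
  have h1 : (fl j).map (algebraMap R L) ∣ C (algebraMap F[X] L c) *
      ∏ i, (g i).map (algebraMap F[X] L) := by
    refine (Finset.dvd_prod_of_mem _ (Finset.mem_univ j)).trans ((D.prod_map_dvd L).trans ?_)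
    conv_lhs => rw [H.eq]
    rw [Polynomial.map_mul, map_C, Polynomial.map_prod]
  have hc : algebraMap F[X] L c ≠ 0 := by
    rw [IsScalarTower.algebraMap_apply F[X] R L, Ne,
      map_eq_zero_iff _ (IsFractionRing.injective R L),
      map_eq_zero_iff _ (FaithfulSMul.algebraMap_injective F[X] R)]
    exact H.ne_zero
  have hp := D.prime_map L j
  obtain ⟨i, -, hi⟩ := (hp.dvd_finsetProd_iff _).mp ((hp.dvd_or_dvd h1).resolve_left fun h =>
    hp.not_isUnit (isUnit_of_dvd_unit h (isUnit_C.mpr hc.isUnit)))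
  refine ⟨i, (D.dvd_iff_map L).mpr ?_⟩
  rwa [map_map_algebraMap]

omit [IsDomain R] in
variable (L) in
-- Separability makes the local factors coprime over `L`, so the product of those assigned to `g_i`
-- divides `g_i`. The degrees on both sides sum to `n`, which leaves only a constant cofactor.
lemma exists_partition (hf : (toK f).Separable) : ∃ I : Fin r → Fin s,
    (∀ j, fl j ∣ (g (I j)).map (algebraMap F[X] R)) ∧
    ∀ i, (g i).map (algebraMap F[X] L) = C (algebraMap F[X] L (g i).leadingCoeff) *
      ∏ j ∈ Finset.univ.filter (I · = i), (fl j).map (algebraMap R L) := by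
  choose I hI using D.exists_dvd L H
  refine ⟨I, hI, ?_⟩
  have hL : Function.Injective (algebraMap F[X] L) := by
    rw [IsScalarTower.algebraMap_eq F[X] R L]
    exact (IsFractionRing.injective R L).comp (FaithfulSMul.algebraMap_injective F[X] R)
  have h1 : ∀ i, ∏ j ∈ Finset.univ.filter (I · = i), (fl j).map (algebraMap R L) ∣
      (g i).map (algebraMap F[X] L) := by
    intro i
    refine Finset.prod_dvd_of_coprime (fun j _ k _ h => D.isCoprime L hf h) fun j hj => ?_
    have := (D.dvd_iff_map L).mp (hI j)
    rwa [map_map_algebraMap, (Finset.mem_filter.mp hj).2] at this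
  have h2 : ∀ i, (∏ j ∈ Finset.univ.filter (I · = i), (fl j).map (algebraMap R L)).Monic :=
    fun i => monic_prod_of_monic _ _ fun j _ => (D.monic j).map _
  have h3 : ∀ i, (∏ j ∈ Finset.univ.filter (I · = i), (fl j).map (algebraMap R L)).natDegree ≤
      (g i).natDegree := by
    intro i
    have h4 := natDegree_le_of_dvd (h1 i)
      ((Polynomial.map_ne_zero_iff hL).mpr (H.irreducible i).ne_zero)
    rwa [natDegree_map_eq_of_injective hL] at h4
  have h4 : ∑ i, (∏ j ∈ Finset.univ.filter (I · = i), (fl j).map (algebraMap R L)).natDegree =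
      ∑ i, (g i).natDegree := by
    rw [← natDegree_prod _ _ fun i _ => (H.irreducible i).ne_zero, H.natDegree_prod,
      ← natDegree_prod _ _ fun i _ => (h2 i).ne_zero,
      Finset.prod_fiberwise]
    have h5 := congrArg natDegree (congrArg (Polynomial.map (algebraMap R L)) D.eq)
    have h6 : algebraMap R L (algebraMap F[X] R f.leadingCoeff) ≠ 0 := by
      rw [← IsScalarTower.algebraMap_apply F[X] R L, Ne, map_eq_zero_iff _ hL]
      exact leadingCoeff_ne_zero.mpr H.f_ne_zero
    rw [map_map_algebraMap, natDegree_map_eq_of_injective hL, Polynomial.map_mul, map_C,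
      natDegree_C_mul h6, Polynomial.map_prod] at h5
    exact h5.symm
  have h5 := (Finset.sum_eq_sum_iff_of_le fun i _ => h3 i).mp h4
  intro i
  have h6 := eq_leadingCoeff_mul_of_monic_of_dvd_of_natDegree_le (h2 i) (h1 i) (by
    rw [natDegree_map_eq_of_injective hL, h5 i (Finset.mem_univ i)])
  rwa [leadingCoeff_map_of_injective hL] at h6

variable {p : ℕ} [Fact p.Prime] [Algebra (ZMod p) F]

omit [Algebra (RatFunc F) L] [IsScalarTower F[X] (RatFunc F) L] [IsDomain R]
  [FaithfulSMul F[X] R] in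
-- Both sides become equal over `L` after multiplication by `g_i`, by additivity of logarithmic
-- derivatives; the constant `u` has derivative zero. Only the residues of the exponents modulo `p`
-- matter.
lemma locComb_eq {i : Fin s} {u : L} (hu : u ≠ 0) {w : Fin r → ℕ}
    (h : (g i).map (algebraMap F[X] L) = C u * ∏ j, (fl j).map (algebraMap R L) ^ w j) :
    locComb f fl (fun j => (w j : ZMod p)) = (logDer c g i).map (algebraMap F[X] R) := by
  have h1 := prod_mul_sum_logDeriv (f := f.map (algebraMap F[X] L))
    (q := fun j => (fl j).map (algebraMap R L))
    (x := fun j => (locLogDer f fl j).map (algebraMap R L)) (fun j => by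
      rw [← Polynomial.map_mul, D.mul_locLogDer, Polynomial.map_mul, map_map_algebraMap,
        derivative_map]) w Finset.univ
  have h2 : f.map (algebraMap F[X] L) * derivative ((g i).map (algebraMap F[X] L)) =
      (g i).map (algebraMap F[X] L) * (logDer c g i).map (algebraMap F[X] L) := by
    rw [derivative_map, ← Polynomial.map_mul, ← Polynomial.map_mul]
    congr 1
    conv_lhs => rw [← H.cofactor_mul i]
    rw [logDer]
    ring
  have hg : (g i).map (algebraMap F[X] L) ≠ 0 := by
    rw [h]
    exact mul_ne_zero (C_ne_zero.mpr hu) (Finset.prod_ne_zero_iff.mpr fun j _ =>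
      pow_ne_zero _ (D.prime_map L j).ne_zero)
  have h3 : ∑ j, (w j : L[X]) * (locLogDer f fl j).map (algebraMap R L) =
      (logDer c g i).map (algebraMap F[X] L) := by
    refine mul_left_cancel₀ hg ?_
    rw [← h2, h, derivative_C_mul]
    linear_combination C u * h1
  refine map_injective _ (IsFractionRing.injective R L) ?_
  rw [map_map_algebraMap, ← h3, locComb, Polynomial.map_sum]
  refine Finset.sum_congr rfl fun j _ => ?_
  simp

variable {h : F[X][X]} {w : Fin r → ZMod p} {i : Fin s} {j : Fin r} {π : F[X]}
  (hj : fl j ∣ (g i).map (algebraMap F[X] R))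
  {B : R[X]} (hB : h.map (algebraMap F[X] R) = locComb f fl w + C (algebraMap F[X] R π) * B)
include hj hB

omit [IsDomain R] [FaithfulSMul F[X] R] [IsIntegrallyClosed R] in
-- With `w j = 0`, all summands of `locComb` at nonzero coefficients contain `f_j`, so `g_i` and `h`
-- both lie in the ideal `(f_j, π)`. Their resultant is a constant in this ideal and therefore a
-- multiple of `π`; its degree is too small unless it is zero.
lemma dvd_of_apply_eq_zero (hw : w j = 0) (hd : h.natDegree ≤ f.natDegree - 1)
    (ht : tdeg h ≤ tdeg f) (hσ : (2 * f.natDegree - 1) * tdeg f < π.natDegree)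
    (hπ : ∀ x, algebraMap F[X] R π ∣ algebraMap F[X] R x → π ∣ x) : toK (g i) ∣ toK h := by
  refine dvd_of_resultant_eq_zero (H.irreducible_toK i) hd ?_
  obtain ⟨P, Q, -, -, h1⟩ := exists_mul_add_mul_eq_C_resultant (g i) h le_rfl hd
    (.inl (H.pos i).ne')
  have h2 := congrArg (Polynomial.map (algebraMap F[X] R)) h1
  obtain ⟨G, hG⟩ := hj
  obtain ⟨A, hA⟩ := dvd_locComb_sub f fl w j
  rw [hw, map_zero, map_zero, C_0, zero_mul, sub_zero] at hA
  rw [Polynomial.map_add, Polynomial.map_mul, Polynomial.map_mul, map_C, hG, hB, hA] at h2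
  have h3 := hπ _ (dvd_of_C_eq_add (D.monic j) (D.natDegree_pos j)
    (P := G * P.map (algebraMap F[X] R) + A * Q.map (algebraMap F[X] R))
    (Q := B * Q.map (algebraMap F[X] R)) (by rw [← h2]; ring))
  refine eq_zero_of_dvd_of_natDegree_lt h3 (lt_of_le_of_lt ?_ hσ)
  have hgi : tdeg (g i) ≤ tdeg f := by
    have h4 := H.f_ne_zero
    rw [← H.cofactor_mul i] at h4
    rw [← H.cofactor_mul i, tdeg_mul (left_ne_zero_of_mul h4) (right_ne_zero_of_mul h4)]
    exact Nat.le_add_left _ _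
  have hn : (g i).natDegree ≤ f.natDegree := natDegree_le_of_dvd (H.dvd i) H.f_ne_zero
  -- The formal degrees `deg g_i ≤ n` and `n - 1` produce the factor `2n - 1` of the hypothesis.
  refine (natDegree_resultant_le hgi ht).trans ?_
  rw [← add_mul]
  exact Nat.mul_le_mul_right _ (by have := H.pos i; omega)

variable {v : F[X]} (hsep : ∃ P Q E : F[X][X], P * f + Q * derivative f = 1 + C v * E)
  (hv : ¬ algebraMap F[X] R v ∣ 1) (hvπ : v ∣ π)
include hsep hv hvπ

omit [IsDomain R] [FaithfulSMul F[X] R] [IsIntegrallyClosed R] H in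
variable (L) in
include L in
-- If `w j ≠ 0`, then `f_j ∣ h` gives `f_j ∣ Φ(f_j)` modulo `v`. Since `Φ(f_j) ≡ f'` modulo `f_j`,
-- the factor `f_j` would divide `f` and `f'` modulo `v`, against the Bézout relation.
lemma apply_eq_zero_of_dvd (hd : toK (g i) ∣ toK h) : w j = 0 := by
  by_contra hw
  have h1 : fl j ∣ h.map (algebraMap F[X] R) := by
    have h2 := Polynomial.map_dvd (algebraMap (RatFunc F) L) hd
    rw [map_toK, map_toK, ← map_map_algebraMap R L, ← map_map_algebraMap R L] at h2
    exact (D.dvd_iff_map L).mpr (((D.dvd_iff_map L).mp hj).trans h2)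
  obtain ⟨P, Q, E, hE⟩ := hsep
  obtain ⟨A, hA⟩ := dvd_locComb_sub f fl w j
  obtain ⟨N, hN⟩ := h1
  obtain ⟨T, hT⟩ := D.dvd_derivative_sub j
  obtain ⟨y, rfl⟩ := hvπ
  have hE' := congrArg (Polynomial.map (algebraMap F[X] R)) hE
  simp only [Polynomial.map_add, Polynomial.map_mul, map_C, Polynomial.map_one] at hE'
  rw [← derivative_map] at hE'
  have hu : C (algebraMap F[X] R (algebraMap (ZMod p) F[X] (w j)⁻¹)) *
      C (algebraMap F[X] R (algebraMap (ZMod p) F[X] (w j))) = 1 := by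
    rw [← C_mul, ← map_mul, ← map_mul, inv_mul_cancel₀ hw, map_one, map_one, C_1]
  rw [map_mul, C_mul] at hB
  -- The Bézout relation, with `f` and `f'` expressed through `f_j`, `v` and `h`, exhibits `1` in
  -- the ideal `(f_j, v)`.
  refine hv (dvd_of_C_eq_add (D.monic j) (D.natDegree_pos j) (x := 1)
    (P := P.map (algebraMap F[X] R) * locCofactor f fl j + Q.map (algebraMap F[X] R) *
      (T + C (algebraMap F[X] R (algebraMap (ZMod p) F[X] (w j)⁻¹)) * (N - A)))
    (Q := -E.map (algebraMap F[X] R) - Q.map (algebraMap F[X] R) *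
      C (algebraMap F[X] R (algebraMap (ZMod p) F[X] (w j)⁻¹)) *
        C (algebraMap F[X] R y) * B) ?_)
  rw [C_1]
  linear_combination -hE' - P.map (algebraMap F[X] R) * D.locCofactor_mul j +
    Q.map (algebraMap F[X] R) * hT - Q.map (algebraMap F[X] R) * locLogDer f fl j * hu +
    Q.map (algebraMap F[X] R) *
      C (algebraMap F[X] R (algebraMap (ZMod p) F[X] (w j)⁻¹)) * (hN - hB - hA)

end IsLocalData
end loc
end FactorFqt


/-! ### Comparison of the spaces `L'` and `W` -/

namespace FactorFqt

section spaces
variable {F : Type u} [Field F] {v : F[X]} {hv : Irreducible v} {f : F[X][X]} {r : ℕ}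
  {fl : Fin r → (Ov v hv)[X]}

lemma IsLocalFactorization.isLocalData (h : IsLocalFactorization v hv f fl) :
    IsLocalData f fl :=
  ⟨fun j => (h.1 j).1, fun j => (h.1 j).2, h.2⟩

lemma IsLocalData.Phi_eq (D : IsLocalData f fl) (j : Fin r) :
    Phi v hv f (fl j) = locLogDer f fl j := by
  rw [Phi, ← D.mul_locLogDer j, mul_divByMonic_cancel_left _ (D.monic j)]

lemma degree_modPow (ℓ : ℕ) (a : Ov v hv) : (modPow v hv ℓ a).degree < (v ^ ℓ).degree :=
  (existsUnique_lift v hv ℓ a).choose_spec.1.1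

lemma dvd_sub_modPow (ℓ : ℕ) (a : Ov v hv) :
    algebraMap F[X] (Ov v hv) (v ^ ℓ) ∣ a - algebraMap F[X] (Ov v hv) (modPow v hv ℓ a) :=
  (existsUnique_lift v hv ℓ a).choose_spec.1.2

variable (v hv f fl) in
/-- `Φ(f_j) mod v ^ ℓ`. -/
noncomputable def liftLogDer (ℓ : ℕ) (j : Fin r) : F[X][X] :=
  ∑ i ∈ Finset.range f.natDegree, monomial i (coeffA v hv f fl ℓ i j)

lemma coeff_liftLogDer (ℓ : ℕ) (j : Fin r) (i : ℕ) : (liftLogDer v hv f fl ℓ j).coeff i =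
    if i < f.natDegree then coeffA v hv f fl ℓ i j else 0 := by
  simp [liftLogDer, finsetSum_coeff, coeff_monomial]

lemma IsLocalData.dvd_sub_map_liftLogDer (D : IsLocalData f fl) (hf : f ≠ 0) (ℓ : ℕ) (j : Fin r) :
    C (algebraMap F[X] (Ov v hv) (v ^ ℓ)) ∣
      (liftLogDer v hv f fl ℓ j).map (algebraMap F[X] (Ov v hv)) - locLogDer f fl j := by
  rw [C_dvd_iff_dvd_coeff]
  intro i
  rw [coeff_sub, coeff_map, coeff_liftLogDer]
  split_ifs with hi
  · rw [← dvd_neg, neg_sub, coeffA, D.Phi_eq]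
    exact dvd_sub_modPow ℓ _
  · rw [coeff_eq_zero_of_degree_lt ((D.degree_locLogDer hf j).trans_le
      (by exact_mod_cast not_lt.mp hi)), map_zero, sub_zero]
    exact dvd_zero _

variable {p : ℕ} [hp : Fact p.Prime] [Algebra (ZMod p) F]

variable (v hv f fl) in
/-- Linear combinations of the polynomials `Φ(f_j) mod v ^ ℓ`. -/
noncomputable def liftComb (ℓ : ℕ) (w : Fin r → ZMod p) : F[X][X] :=
  ∑ j, w j • liftLogDer v hv f fl ℓ j

lemma coeff_liftComb (ℓ : ℕ) (w : Fin r → ZMod p) (i : ℕ) : (liftComb v hv f fl ℓ w).coeff i =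
    if i < f.natDegree then ∑ j, w j • coeffA v hv f fl ℓ i j else 0 := by
  simp only [liftComb, finsetSum_coeff, coeff_smul, coeff_liftLogDer]
  split_ifs <;> simp

lemma degree_coeff_liftComb (ℓ : ℕ) (w : Fin r → ZMod p) (i : ℕ) :
    ((liftComb v hv f fl ℓ w).coeff i).degree < (v ^ ℓ).degree := by
  rw [coeff_liftComb]
  have h0 : (⊥ : WithBot ℕ) < (v ^ ℓ).degree :=
    bot_lt_iff_ne_bot.mpr (degree_ne_bot.mpr (pow_ne_zero _ hv.ne_zero))
  split_ifs
  · refine (degree_sum_le _ _).trans_lt ((Finset.sup_lt_iff h0).mpr fun j _ => ?_)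
    exact (degree_smul_le _ _).trans_lt (degree_modPow ℓ _)
  · rwa [degree_zero]

/-- The combination with coefficients in `𝔽_p` commutes with taking `γ`-coordinates, so the matrices
annihilate `w` exactly when the coefficients of `t ^ (deg_t f + 1), …, t ^ (σ - 1)` vanish. Beyond
`σ - 1` there are none. -/
lemma mem_spaceL' {m : ℕ} (γ : Module.Basis (Fin m) (ZMod p) F) (ℓ : ℕ) (w : Fin r → ZMod p) :
    w ∈ spaceL' γ v hv f fl ℓ ↔ tdeg (liftComb v hv f fl ℓ w) ≤ tdeg f := by
  have h1 : w ∈ spaceL' γ v hv f fl ℓ ↔ ∀ (i : Fin f.natDegree)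
      (k : Fin ((v ^ ℓ).natDegree - (degT f + 1))),
        (∑ j, w j • coeffA v hv f fl ℓ i j).coeff (degT f + 1 + k) = 0 := by
    simp only [spaceL', Submodule.mem_iInf, LinearMap.mem_ker, Matrix.mulVecLin_apply]
    refine forall_congr' fun i => ?_
    rw [funext_iff, Prod.forall]
    refine forall_congr' fun k => ?_
    rw [← γ.repr.map_eq_zero_iff, DFunLike.ext_iff]
    refine forall_congr' fun l => ?_
    simp [Matrix.mulVec, dotProduct, matAtilde, matA, finsetSum_coeff, mul_comm]
  rw [h1, tdeg_le_iff]
  constructor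
  · intro h i
    rw [natDegree_le_iff_coeff_eq_zero]
    intro k hk
    by_cases hi : i < f.natDegree
    · by_cases hk' : k < (v ^ ℓ).natDegree
      · have := h ⟨i, hi⟩ ⟨k - (degT f + 1), by rw [← tdeg_eq_degT]; omega⟩
        simp only [← tdeg_eq_degT] at this
        rwa [show tdeg f + 1 + (k - (tdeg f + 1)) = k by omega, ← if_pos (c := i < f.natDegree)
          (t := ∑ j, w j • coeffA v hv f fl ℓ i j) (e := 0) hi, ← coeff_liftComb] at this
      · refine coeff_eq_zero_of_degree_lt ((degree_coeff_liftComb ℓ w i).trans_le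
          (degree_le_natDegree.trans ?_))
        exact_mod_cast not_lt.mp hk'
    · rw [coeff_liftComb, if_neg hi, coeff_zero]
  · intro h i k
    have := h i
    rw [coeff_liftComb, if_pos i.2] at this
    have e := tdeg_eq_degT f
    exact coeff_eq_zero_of_natDegree_lt (by omega)

lemma IsLocalData.exists_map_liftComb (D : IsLocalData f fl) (hf : f ≠ 0) (ℓ : ℕ)
    (w : Fin r → ZMod p) : ∃ B, (liftComb v hv f fl ℓ w).map (algebraMap F[X] (Ov v hv)) =
      locComb f fl w + C (algebraMap F[X] (Ov v hv) (v ^ ℓ)) * B := by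
  have h : C (algebraMap F[X] (Ov v hv) (v ^ ℓ)) ∣
      (liftComb v hv f fl ℓ w).map (algebraMap F[X] (Ov v hv)) - locComb f fl w := by
    rw [liftComb, locComb, Polynomial.map_sum, ← Finset.sum_sub_distrib]
    refine Finset.dvd_sum fun j _ => ?_
    rw [← algebraMap_smul F[X] (w j), smul_eq_C_mul, Polynomial.map_mul, map_C, ← mul_sub]
    exact (D.dvd_sub_map_liftLogDer hf ℓ j).mul_left _
  obtain ⟨B, hB⟩ := h
  exact ⟨B, by rw [← hB]; ring⟩

/-- Two polynomials that are congruent modulo `v ^ ℓ` and have `t`-degree less than `σ` are equal.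
-/
lemma IsLocalData.liftComb_eq (D : IsLocalData f fl) (hf : f ≠ 0) {ℓ : ℕ} {w : Fin r → ZMod p}
    {x : F[X][X]} (h : locComb f fl w = x.map (algebraMap F[X] (Ov v hv)))
    (hx : tdeg x < (v ^ ℓ).natDegree) : liftComb v hv f fl ℓ w = x := by
  obtain ⟨B, hB⟩ := D.exists_map_liftComb hf ℓ w
  ext1 i
  rw [← sub_eq_zero]
  refine eq_zero_of_dvd_of_degree_lt (p := v ^ ℓ) ?_ ?_
  · rw [← algebraMap_pow_dvd_iff v hv, map_sub, ← coeff_map, ← coeff_map, hB, h, coeff_add,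
      add_sub_cancel_left, coeff_C_mul]
    exact dvd_mul_right _ _
  · refine (degree_sub_le _ _).trans_lt (max_lt (degree_coeff_liftComb ℓ w i) ?_)
    rw [degree_eq_natDegree (pow_ne_zero ℓ hv.ne_zero)]
    refine degree_le_natDegree.trans_lt ?_
    exact_mod_cast (tdeg_le_iff.mp le_rfl i).trans_lt hx

lemma exists_bezout {R : Type*} [CommRing R] {v : R} {f : R[X]}
    (h : (f.map (Ideal.Quotient.mk (Ideal.span {v}))).Separable) :
    ∃ P Q E : R[X], P * f + Q * derivative f = 1 + C v * E := by
  obtain ⟨P', Q', hPQ⟩ := h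
  obtain ⟨P, rfl⟩ := map_surjective _ Ideal.Quotient.mk_surjective P'
  obtain ⟨Q, rfl⟩ := map_surjective _ Ideal.Quotient.mk_surjective Q'
  rw [derivative_map, ← Polynomial.map_mul, ← Polynomial.map_mul, ← Polynomial.map_add,
    ← Polynomial.map_one (Ideal.Quotient.mk (Ideal.span {v})), ← sub_eq_zero,
    ← Polynomial.map_sub] at hPQ
  have h1 : C v ∣ P * f + Q * derivative f - 1 := by
    rw [C_dvd_iff_dvd_coeff]
    intro i
    have := congrArg (fun x => coeff x i) hPQ
    simp only [coeff_map, coeff_zero] at this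
    rwa [Ideal.Quotient.eq_zero_iff_mem, Ideal.mem_span_singleton] at this
  obtain ⟨E, hE⟩ := h1
  exact ⟨P, Q, E, by rw [← hE]; ring⟩

variable {m : ℕ} (γ : Module.Basis (Fin m) (ZMod p) F) (hf : (toK f).Separable)
  (D : IsLocalData f fl) {ℓ : ℕ}
  (hσ : (2 * f.natDegree - 1) * tdeg f < (v ^ ℓ).natDegree)
include hf D hσ

/-- A monic irreducible factor over `K` is some `g_i` up to a constant, and its exponent vector
gives the combination `logDer c g i`, which has `t`-degree at most `deg_t f < σ`. -/
lemma spaceW_le_spaceL' : spaceW p v hv f fl ≤ spaceL' γ v hv f fl ℓ := by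
  obtain ⟨s, c, g, H⟩ := exists_isFactorData hf
  rw [spaceW, Submodule.span_le]
  rintro _ ⟨q, w, hq, hqi, hqd, hw, rfl⟩
  have hd : q ∣ C (algebraMap F[X] (RatFunc F) c) * ∏ i, toK (g i) := by
    convert hqd using 1
    conv_rhs => rw [H.eq]
    rw [toK, Polynomial.map_mul, map_C, Polynomial.map_prod]
    rfl
  have hc : algebraMap F[X] (RatFunc F) c ≠ 0 := by
    rw [Ne, map_eq_zero_iff _ algebraMap_ratFunc_injective]
    exact H.ne_zero
  obtain ⟨i, -, hi⟩ := (hqi.prime.dvd_finsetProd_iff _).mp ((hqi.prime.dvd_or_dvd hd).resolve_left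
    fun h => hqi.not_isUnit (isUnit_of_dvd_unit h (isUnit_C.mpr hc.isUnit)))
  obtain ⟨y, hy⟩ := hi
  have hyu := ((H.irreducible_toK i).isUnit_or_isUnit hy).resolve_left hqi.not_isUnit
  obtain ⟨u, hu, rfl⟩ := isUnit_iff.mp hyu
  have h1 := congrArg (Polynomial.map (algebraMap (RatFunc F) (Kv v hv))) hy
  rw [map_toK, Polynomial.map_mul, map_C, mul_comm, hw] at h1
  have h2 := D.locComb_eq (p := p) H (by simpa using hu.ne_zero) h1
  have hn : 1 ≤ f.natDegree := (H.pos i).trans_le (natDegree_le_of_dvd (H.dvd i) H.f_ne_zero)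
  have h3 : tdeg f < (v ^ ℓ).natDegree := by
    refine lt_of_le_of_lt ?_ hσ
    exact Nat.le_mul_of_pos_left _ (by omega)
  rw [SetLike.mem_coe, mem_spaceL', D.liftComb_eq H.f_ne_zero h2 ((H.tdeg_logDer i).trans_lt h3)]
  exact H.tdeg_logDer i

/-- A vector that is constant on the classes of local factors below each `g_i` is a combination of
the class indicators, which lie in `W`. -/
lemma spaceL'_le_spaceW (hsep : (f.map (Ideal.Quotient.mk (Ideal.span {v}))).Separable) :
    spaceL' γ v hv f fl ℓ ≤ spaceW p v hv f fl := by
  classical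
  obtain ⟨s, c, g, H⟩ := exists_isFactorData hf
  obtain ⟨I, hI, hg⟩ := D.exists_partition (Kv v hv) H hf
  obtain ⟨ind, hind⟩ : ∃ ind : Fin s → Fin r → ZMod p, ind = fun i j => if I j = i then 1 else 0 :=
    ⟨_, rfl⟩
  have h1 : ∀ i, ind i ∈ spaceW p v hv f fl := by
    intro i
    have h0 : algebraMap F[X] (RatFunc F) (g i).leadingCoeff ≠ 0 := by
      rw [Ne, map_eq_zero_iff _ algebraMap_ratFunc_injective]
      exact leadingCoeff_ne_zero.mpr (H.irreducible i).ne_zero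
    obtain ⟨a, ha⟩ : ∃ a, a = (algebraMap F[X] (RatFunc F) (g i).leadingCoeff)⁻¹ := ⟨_, rfl⟩
    have hu : IsUnit (C a) := isUnit_C.mpr (ha ▸ inv_ne_zero h0).isUnit
    refine Submodule.subset_span ⟨C a * toK (g i), fun j => if I j = i then 1 else 0, ?_,
      (irreducible_isUnit_mul hu).mpr (H.irreducible_toK i), ?_, ?_, ?_⟩
    · rw [Monic, leadingCoeff_mul, leadingCoeff_C, toK,
        leadingCoeff_map_of_injective algebraMap_ratFunc_injective, ha, inv_mul_cancel₀ h0]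
    · exact (hu.mul_left_dvd).mpr (Polynomial.map_dvd _ (H.dvd i))
    · rw [IsExponentVector, Polynomial.map_mul, map_C, map_toK, hg i, ← mul_assoc, ← C_mul,
        IsScalarTower.algebraMap_apply F[X] (RatFunc F) (Kv v hv), ← map_mul, ha,
        inv_mul_cancel₀ h0, map_one, C_1, one_mul, Finset.prod_filter]
      refine Finset.prod_congr rfl fun j _ => ?_
      split_ifs <;> simp
    · rw [hind]
      funext j
      dsimp only
      split_ifs <;> simp
  -- Zero at one member of a class implies zero at all of them: the first forces `g_i ∣ h_w`, and
  -- this forces the others.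
  have h2 : ∀ w ∈ spaceL' γ v hv f fl ℓ, ∀ j k, I j = I k → w j = 0 → w k = 0 := by
    intro w hw j k hjk hj
    rw [mem_spaceL'] at hw
    obtain ⟨B, hB⟩ := D.exists_map_liftComb H.f_ne_zero ℓ w
    have hd : (liftComb v hv f fl ℓ w).natDegree ≤ f.natDegree - 1 := by
      rw [natDegree_le_iff_coeff_eq_zero]
      intro i hi
      rw [coeff_liftComb, if_neg (by omega)]
    have h3 := D.dvd_of_apply_eq_zero H (hI j) hB hj hd hw hσ
      fun x hx => (algebraMap_pow_dvd_iff v hv ℓ x).mp hx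
    refine D.apply_eq_zero_of_dvd (Kv v hv) (hjk ▸ hI k) hB (exists_bezout hsep) ?_ ?_ h3
    · have := algebraMap_pow_dvd_iff v hv 1 1
      rw [pow_one, map_one] at this
      rw [this]
      exact fun h => hv.not_isUnit (isUnit_of_dvd_one h)
    · refine dvd_pow_self v ?_
      -- For `ℓ = 0` the degree `σ` is zero, which the strict inequality excludes.
      rintro rfl
      simp at hσ
  intro w hw
  obtain ⟨t, ht⟩ : ∃ t : Fin s → ZMod p, ∀ j, t (I j) = w j := by
    have h3 : ∀ i, ∃ a, ∀ j, I j = i → w j = a := by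
      intro i
      by_cases h : ∃ k, I k = i
      · obtain ⟨k, rfl⟩ := h
        refine ⟨w k, fun j hj => ?_⟩
        -- Subtracting `w k` times the class indicator keeps the vector in `L'`, by the other
        -- inclusion, and makes its entry at `k` zero.
        have h4 := h2 (w - w k • ind (I k)) (sub_mem hw (Submodule.smul_mem _ _
          (spaceW_le_spaceL' γ hf D hσ (h1 (I k))))) k j hj.symm (by simp [hind])
        simpa [hind, hj, sub_eq_zero] using h4
      · exact ⟨0, fun j hj => absurd ⟨j, hj⟩ h⟩
    choose t ht using h3
    exact ⟨t, fun j => (ht (I j) j rfl).symm⟩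
  have h5 : w = ∑ i, t i • ind i := by
    funext j
    simp [hind, ht]
  rw [h5]
  exact sum_mem fun i _ => Submodule.smul_mem _ _ (h1 i)

end spaces
end FactorFqt

theorem mainTheorem4 :
    (∀ (p m : ℕ) [Fact p.Prime] (F : Type u) [Field F] [Finite F] [Algebra (ZMod p) F]
      (γ : Module.Basis (Fin m) (ZMod p) F)
      (f : F[X][X]) (_ : (FactorFqt.toK f).Separable)
      (v : F[X]) (hv : Irreducible v)
      (_ : ¬ v ∣ f.leadingCoeff)
      (_ : (f.map (Ideal.Quotient.mk (Ideal.span {v}))).Separable)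
      (r : ℕ) (fl : Fin r → (FactorFqt.Ov v hv)[X])
      (_ : FactorFqt.IsLocalFactorization v hv f fl)
      (ℓ : ℕ) (_ : (2 * f.natDegree - 1) * FactorFqt.degT f < (v ^ ℓ).natDegree),
      FactorFqt.spaceL' γ v hv f fl ℓ = FactorFqt.spaceW p v hv f fl) ∧
    ∃ c : FactorFqt.Prog, FactorFqt.FactorsInPolyTime.{u} c := by
  refine ⟨fun p m _ F _ _ _ γ f hf v hv _ hsep r fl hfl ℓ hσ => ?_,
    FactorFqt.exists_factorsInPolyTime.{u}⟩
  rw [← FactorFqt.tdeg_eq_degT] at hσ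
  exact le_antisymm (FactorFqt.spaceL'_le_spaceW γ hf hfl.isLocalData hσ hsep)
    (FactorFqt.spaceW_le_spaceL' γ hf hfl.isLocalData hσ)
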